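/- Let $\Gamma\subset\mathbb R^N$ be bounded and measurable, and let $\rho\in L^\infty(\Gamma)$, $\rho\ge 0$, be a probability density on $\Gamma$ (with respect to Lebesgue measure); $L^2_\rho$ denotes the $L^2$ space for the measure $\rho(y)\,dx\,dy$ on $\mathbb R\times\Gamma$. Let $a>0$ and let $f\in C^2(\mathbb R)$ satisfy $f(0)=f'(0)=0$ and $-a<f'(u)<a$ for all $u\in\mathbb R$. Put $A=\begin{bmatrix}-a&1\\-a&-1\end{bmatrix}$. On $\mathbb R^2$ use the maximum norm $|(u,v)|=\max\{|u|,|v|\}$, let $\|A^{-1}\|$ be the operator norm induced by it, and let $\|g\|_\infty=\operatorname{ess\,sup}|g|$ for $\mathbb R^2$-valued $g$. For all $\varepsilon,\nu>0$ let $U_0^{\varepsilon,\nu}:\mathbb R\times\Gamma\to\mathbb R^2$ be such that $U_0^{\varepsilon,\nu}$ and its weak derivatives $\partial_xU_0^{\varepsilon,\nu}$, $\partial_{xx}U_0^{\varepsilon,\nu}$ belong to $[L^2_\rho(\mathbb R\times\Gamma)]^2\cap[L^\infty(\mathbb R\times\Gamma)]^2$, and assume that, with $\|\cdot\|=\|\cdot\|_{L^\infty(\mathbb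 R\times\Gamma)}+\|\cdot\|_{L^2_\rho(\mathbb R\times\Gamma)}$, $$\|U_0^{\varepsilon,\nu}\|+\|\partial_xU_0^{\varepsilon,\nu}\|+\|\partial_{xx}U_0^{\varepsilon,\nu}\|\le C$$ with a constant $C$ independent of $\varepsilon,\nu$. Then for all $\varepsilon,\nu>0$ the system $$\partial_tu+\partial_xv=\nu\,\partial_{xx}u,\qquad \partial_tv+a^2\partial_xu+\tfrac1\varepsilon\bigl(v-f(u)\bigr)=\nu\,\partial_{xx}v,\qquad (u,v)|_{t=0}=U_0^{\varepsilon,\nu},$$ has a unique global classical solution $U^{\varepsilon,\nu}=(u,v)$ on $\mathbb R\times[0,\infty)\times\Gamma$ satisfying $$U^{\varepsilon,\nu},\ \partial_tU^{\varepsilon,\nu},\ \partial_xU^{\varepsilon,\nu},\ \partial_{xx}U^{\varepsilon,\nu}\in L^\infty\bigl((0,\infty);[L^2_\rho(\mathbb R\times\Gamma)]^2\bigr)\cap[L^\infty(\mathbb R\times(0,\infty)\times\Gamma)]^2 .$$ Here a global classical solution is a function that, for almost every $y\in\Gamma$, is continuous in $(x,t)\in\mathbb R\times[0,\infty)$, has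 continuous $\partial_t,\partial_x,\partial_{xx}$ on $\mathbb R\times(0,\infty)$, satisfies the equations at every point of $\mathbb R\times(0,\infty)$, and equals the continuous representative of $U_0^{\varepsilon,\nu}(\cdot,y)$ at $t=0$; uniqueness means that two such solutions agree for almost every $y\in\Gamma$ at all $(x,t)\in\mathbb R\times[0,\infty)$. Moreover, for all $\varepsilon,\nu>0$, $$\|U^{\varepsilon,\nu}\|_{\infty}\le\|A^{-1}\|\Bigl(\beta+\max\bigl\{|f(-\beta/a)|,\ |f(\beta/a)|\bigr\}\Bigr),\qquad \beta:=\sup_{\varepsilon,\nu>0}\|AU_0^{\varepsilon,\nu}\|_\infty .$$ -/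

import Mathlib

open MeasureTheory Set
open scoped ENNReal ContDiff

noncomputable section

namespace ViscousPSystem

/-- States `U = (u, v)`; the norm on this space is the maximum norm `max |u| |v|`. -/
abbrev State : Type := Fin 2 → ℝ

/-- `ρ` is an essentially bounded probability density on the parameter set `Γ`. -/
structure IsBoundedDensity {N : ℕ} (Γ : Set (Fin N → ℝ)) (ρ : (Fin N → ℝ) → ℝ) : Prop where
  nonneg : ∀ y ∈ Γ, 0 ≤ ρ y
  bounded : MemLp ρ ⊤ (volume.restrict Γ)
  mass : ∫ y in Γ, ρ y = 1

/-- The measure `ρ(y) dy` on `Γ`. -/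
def densityMeasure {N : ℕ} (Γ : Set (Fin N → ℝ)) (ρ : (Fin N → ℝ) → ℝ) : Measure (Fin N → ℝ) :=
  (volume.restrict Γ).withDensity (fun y => ENNReal.ofReal (ρ y))

/-- Lebesgue measure `dx dy` on `ℝ × Γ`. -/
def spaceMeasure {N : ℕ} (Γ : Set (Fin N → ℝ)) : Measure (ℝ × (Fin N → ℝ)) :=
  (volume : Measure ℝ).prod (volume.restrict Γ)

/-- The weighted measure `ρ(y) dx dy` on `ℝ × Γ`. -/
def weightedMeasure {N : ℕ} (Γ : Set (Fin N → ℝ)) (ρ : (Fin N → ℝ) → ℝ) :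
    Measure (ℝ × (Fin N → ℝ)) :=
  (volume : Measure ℝ).prod (densityMeasure Γ ρ)

/-- Lebesgue measure `dx dt dy` on `ℝ × (0,∞) × Γ`. -/
def spaceTimeMeasure {N : ℕ} (Γ : Set (Fin N → ℝ)) : Measure (ℝ × ℝ × (Fin N → ℝ)) :=
  (volume : Measure ℝ).prod ((volume.restrict (Ioi (0 : ℝ))).prod (volume.restrict Γ))

/-- The norm `‖g‖ = ‖g‖_{L^∞(ℝ × Γ)} + ‖g‖_{L²_ρ(ℝ × Γ)}`. -/
def dataNorm {N : ℕ} (Γ : Set (Fin N → ℝ)) (ρ : (Fin N → ℝ) → ℝ)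
    (g : ℝ × (Fin N → ℝ) → State) : ℝ≥0∞ :=
  eLpNorm g ⊤ (spaceMeasure Γ) + eLpNorm g 2 (weightedMeasure Γ ρ)

/-- `g ∈ L²_ρ(ℝ × Γ)² ∩ L^∞(ℝ × Γ)²`. -/
def MemL2Linfty {N : ℕ} (Γ : Set (Fin N → ℝ)) (ρ : (Fin N → ℝ) → ℝ)
    (g : ℝ × (Fin N → ℝ) → State) : Prop :=
  MemLp g 2 (weightedMeasure Γ ρ) ∧ MemLp g ⊤ (spaceMeasure Γ)

/-- `g'` is the weak (distributional) derivative of `g` on the real line. -/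
def HasWeakDeriv (g g' : ℝ → State) : Prop :=
  LocallyIntegrable g volume ∧ LocallyIntegrable g' volume ∧
    ∀ φ : ℝ → ℝ, ContDiff ℝ ∞ φ → HasCompactSupport φ →
      ∫ x, deriv φ x • g x = -∫ x, φ x • g' x

/-- `g'` is the weak partial derivative `∂ₓ g` on `ℝ × Γ`. -/
def HasWeakDerivX {N : ℕ} (Γ : Set (Fin N → ℝ)) (g g' : ℝ × (Fin N → ℝ) → State) : Prop :=
  ∀ᵐ y ∂(volume.restrict Γ), HasWeakDeriv (fun x => g (x, y)) (fun x => g' (x, y))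

/-- The partial derivatives of a function of `(x, t)`. -/
def dt (u : ℝ → ℝ → State) (x t : ℝ) : State := deriv (fun s => u x s) t

def dx (u : ℝ → ℝ → State) (x t : ℝ) : State := deriv (fun z => u z t) x

def dxx (u : ℝ → ℝ → State) (x t : ℝ) : State := deriv (fun z => dx u z t) x

/-- `u = (u₁, u₂)` is a global classical solution, for one fixed parameter, of
`∂ₜ u₁ + ∂ₓ u₂ = ν ∂ₓₓ u₁`, `∂ₜ u₂ + a² ∂ₓ u₁ + (u₂ - f(u₁)) / ε = ν ∂ₓₓ u₂`
with initial data `u₀`: it is continuous on `ℝ × [0,∞)`, has continuous `∂ₜ, ∂ₓ, ∂ₓₓ` on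
`ℝ × (0,∞)`, satisfies the equations at every point there, and its trace at `t = 0` is (the
continuous representative of) `u₀`. -/
structure IsClassicalSolution (a ε ν : ℝ) (f : ℝ → ℝ) (u₀ : ℝ → State) (u : ℝ → ℝ → State) :
    Prop where
  continuousOn : ContinuousOn (fun p : ℝ × ℝ => u p.1 p.2) {p | 0 ≤ p.2}
  differentiable_t : ∀ x t, 0 < t → DifferentiableAt ℝ (fun s => u x s) t
  differentiable_x : ∀ x t, 0 < t → DifferentiableAt ℝ (fun z => u z t) x
  differentiable_xx : ∀ x t, 0 < t → DifferentiableAt ℝ (fun z => dx u z t) x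
  continuousOn_dt : ContinuousOn (fun p : ℝ × ℝ => dt u p.1 p.2) {p | 0 < p.2}
  continuousOn_dx : ContinuousOn (fun p : ℝ × ℝ => dx u p.1 p.2) {p | 0 < p.2}
  continuousOn_dxx : ContinuousOn (fun p : ℝ × ℝ => dxx u p.1 p.2) {p | 0 < p.2}
  eq_fst : ∀ x t, 0 < t → dt u x t 0 + dx u x t 1 = ν * dxx u x t 0
  eq_snd : ∀ x t, 0 < t →
    dt u x t 1 + a ^ 2 * dx u x t 0 + (1 / ε) * (u x t 1 - f (u x t 0)) = ν * dxx u x t 1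
  initial : ∀ᵐ x, u x 0 = u₀ x

/-- `U(x,t,y)` is a global classical solution of the viscous system on `ℝ × [0,∞) × Γ` with initial
data `U₀(x,y)`. As `U₀` is given up to null sets only, so is the set of parameters `y`. -/
def IsGlobalClassicalSolution {N : ℕ} (Γ : Set (Fin N → ℝ)) (a ε ν : ℝ) (f : ℝ → ℝ)
    (U₀ : ℝ × (Fin N → ℝ) → State) (U : ℝ → ℝ → (Fin N → ℝ) → State) : Prop :=
  ∀ᵐ y ∂(volume.restrict Γ),
    IsClassicalSolution a ε ν f (fun x => U₀ (x, y)) (fun x t => U x t y)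

/-- `G ∈ L^∞((0,∞); L²_ρ(ℝ × Γ)²) ∩ L^∞(ℝ × (0,∞) × Γ)²`. -/
def MemSolutionClass {N : ℕ} (Γ : Set (Fin N → ℝ)) (ρ : (Fin N → ℝ) → ℝ)
    (G : ℝ → ℝ → (Fin N → ℝ) → State) : Prop :=
  MemLp (fun p : ℝ × ℝ × (Fin N → ℝ) => G p.1 p.2.1 p.2.2) ⊤ (spaceTimeMeasure Γ) ∧
    ∃ M : ℝ, ∀ᵐ t ∂(volume.restrict (Ioi (0 : ℝ))),
      MemLp (fun p : ℝ × (Fin N → ℝ) => G p.1 t p.2) 2 (weightedMeasure Γ ρ) ∧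
      eLpNorm (fun p : ℝ × (Fin N → ℝ) => G p.1 t p.2) 2 (weightedMeasure Γ ρ)
        ≤ ENNReal.ofReal M

/-- `U`, `∂ₜ U`, `∂ₓ U`, `∂ₓₓ U` all belong to
`L^∞((0,∞); L²_ρ(ℝ × Γ)²) ∩ L^∞(ℝ × (0,∞) × Γ)²`. -/
structure HasSolutionRegularity {N : ℕ} (Γ : Set (Fin N → ℝ)) (ρ : (Fin N → ℝ) → ℝ)
    (U : ℝ → ℝ → (Fin N → ℝ) → State) : Prop where
  mem : MemSolutionClass Γ ρ U
  mem_dt : MemSolutionClass Γ ρ (fun x t y => dt (fun x t => U x t y) x t)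
  mem_dx : MemSolutionClass Γ ρ (fun x t y => dx (fun x t => U x t y) x t)
  mem_dxx : MemSolutionClass Γ ρ (fun x t y => dxx (fun x t => U x t y) x t)

/-- The matrix `A` with `A (u, v) = (-a u + v, -a u - v)`. -/
def riemannMatrix (a : ℝ) : Matrix (Fin 2) (Fin 2) ℝ := !![-a, 1; -a, -1]

/-- The operator norm of a matrix induced by the maximum norm on `ℝ²`. -/
def maxOpNorm (M : Matrix (Fin 2) (Fin 2) ℝ) : ℝ :=
  ‖LinearMap.toContinuousLinearMap (Matrix.toLin' M)‖

/-- `β = sup_{ε, ν > 0} ‖A U₀^{ε,ν}‖_{L^∞(ℝ × Γ)}` (a finite number for uniformly bounded data). -/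
def supData {N : ℕ} (Γ : Set (Fin N → ℝ)) (a : ℝ) (U₀ : ℝ → ℝ → ℝ × (Fin N → ℝ) → State) : ℝ :=
  (⨆ (ε : ℝ) (ν : ℝ) (_ : 0 < ε) (_ : 0 < ν),
    eLpNorm (fun p => (riemannMatrix a).mulVec (U₀ ε ν p)) ⊤ (spaceMeasure Γ)).toReal

end ViscousPSystem

end

/-! The system is a two-speed kinetic (BGK) model in disguise. With `p = (u - v/a)/2` and `q = (u +
v/a)/2` it decouples, up to the relaxation terms, into `∂ₜp = a ∂ₓp + ν ∂ₓₓp + κ (M₁(u) - p)` and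
`∂ₜq = -a ∂ₓq + ν ∂ₓₓq + κ (M₂(u) - q)`, where `κ = 1/ε`, `u = p + q` and `M₁, M₂ = (u ∓ f(u)/a)/2`.
The condition `-a < f' < a` says exactly that `M₁` and `M₂` are strictly increasing; they sum to
`u`, hence are 1-Lipschitz, and vanish at `0`. Everything follows from this monotonicity.

Existence: the mild formulation (damped heat flow of the data plus a Duhamel integral) is a fixed
point equation for `u` alone. In a sup norm with weight `exp (3κt)` the map contracts by `1/2`, so
Picard iterates converge for all times at once (`density_eq`). The semigroup is written as a
Gaussian average. Gaussian integration by parts moves one `x`-derivative onto the kernel at the cost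
of an integrable `τ^(-1/2)`, so the fixed point is automatically `C¹` in `x`; the second derivative
is shared between kernel and source, and `∂ₜ` follows by Fubini and the fundamental theorem of
calculus.

Sup bound: `A U = -2a (p, q)`, so `‖A U₀‖ ≤ β` means `|p|, |q| ≤ b/2` at time zero with `b = β/a`.
The constants `±b` are sub- and supersolutions because `M₁(±b) + M₂(±b) = ±b`. Hence `|u| ≤ b`, and
each component is an average of its data and of values of `Mᵢ` on `[-b, b]`, which is the stated
bound.

`L²` bound uniform in time: a Gronwall argument would only give growth in time. Instead, for every
level `k` the Kružkov-type functional `∫ (p - M₁(k))⁺ + (q - M₂(k))⁺` never exceeds its initial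
value (`excess_kineticComponents_le`). Integrating it over `k` on both sides of zero gives an
entropy comparable to the squared `L²` norm (`sqNorm_kineticComponents_le`). Derivative bounds then
follow from the finite mass of the damped kernels.

Uniqueness: differences of bounded solutions solve a weakly coupled linear inequality in the
variables `p, q`, and a maximum principle on the half plane makes them vanish.

Dependence on `y`: the data have `C^{1,1}` representatives for almost every `y`; joint measurability
comes from local averages, Picard limits and difference quotients. -/

namespace ViscousPSystem
open Filter Topology ProbabilityTheory

/-! ### Gaussian averages and integration by parts -/

/-- The standard Gaussian measure on the line. -/
noncomputable abbrev stdGaussian : Measure ℝ := gaussianReal 0 1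

lemma integrable_abs_stdGaussian : Integrable (fun z : ℝ => |z|) stdGaussian := by
  have h : MemLp id 1 stdGaussian := by simpa using memLp_id_gaussianReal (μ := 0) (v := 1) 1
  exact (memLp_one_iff_integrable.1 h).abs

lemma integrable_id_stdGaussian : Integrable (fun z : ℝ => z) stdGaussian := by
  have h : MemLp id 1 stdGaussian := by simpa using memLp_id_gaussianReal (μ := 0) (v := 1) 1
  exact (memLp_one_iff_integrable.1 h)

lemma integrable_sq_stdGaussian : Integrable (fun z : ℝ => z ^ 2) stdGaussian := by
  have h : MemLp id 2 stdGaussian := by simpa using memLp_id_gaussianReal (μ := 0) (v := 1) 2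
  exact h.integrable_sq

lemma stdGaussian_density_hasDerivAt (z : ℝ) :
    HasDerivAt (gaussianPDFReal 0 1) (-z * gaussianPDFReal 0 1 z) z := by
  have h1 : HasDerivAt (fun x : ℝ => -(x - 0) ^ 2 / (2 * ((1 : NNReal) : ℝ))) (-z) z := by
    have := (((hasDerivAt_id z).sub_const 0).pow 2).neg.div_const (2 * ((1 : NNReal) : ℝ))
    refine this.congr_deriv ?_
    simp
    ring
  have h2 := (h1.exp).const_mul (√(2 * Real.pi * ((1 : NNReal) : ℝ)))⁻¹
  rw [gaussianPDFReal_def]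
  refine h2.congr_deriv ?_
  ring

lemma integrable_stdGaussian_iff {g : ℝ → ℝ} :
    Integrable g stdGaussian ↔ Integrable (fun z => gaussianPDFReal 0 1 z * g z) := by
  rw [stdGaussian, gaussianReal_of_var_ne_zero 0 one_ne_zero,
    integrable_withDensity_iff_integrable_smul' (measurable_gaussianPDF 0 1)
      (Eventually.of_forall fun _ => gaussianPDF_lt_top)]
  simp [toReal_gaussianPDF]

lemma abs_le_linear_growth {H h : ℝ → ℝ} {B : ℝ} (hH : ∀ z, HasDerivAt H (h z) z)
    (hB : ∀ z, |h z| ≤ B) (x y : ℝ) : |H y - H x| ≤ B * |y - x| := by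
  have := Convex.norm_image_sub_le_of_norm_hasDerivWithin_le (f := H) (f' := h) (C := B)
    (s := univ) (x := x) (y := y) (fun x _ => (hH x).hasDerivWithinAt)
    (fun x _ => hB x) convex_univ (mem_univ _) (mem_univ _)
  simpa using this

/-- Gaussian integration by parts. -/
lemma stein_identity {H h : ℝ → ℝ} {B : ℝ} (hH : ∀ z, HasDerivAt H (h z) z)
    (hc : Continuous h) (hB : ∀ z, |h z| ≤ B) :
    ∫ z, h z ∂stdGaussian = ∫ z, z * H z ∂stdGaussian := by
  have hHc : Continuous H := continuous_iff_continuousAt.2 fun z => (hH z).continuousAt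
  have hB0 : 0 ≤ B := (abs_nonneg _).trans (hB 0)
  -- A bounded derivative gives linear growth, so `z * H z` is dominated by first and second
  -- Gaussian moments.
  have hg (z : ℝ) : |H z| ≤ |H 0| + B * |z| := by
    have h1 := abs_le_linear_growth hH hB 0 z
    have h2 : |H z| ≤ |H z - H 0| + |H 0| := by
      simpa using abs_add_le (H z - H 0) (H 0)
    simp only [sub_zero] at h1
    linarith
  have i1 : Integrable h stdGaussian :=
    Integrable.of_bound hc.aestronglyMeasurable B (Eventually.of_forall hB)
  have i2 : Integrable H stdGaussian := by
    refine ((integrable_const |H 0|).add (integrable_abs_stdGaussian.const_mul B)).mono'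
      hHc.aestronglyMeasurable (Eventually.of_forall hg)
  have i3 : Integrable (fun z => z * H z) stdGaussian := by
    refine ((integrable_abs_stdGaussian.const_mul |H 0|).add
      (integrable_sq_stdGaussian.const_mul B)).mono'
      (continuous_id.mul hHc).aestronglyMeasurable (Eventually.of_forall fun z => ?_)
    have := mul_le_mul_of_nonneg_left (hg z) (abs_nonneg z)
    simp only [Real.norm_eq_abs, abs_mul, Pi.add_apply]
    refine this.trans (le_of_eq ?_)
    rw [← sq_abs z]
    ring
  have j1 := integrable_stdGaussian_iff.1 i1
  have j2 := integrable_stdGaussian_iff.1 i2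
  have j3 := integrable_stdGaussian_iff.1 i3
  -- With `φ` the density and `φ' = -zφ`, one has `(φH)' = φh - zφH`. Integrability of `φH` and of
  -- its derivative removes the boundary terms.
  have key := integral_eq_zero_of_hasDerivAt_of_integrable
    (f := fun z => gaussianPDFReal 0 1 z * H z)
    (f' := fun z => gaussianPDFReal 0 1 z * h z - gaussianPDFReal 0 1 z * (z * H z))
    (fun z => by
      refine ((stdGaussian_density_hasDerivAt z).mul (hH z)).congr_deriv ?_
      ring) (j1.sub j3) j2
  rw [integral_sub j1 j3, sub_eq_zero] at key
  rw [integral_gaussianReal_eq_integral_smul one_ne_zero,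
    integral_gaussianReal_eq_integral_smul one_ne_zero]
  simpa using key

/-- Scaled form of `stein_identity`. -/
lemma stein_identity_scaled {H h : ℝ → ℝ} {B : ℝ} (hH : ∀ z, HasDerivAt H (h z) z)
    (hc : Continuous h) (hB : ∀ z, |h z| ≤ B) {σ : ℝ} (hσ : σ ≠ 0) (x : ℝ) :
    ∫ z, h (x + σ * z) ∂stdGaussian = ∫ z, z / σ * H (x + σ * z) ∂stdGaussian := by
  have h1 (z : ℝ) : HasDerivAt (fun z => H (x + σ * z) / σ) (h (x + σ * z)) z := by
    have h2 : HasDerivAt (fun z : ℝ => x + σ * z) σ z := by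
      simpa using ((hasDerivAt_id z).const_mul σ).const_add x
    have := ((hH (x + σ * z)).comp z h2).div_const σ
    refine this.congr_deriv ?_
    field_simp
  rw [stein_identity h1 (by fun_prop) (fun z => hB _)]
  congr 1; ext z; ring

/-- Gaussian averages of a bounded continuous function are differentiable. -/
lemma hasDerivAt_gaussian_average {h : ℝ → ℝ} {B : ℝ} (hc : Continuous h)
    (hB : ∀ z, |h z| ≤ B) {σ : ℝ} (hσ : σ ≠ 0) (x : ℝ) :
    HasDerivAt (fun x => ∫ z, h (x + σ * z) ∂stdGaussian)
      (∫ z, z / σ * h (x + σ * z) ∂stdGaussian) x := by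
  -- `h` need not be differentiable. Its primitive `H` is: Stein's identity rewrites the average in
  -- terms of `H`, and differentiating under the integral turns `H` back into `h`, leaving the
  -- factor `z / σ`.
  set H : ℝ → ℝ := fun x => ∫ y in (0 : ℝ)..x, h y
  have hH (z : ℝ) : HasDerivAt H (h z) z :=
    intervalIntegral.integral_hasDerivAt_right (hc.intervalIntegrable _ _)
      hc.aestronglyMeasurable.stronglyMeasurableAtFilter hc.continuousAt
  have hHc : Continuous H := continuous_iff_continuousAt.2 fun z => (hH z).continuousAt
  have e : (fun x => ∫ z, h (x + σ * z) ∂stdGaussian) =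
      fun x => ∫ z, z / σ * H (x + σ * z) ∂stdGaussian := by
    ext x; exact stein_identity_scaled hH hc hB hσ x
  rw [e]
  have hB0 : 0 ≤ B := (abs_nonneg _).trans (hB 0)
  refine (hasDerivAt_integral_of_dominated_loc_of_deriv_le (μ := stdGaussian) (s := univ)
    (F := fun x z => z / σ * H (x + σ * z)) (F' := fun x z => z / σ * h (x + σ * z))
    (bound := fun z => |z| * (B / |σ|)) univ_mem ?_ ?_ ?_ ?_ ?_ ?_).2
  · exact Eventually.of_forall fun x => Continuous.aestronglyMeasurable (by fun_prop)
  · have hg (z : ℝ) : |H (x + σ * z)| ≤ |H x| + B * |σ| * |z| := by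
      have h1 := abs_le_linear_growth hH hB x (x + σ * z)
      have h2 : |H (x + σ * z)| ≤ |H (x + σ * z) - H x| + |H x| := by
        simpa using abs_add_le (H (x + σ * z) - H x) (H x)
      rw [add_sub_cancel_left, abs_mul] at h1
      linarith
    refine ((integrable_abs_stdGaussian.const_mul (|H x| / |σ|)).add
      (integrable_sq_stdGaussian.const_mul B)).mono'
      (Continuous.aestronglyMeasurable (by fun_prop)) (Eventually.of_forall fun z => ?_)
    have := mul_le_mul_of_nonneg_left (hg z) (abs_nonneg (z / σ))
    simp only [Real.norm_eq_abs, abs_mul, Pi.add_apply]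
    refine this.trans (le_of_eq ?_)
    have : |σ| ≠ 0 := abs_ne_zero.2 hσ
    rw [← sq_abs z, abs_div]
    field_simp
  · exact Continuous.aestronglyMeasurable (by fun_prop)
  · refine Eventually.of_forall fun z x _ => ?_
    rw [Real.norm_eq_abs, abs_mul, abs_div, div_mul_eq_mul_div, ← mul_div_assoc]
    gcongr
    exact hB _
  · exact integrable_abs_stdGaussian.mul_const _
  · refine Eventually.of_forall fun z x _ => ?_
    have h2 : HasDerivAt (fun x : ℝ => x + σ * z) 1 x := (hasDerivAt_id x).add_const _
    have := ((hH (x + σ * z)).comp x h2).const_mul (z / σ)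
    simpa using this

end ViscousPSystem

/-! ### The advection-diffusion semigroup and the exponential delay weights -/

namespace ViscousPSystem
open Filter Topology ProbabilityTheory

/-- The semigroup of `∂ₜ w = c ∂ₓ w + ν ∂ₓₓ w`, as a Gaussian average. -/
noncomputable def driftHeat (ν c : ℝ) (w : ℝ → ℝ) (x t : ℝ) : ℝ :=
  ∫ z, w (x + c * t + √(2 * ν * t) * z) ∂stdGaussian

/-- The `x`-derivative of `driftHeat`, with the derivative falling on the Gaussian. -/
noncomputable def driftHeatDx (ν c : ℝ) (w : ℝ → ℝ) (x t : ℝ) : ℝ :=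
  ∫ z, z / √(2 * ν * t) * w (x + c * t + √(2 * ν * t) * z) ∂stdGaussian

section driftHeat

variable {ν c B : ℝ} {w w' : ℝ → ℝ}

lemma integrable_gaussian_shift (hw : Continuous w) (hB : ∀ x, |w x| ≤ B) (x σ : ℝ) :
    Integrable (fun z => w (x + σ * z)) stdGaussian :=
  Integrable.of_bound (Continuous.aestronglyMeasurable (by fun_prop)) B
    (Eventually.of_forall fun _ => hB _)

lemma abs_driftHeat_le (hB : ∀ x, |w x| ≤ B) (x t : ℝ) : |driftHeat ν c w x t| ≤ B := by
  have := norm_integral_le_of_norm_le_const (μ := stdGaussian) (C := B)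
    (f := fun z => w (x + c * t + √(2 * ν * t) * z)) (Eventually.of_forall fun z => hB _)
  simpa [driftHeat] using this

lemma driftHeat_zero (x : ℝ) : driftHeat ν c w x 0 = w x := by simp [driftHeat]

lemma continuous_driftHeat (hw : Continuous w) (hB : ∀ x, |w x| ≤ B) :
    Continuous fun p : ℝ × ℝ => driftHeat ν c w p.1 p.2 := by
  unfold driftHeat
  refine continuous_of_dominated (bound := fun _ => B) ?_ ?_ (integrable_const _) ?_
  · exact fun p => Continuous.aestronglyMeasurable (by fun_prop)
  · exact fun p => Eventually.of_forall fun z => hB _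
  · exact Eventually.of_forall fun z => by fun_prop

lemma continuous_driftHeat_comp {X : Type*} [TopologicalSpace X] (hw : Continuous w)
    (hB : ∀ x, |w x| ≤ B) {g h : X → ℝ} (hg : Continuous g) (hh : Continuous h) :
    Continuous fun p : X => driftHeat ν c w (g p) (h p) :=
  (continuous_driftHeat hw hB).comp (hg.prodMk hh)

lemma hasDerivAt_driftHeat (hw : ∀ x, HasDerivAt w (w' x) x) (hwB : ∀ x, |w x| ≤ B)
    (hw' : Continuous w') {B' : ℝ} (hB' : ∀ x, |w' x| ≤ B') (x t : ℝ) :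
    HasDerivAt (fun x => driftHeat ν c w x t) (driftHeat ν c w' x t) x := by
  have hwc : Continuous w := continuous_iff_continuousAt.2 fun z => (hw z).continuousAt
  unfold driftHeat
  refine (hasDerivAt_integral_of_dominated_loc_of_deriv_le (μ := stdGaussian) (s := univ)
    (F' := fun x z => w' (x + c * t + √(2 * ν * t) * z)) (bound := fun z => B') univ_mem ?_ ?_ ?_ ?_ ?_ ?_).2
  · exact Eventually.of_forall fun x => Continuous.aestronglyMeasurable (by fun_prop)
  · exact integrable_gaussian_shift hwc hwB _ _
  · exact Continuous.aestronglyMeasurable (by fun_prop)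
  · exact Eventually.of_forall fun z x _ => hB' _
  · exact integrable_const _
  · refine Eventually.of_forall fun z x _ => ?_
    have h2 : HasDerivAt (fun x : ℝ => x + c * t + √(2 * ν * t) * z) 1 x :=
      ((hasDerivAt_id x).add_const _).add_const _
    simpa [Function.comp_def] using (hw _).comp x h2

/-- The derivative falls on the Gaussian, so continuity of `w` suffices. The price is a factor of
order `t^(-1/2)`, which confines the statement to positive times but stays integrable in `t`. -/
lemma hasDerivAt_driftHeat_smoothing (hw : Continuous w) (hB : ∀ x, |w x| ≤ B) (hν : 0 < ν)
    (x : ℝ) {t : ℝ} (ht : 0 < t) :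
    HasDerivAt (fun x => driftHeat ν c w x t) (driftHeatDx ν c w x t) x := by
  have hσ : √(2 * ν * t) ≠ 0 := (Real.sqrt_pos.2 (by positivity)).ne'
  have := (hasDerivAt_gaussian_average hw hB hσ (x + c * t)).comp x
    ((hasDerivAt_id x).add_const (c * t))
  simpa [Function.comp_def, driftHeat, driftHeatDx] using this

lemma continuousOn_driftHeatDx (hν : 0 < ν) (hw : Continuous w) (hB : ∀ x, |w x| ≤ B) :
    ContinuousOn (fun p : ℝ × ℝ => driftHeatDx ν c w p.1 p.2) {p | 0 < p.2} := by
  have e : (fun p : ℝ × ℝ => driftHeatDx ν c w p.1 p.2) = fun p =>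
      (√(2 * ν * p.2))⁻¹ *
        ∫ z, z * w (p.1 + c * p.2 + √(2 * ν * p.2) * z) ∂stdGaussian := by
    ext p
    rw [driftHeatDx, ← integral_const_mul]
    congr 1; ext z; ring
  rw [e]
  refine ContinuousOn.mul ?_ (Continuous.continuousOn ?_)
  · refine ContinuousOn.inv₀ (Continuous.continuousOn (by fun_prop)) fun p hp => ?_
    exact (Real.sqrt_pos.2 (mul_pos (by positivity) hp)).ne'
  · refine continuous_of_dominated (bound := fun z => |z| * B) ?_ ?_
      (integrable_abs_stdGaussian.mul_const _) ?_
    · exact fun p => Continuous.aestronglyMeasurable (by fun_prop)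
    · refine fun p => Eventually.of_forall fun z => ?_
      rw [Real.norm_eq_abs, abs_mul]
      exact mul_le_mul_of_nonneg_left (hB _) (abs_nonneg _)
    · exact Eventually.of_forall fun z => by fun_prop

/-- `driftHeat` solves the advection-diffusion equation. -/
lemma hasDerivAt_driftHeat_time (hν : 0 < ν) (hw : ∀ x, HasDerivAt w (w' x) x)
    (hwB : ∀ x, |w x| ≤ B) (hw' : Continuous w') {B' : ℝ} (hB' : ∀ x, |w' x| ≤ B') (x : ℝ)
    {t : ℝ} (ht : 0 < t) :
    HasDerivAt (fun t => driftHeat ν c w x t)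
      (c * driftHeat ν c w' x t + ν * driftHeatDx ν c w' x t) t := by
  have hwc : Continuous w := continuous_iff_continuousAt.2 fun z => (hw z).continuousAt
  have hB0 : 0 ≤ B' := (abs_nonneg _).trans (hB' 0)
  have hσ : √(2 * ν * t) ≠ 0 := (Real.sqrt_pos.2 (by positivity)).ne'
  -- The point `x + c t + √(2νt) z` moves with velocity `c + ν z / √(2νt)`. Tested against `w'`, the
  -- noise part is `ν` times the smoothed derivative of `w'`, which is the term `ν ∂ₓₓ`.
  have e : c * driftHeat ν c w' x t + ν * driftHeatDx ν c w' x t =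
      ∫ z, w' (x + c * t + √(2 * ν * t) * z) * (c + ν / √(2 * ν * t) * z) ∂stdGaussian := by
    rw [driftHeat, driftHeatDx, ← integral_const_mul, ← integral_const_mul, ← integral_add]
    · congr 1; ext z; ring
    · exact (integrable_gaussian_shift hw' hB' _ _).const_mul _
    · refine Integrable.const_mul ?_ _
      refine (integrable_abs_stdGaussian.mul_const (B' / √(2 * ν * t))).mono'
        (Continuous.aestronglyMeasurable (by fun_prop)) (Eventually.of_forall fun z => ?_)
      rw [Real.norm_eq_abs, abs_mul, abs_div, abs_of_nonneg (Real.sqrt_nonneg _), div_mul_eq_mul_div,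
        ← mul_div_assoc]
      gcongr
      exact hB' _
  rw [e]
  unfold driftHeat
  -- The velocity `ν / √(2νs)` blows up as `s → 0`; on `s > t/2` it is dominated by its value at
  -- `t/2`.
  have hs : Ioi (t / 2) ∈ 𝓝 t := Ioi_mem_nhds (by linarith)
  refine (hasDerivAt_integral_of_dominated_loc_of_deriv_le (μ := stdGaussian) (s := Ioi (t / 2))
    (F' := fun t z => w' (x + c * t + √(2 * ν * t) * z) * (c + ν / √(2 * ν * t) * z))
    (bound := fun z => B' * (|c| + ν / √(2 * ν * (t / 2)) * |z|)) hs ?_ ?_ ?_ ?_ ?_ ?_).2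
  · exact Eventually.of_forall fun x => Continuous.aestronglyMeasurable (by fun_prop)
  · exact integrable_gaussian_shift hwc hwB _ _
  · exact Continuous.aestronglyMeasurable (by fun_prop)
  · refine Eventually.of_forall fun z s hs => ?_
    have hs' : t / 2 < s := hs
    have h0 : 0 < √(2 * ν * (t / 2)) := Real.sqrt_pos.2 (by positivity)
    rw [Real.norm_eq_abs, abs_mul]
    refine mul_le_mul (hB' _) ?_ (abs_nonneg _) hB0
    refine (abs_add_le _ _).trans ?_
    rw [abs_mul, abs_div, abs_of_nonneg hν.le, abs_of_nonneg (Real.sqrt_nonneg _)]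
    gcongr
  · exact ((integrable_const _).add (integrable_abs_stdGaussian.const_mul _)).const_mul _
  · refine Eventually.of_forall fun z s hs => ?_
    have hs0 : 0 < s := (by linarith : 0 < t / 2).trans hs
    have h1 : HasDerivAt (fun t : ℝ => √(2 * ν * t)) (ν / √(2 * ν * s)) s := by
      have := ((hasDerivAt_id s).const_mul (2 * ν)).sqrt
        (mul_pos (by positivity) hs0).ne'
      refine this.congr_deriv ?_
      simp only [id]
      field_simp
    have h2 : HasDerivAt (fun t : ℝ => x + c * t + √(2 * ν * t) * z)
        (c + ν / √(2 * ν * s) * z) s := by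
      have := (((hasDerivAt_id s).const_mul c).const_add x).add (h1.mul_const z)
      rw [mul_one] at this
      exact this
    exact (hw _).comp s h2

end driftHeat

/-- Product of Lebesgue measure in the delay variable and the standard Gaussian. -/
noncomputable abbrev delayMeasure : Measure (ℝ × ℝ) := (volume.restrict (Ioi (0 : ℝ))).prod stdGaussian

/-- The exponential delay density. -/
noncomputable def expWeight (κ : ℝ) (p : ℝ × ℝ) : ℝ := κ * Real.exp (-κ * p.1)

/-- The exponential delay density with the factor produced by an `x`-derivative. -/
noncomputable def expWeightDx (κ ν : ℝ) (p : ℝ × ℝ) : ℝ :=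
  κ * Real.exp (-κ * p.1) * (p.2 / √(2 * ν * p.1))

lemma integrableOn_exp_decay {κ : ℝ} (hκ : 0 < κ) :
    IntegrableOn (fun τ : ℝ => κ * Real.exp (-κ * τ)) (Ioi 0) :=
  (exp_neg_integrableOn_Ioi 0 hκ).const_mul κ

lemma integrable_expWeight {κ : ℝ} (hκ : 0 < κ) : Integrable (expWeight κ) delayMeasure := by
  refine ((integrableOn_exp_decay hκ).mul_prod
    (integrable_const (1 : ℝ) (μ := stdGaussian))).congr (Eventually.of_forall fun p => ?_)
  simp [expWeight]

/-- The singularity `τ^(-1/2)` is integrable at zero and the damping controls infinity. All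
derivative bounds uniform in time rest on this. -/
lemma integrableOn_exp_decay_div_sqrt {κ ν : ℝ} (hκ : 0 < κ) (hν : 0 < ν) :
    IntegrableOn (fun τ : ℝ => κ * Real.exp (-κ * τ) / √(2 * ν * τ)) (Ioi 0) := by
  have h := (integrableOn_rpow_mul_exp_neg_mul_rpow (s := -(1 / 2 : ℝ)) (p := 1) (b := κ)
    (by norm_num) one_pos hκ).const_mul (κ / √(2 * ν))
  refine IntegrableOn.congr_fun h (fun τ hτ => ?_) measurableSet_Ioi
  have hτ' : (0 : ℝ) < τ := hτ
  simp only [Real.rpow_one]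
  rw [show √(2 * ν * τ) = √(2 * ν) * √τ from Real.sqrt_mul (by positivity) τ,
    Real.rpow_neg hτ'.le, ← Real.sqrt_eq_rpow]
  field_simp

lemma integrable_expWeightDx {κ ν : ℝ} (hκ : 0 < κ) (hν : 0 < ν) :
    Integrable (expWeightDx κ ν) delayMeasure := by
  refine ((integrableOn_exp_decay_div_sqrt hκ hν).mul_prod integrable_id_stdGaussian).congr
    (Eventually.of_forall fun p => ?_)
  simp only [expWeightDx]
  ring

lemma measurable_expWeight (κ : ℝ) : Measurable (expWeight κ) := by
  unfold expWeight; fun_prop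

lemma measurable_expWeightDx (κ ν : ℝ) : Measurable (expWeightDx κ ν) := by
  unfold expWeightDx; fun_prop

end ViscousPSystem

/-! ### The Duhamel operator in delay and noise variables -/

namespace ViscousPSystem
open Filter Topology ProbabilityTheory

/-- The integrand of `duhamel`. -/
noncomputable def duhamelIntegrand (ν c : ℝ) (ϖ : ℝ × ℝ → ℝ) (F : ℝ → ℝ → ℝ) (x t : ℝ)
    (p : ℝ × ℝ) : ℝ :=
  if p.1 < t then ϖ p * F (x + c * p.1 + √(2 * ν * p.1) * p.2) (t - p.1) else 0

/-- The Duhamel integral of a source `F` against a weight `ϖ` in the delay and noise variables. -/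
noncomputable def duhamel (ν c : ℝ) (ϖ : ℝ × ℝ → ℝ) (F : ℝ → ℝ → ℝ) (x t : ℝ) : ℝ :=
  ∫ p, duhamelIntegrand ν c ϖ F x t p ∂delayMeasure

section duhamel

variable {ν c B κ : ℝ} {ϖ : ℝ × ℝ → ℝ} {F F' : ℝ → ℝ → ℝ}

lemma measurable_duhamelIntegrand (hϖ : Measurable ϖ) (hF : Measurable (Function.uncurry F))
    (x t : ℝ) : Measurable (duhamelIntegrand ν c ϖ F x t) := by
  have h : Measurable fun p : ℝ × ℝ => F (x + c * p.1 + √(2 * ν * p.1) * p.2) (t - p.1) :=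
    hF.comp (by fun_prop : Measurable fun p : ℝ × ℝ =>
      (x + c * p.1 + √(2 * ν * p.1) * p.2, t - p.1))
  exact Measurable.ite (measurableSet_lt measurable_fst measurable_const) (hϖ.mul h)
    measurable_const

lemma abs_duhamelIntegrand_le (hB : ∀ x t, |F x t| ≤ B) (x t : ℝ) (p : ℝ × ℝ) :
    |duhamelIntegrand ν c ϖ F x t p| ≤ |ϖ p| * B := by
  have hB0 : 0 ≤ B := (abs_nonneg _).trans (hB 0 0)
  unfold duhamelIntegrand
  split_ifs
  · rw [abs_mul]
    exact mul_le_mul_of_nonneg_left (hB _ _) (abs_nonneg _)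
  · simpa using mul_nonneg (abs_nonneg _) hB0

lemma integrable_duhamelIntegrand (hϖ : Measurable ϖ) (hi : Integrable ϖ delayMeasure)
    (hF : Measurable (Function.uncurry F)) (hB : ∀ x t, |F x t| ≤ B) (x t : ℝ) :
    Integrable (duhamelIntegrand ν c ϖ F x t) delayMeasure :=
  (hi.abs.mul_const B).mono' (measurable_duhamelIntegrand hϖ hF x t).aestronglyMeasurable
    (Eventually.of_forall fun p => abs_duhamelIntegrand_le hB x t p)

lemma abs_duhamel_le (hi : Integrable ϖ delayMeasure) (hB : ∀ x t, |F x t| ≤ B) (x t : ℝ) :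
    |duhamel ν c ϖ F x t| ≤ (∫ p, |ϖ p| ∂delayMeasure) * B := by
  rw [← integral_mul_const]
  exact norm_integral_le_of_norm_le (f := duhamelIntegrand ν c ϖ F x t) (hi.abs.mul_const B)
    (Eventually.of_forall fun p => abs_duhamelIntegrand_le hB x t p)

/-- Delays are almost surely positive, so no delay below `t` remains. This extends Duhamel integrals
by zero and lets later estimates range over all real `t`. -/
lemma duhamel_of_nonpos (x : ℝ) {t : ℝ} (ht : t ≤ 0) : duhamel ν c ϖ F x t = 0 := by
  refine integral_eq_zero_of_ae ?_
  have h : ∀ᵐ p ∂(delayMeasure), p.1 ∈ Ioi (0 : ℝ) :=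
    Measure.quasiMeasurePreserving_fst.ae (ae_restrict_mem measurableSet_Ioi)
  filter_upwards [h] with p hp
  have : ¬ p.1 < t := not_lt.2 (ht.trans (le_of_lt hp))
  simp [duhamelIntegrand, this]

lemma ae_delay_ne (t : ℝ) : ∀ᵐ p ∂delayMeasure, p.1 ≠ t := by
  refine Measure.quasiMeasurePreserving_fst.ae (p := fun τ : ℝ => τ ≠ t) ?_
  exact ae_restrict_of_ae (by simp [ae_iff])

/-- The cutoff `τ < t` jumps only at `τ = t`, a null set of delays. At every other delay the
integrand is continuous near the given point, and `|ϖ| * B` dominates. -/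
lemma continuous_duhamel (hϖ : Measurable ϖ) (hi : Integrable ϖ delayMeasure)
    (hF : Continuous (Function.uncurry F)) (hB : ∀ x t, |F x t| ≤ B) :
    Continuous fun q : ℝ × ℝ => duhamel ν c ϖ F q.1 q.2 := by
  refine continuous_iff_continuousAt.2 fun q => ?_
  refine tendsto_integral_filter_of_dominated_convergence (fun p => |ϖ p| * B) ?_ ?_
    (hi.abs.mul_const B) ?_
  · exact Eventually.of_forall fun q =>
      (measurable_duhamelIntegrand hϖ hF.measurable _ _).aestronglyMeasurable
  · exact Eventually.of_forall fun q => Eventually.of_forall fun p =>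
      abs_duhamelIntegrand_le hB _ _ p
  · filter_upwards [ae_delay_ne q.2] with p hp
    rcases lt_or_gt_of_ne hp with h | h
    · have hev : ∀ᶠ r : ℝ × ℝ in 𝓝 q, p.1 < r.2 :=
        (continuous_snd.tendsto q).eventually (lt_mem_nhds h)
      have hc : Continuous fun r : ℝ × ℝ =>
          ϖ p * F (r.1 + c * p.1 + √(2 * ν * p.1) * p.2) (r.2 - p.1) :=
        continuous_const.mul (hF.comp (by fun_prop : Continuous fun r : ℝ × ℝ =>
          (r.1 + c * p.1 + √(2 * ν * p.1) * p.2, r.2 - p.1)))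
      have := hc.tendsto q
      simp only [duhamelIntegrand, h, if_true]
      refine this.congr' ?_
      filter_upwards [hev] with r hr
      simp [hr]
    · have hev : ∀ᶠ r : ℝ × ℝ in 𝓝 q, r.2 < p.1 :=
        (continuous_snd.tendsto q).eventually (gt_mem_nhds h)
      simp only [duhamelIntegrand, not_lt.2 h.le, if_false]
      refine tendsto_const_nhds.congr' ?_
      filter_upwards [hev] with r hr
      simp [not_lt.2 hr.le]

/-- A differentiable source can take the derivative itself, which leaves the weight unchanged and so
creates no new singularity in the delay. -/
lemma hasDerivAt_duhamel (hϖ : Measurable ϖ) (hi : Integrable ϖ delayMeasure)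
    (hF : Measurable (Function.uncurry F)) (hB : ∀ x t, |F x t| ≤ B)
    (hF' : Measurable (Function.uncurry F')) {B' : ℝ} (hB' : ∀ x t, |F' x t| ≤ B')
    (hd : ∀ x t, HasDerivAt (fun x => F x t) (F' x t) x) (x t : ℝ) :
    HasDerivAt (fun x => duhamel ν c ϖ F x t) (duhamel ν c ϖ F' x t) x := by
  refine (hasDerivAt_integral_of_dominated_loc_of_deriv_le (μ := delayMeasure) (s := univ)
    (F := fun x => duhamelIntegrand ν c ϖ F x t) (F' := fun x => duhamelIntegrand ν c ϖ F' x t)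
    (bound := fun p => |ϖ p| * B') univ_mem ?_ ?_ ?_ ?_ ?_ ?_).2
  · exact Eventually.of_forall fun x =>
      (measurable_duhamelIntegrand hϖ hF _ _).aestronglyMeasurable
  · exact integrable_duhamelIntegrand hϖ hi hF hB _ _
  · exact (measurable_duhamelIntegrand hϖ hF' _ _).aestronglyMeasurable
  · exact Eventually.of_forall fun p x _ => abs_duhamelIntegrand_le hB' x t p
  · exact hi.abs.mul_const B'
  · refine Eventually.of_forall fun p x _ => ?_
    unfold duhamelIntegrand
    split_ifs
    · have h2 : HasDerivAt (fun x : ℝ => x + c * p.1 + √(2 * ν * p.1) * p.2) 1 x :=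
        ((hasDerivAt_id x).add_const _).add_const _
      simpa [Function.comp_def] using ((hd _ _).comp x h2).const_mul (ϖ p)
    · exact hasDerivAt_const _ _

lemma duhamel_eq_setIntegral (hϖ : Measurable ϖ) (hi : Integrable ϖ delayMeasure)
    (hF : Measurable (Function.uncurry F)) (hB : ∀ x t, |F x t| ≤ B) (x t : ℝ) :
    duhamel ν c ϖ F x t = ∫ τ in Ioi 0, if τ < t then
      ∫ z, ϖ (τ, z) * F (x + c * τ + √(2 * ν * τ) * z) (t - τ) ∂stdGaussian else 0 := by
  rw [duhamel, integral_prod _ (integrable_duhamelIntegrand hϖ hi hF hB x t)]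
  refine integral_congr_ae (Eventually.of_forall fun τ => ?_)
  simp only [duhamelIntegrand]
  split_ifs <;> simp

lemma setIntegral_ite_lt {g : ℝ → ℝ} {t : ℝ} (ht : 0 ≤ t) :
    (∫ τ in Ioi 0, if τ < t then g τ else 0) = ∫ τ in (0 : ℝ)..t, g τ := by
  have e : (fun τ => if τ < t then g τ else 0) = (Iio t).indicator g := by
    ext τ; simp [indicator]
  rw [e, setIntegral_indicator measurableSet_Iio, Ioi_inter_Iio,
    intervalIntegral.integral_of_le ht, integral_Ioc_eq_integral_Ioo]

lemma duhamel_eq_intervalIntegral (hϖ : Measurable ϖ) (hi : Integrable ϖ delayMeasure)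
    (hF : Measurable (Function.uncurry F)) (hB : ∀ x t, |F x t| ≤ B) (x : ℝ) {t : ℝ}
    (ht : 0 ≤ t) :
    duhamel ν c ϖ F x t = ∫ τ in (0 : ℝ)..t,
      ∫ z, ϖ (τ, z) * F (x + c * τ + √(2 * ν * τ) * z) (t - τ) ∂stdGaussian := by
  rw [duhamel_eq_setIntegral hϖ hi hF hB, setIntegral_ite_lt ht]

lemma continuous_slice (hF : Continuous (Function.uncurry F)) (t : ℝ) :
    Continuous fun x => F x t :=
  hF.comp (by fun_prop : Continuous fun x : ℝ => (x, t))

lemma duhamel_expWeight_eq (hκ : 0 < κ)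
    (hF : Continuous (Function.uncurry F)) (hB : ∀ x t, |F x t| ≤ B) (x t : ℝ) :
    duhamel ν c (expWeight κ) F x t = ∫ τ in Ioi 0, if τ < t then
      κ * Real.exp (-κ * τ) * driftHeat ν c (fun x => F x (t - τ)) x τ else 0 := by
  rw [duhamel_eq_setIntegral (measurable_expWeight κ) (integrable_expWeight hκ) hF.measurable hB]
  simp only [expWeight, driftHeat, integral_const_mul]

/-- For a merely continuous source the integrand is not differentiable for fixed noise, only after
averaging over it. The integral is therefore iterated: the semigroup smoothing is used at each
delay, and differentiation under the integral concerns the delay alone. -/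
lemma hasDerivAt_duhamel_smoothing (hκ : 0 < κ) (hν : 0 < ν)
    (hF : Continuous (Function.uncurry F)) (hB : ∀ x t, |F x t| ≤ B) (x t : ℝ) :
    HasDerivAt (fun x => duhamel ν c (expWeight κ) F x t)
      (duhamel ν c (expWeightDx κ ν) F x t) x := by
  have hB0 : 0 ≤ B := (abs_nonneg _).trans (hB 0 0)
  have hϖi := integrable_expWeightDx hκ hν
  have e1 : (fun x => duhamel ν c (expWeight κ) F x t) = fun x => ∫ τ in Ioi 0,
      ∫ z, duhamelIntegrand ν c (expWeight κ) F x t (τ, z) ∂stdGaussian := by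
    ext x
    exact integral_prod _ (integrable_duhamelIntegrand (measurable_expWeight κ)
      (integrable_expWeight hκ) hF.measurable hB x t)
  have e2 : duhamel ν c (expWeightDx κ ν) F x t = ∫ τ in Ioi 0,
      ∫ z, duhamelIntegrand ν c (expWeightDx κ ν) F x t (τ, z) ∂stdGaussian :=
    integral_prod _ (integrable_duhamelIntegrand (measurable_expWeightDx κ ν)
      hϖi hF.measurable hB x t)
  rw [e1, e2]
  refine (hasDerivAt_integral_of_dominated_loc_of_deriv_le (μ := volume.restrict (Ioi (0 : ℝ)))
    (s := univ)
    (F' := fun x τ => ∫ z, duhamelIntegrand ν c (expWeightDx κ ν) F x t (τ, z) ∂stdGaussian)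
    (bound := fun τ => (∫ z, |expWeightDx κ ν (τ, z)| ∂stdGaussian) * B) univ_mem ?_ ?_ ?_ ?_ ?_ ?_).2
  · exact Eventually.of_forall fun x => (measurable_duhamelIntegrand (measurable_expWeight κ)
      hF.measurable x t).stronglyMeasurable.integral_prod_right'.aestronglyMeasurable
  · exact (integrable_duhamelIntegrand (measurable_expWeight κ)
      (integrable_expWeight hκ) hF.measurable hB x t).integral_prod_left
  · exact (measurable_duhamelIntegrand (measurable_expWeightDx κ ν)
      hF.measurable x t).stronglyMeasurable.integral_prod_right'.aestronglyMeasurable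
  · filter_upwards [hϖi.abs.prod_right_ae] with τ hτ x _
    rw [← integral_mul_const]
    exact norm_integral_le_of_norm_le (hτ.mul_const B)
      (Eventually.of_forall fun z => abs_duhamelIntegrand_le hB x t (τ, z))
  · exact hϖi.abs.integral_prod_left.mul_const B
  · filter_upwards [ae_restrict_mem measurableSet_Ioi] with τ hτ x _
    simp only [duhamelIntegrand]
    split_ifs
    · have := (hasDerivAt_driftHeat_smoothing (c := c) (continuous_slice hF (t - τ))
        (fun x => hB x _) hν x hτ).const_mul (κ * Real.exp (-κ * τ))
      simpa [driftHeat, driftHeatDx, expWeight, expWeightDx, integral_const_mul, mul_assoc]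
        using this
    · simpa using hasDerivAt_const x (0 : ℝ)

lemma integral_exp_decay (κ t : ℝ) :
    ∫ τ in (0 : ℝ)..t, κ * Real.exp (-κ * τ) = 1 - Real.exp (-κ * t) := by
  have h (τ : ℝ) : HasDerivAt (fun τ => -Real.exp (-κ * τ)) (κ * Real.exp (-κ * τ)) τ := by
    have := (((hasDerivAt_id τ).const_mul (-κ)).exp).neg
    refine this.congr_deriv ?_
    simp only [id]; ring
  rw [intervalIntegral.integral_eq_sub_of_hasDerivAt (fun τ _ => h τ)
    (Continuous.intervalIntegrable (by fun_prop) _ _)]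
  simp; ring

/-- The truncated delay weight has mass `1 - exp (-κt)`, the complement of the damping of the free
term. Data and source thus enter with weights summing to one. -/
lemma duhamel_const (hκ : 0 < κ) (m x t : ℝ) :
    duhamel ν c (expWeight κ) (fun _ _ => m) x t = (1 - Real.exp (-κ * max t 0)) * m := by
  rcases le_total t 0 with ht | ht
  · rw [duhamel_of_nonpos x ht, max_eq_right ht]; simp
  · rw [duhamel_eq_intervalIntegral (B := |m|) (measurable_expWeight κ) (integrable_expWeight hκ)
      measurable_const (fun _ _ => le_rfl) x ht, max_eq_left ht, ← integral_exp_decay,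
      ← intervalIntegral.integral_mul_const]
    simp [expWeight]

lemma duhamel_mono {G : ℝ → ℝ → ℝ} {B' : ℝ} (hκ : 0 < κ)
    (hF : Measurable (Function.uncurry F)) (hB : ∀ x t, |F x t| ≤ B)
    (hG : Measurable (Function.uncurry G)) (hB' : ∀ x t, |G x t| ≤ B')
    (h : ∀ x t, F x t ≤ G x t) (x t : ℝ) :
    duhamel ν c (expWeight κ) F x t ≤ duhamel ν c (expWeight κ) G x t := by
  refine integral_mono
    (integrable_duhamelIntegrand (measurable_expWeight κ) (integrable_expWeight hκ) hF hB x t)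
    (integrable_duhamelIntegrand (measurable_expWeight κ) (integrable_expWeight hκ) hG hB' x t)
    fun p => ?_
  simp only [duhamelIntegrand]
  split_ifs
  · exact mul_le_mul_of_nonneg_left (h _ _) (by unfold expWeight; positivity)
  · exact le_rfl

lemma duhamel_sub {G : ℝ → ℝ → ℝ} {B' : ℝ} (hϖ : Measurable ϖ) (hi : Integrable ϖ delayMeasure)
    (hF : Measurable (Function.uncurry F)) (hB : ∀ x t, |F x t| ≤ B)
    (hG : Measurable (Function.uncurry G)) (hB' : ∀ x t, |G x t| ≤ B') (x t : ℝ) :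
    duhamel ν c ϖ F x t - duhamel ν c ϖ G x t =
      duhamel ν c ϖ (fun x t => F x t - G x t) x t := by
  unfold duhamel
  rw [← integral_sub (integrable_duhamelIntegrand hϖ hi hF hB x t)
    (integrable_duhamelIntegrand hϖ hi hG hB' x t)]
  congr 1; ext p
  simp only [duhamelIntegrand]
  split_ifs <;> ring

/-- The contraction estimate for `duhamel` in an exponentially weighted sup norm. -/
lemma abs_duhamel_le_exp {D : ℝ} (hκ : 0 < κ)
    (hD : ∀ x t, |F x t| ≤ D * Real.exp (3 * κ * max t 0)) (x t : ℝ) :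
    |duhamel ν c (expWeight κ) F x t| ≤ D / 4 * Real.exp (3 * κ * max t 0) := by
  have hD0 : 0 ≤ D := by simpa using (abs_nonneg _).trans (hD 0 0)
  rcases le_total t 0 with ht | ht
  · rw [duhamel_of_nonpos x ht]; simp; positivity
  rw [max_eq_left ht]
  -- Since `exp (-κτ) exp (3κ(t-τ)) = exp (3κt) exp (-4κτ)`, the majorant is one quarter of the
  -- exponential probability density of rate `4κ`. This is the source of the factor `1/4`.
  have hi : Integrable (expWeight (4 * κ)) delayMeasure := integrable_expWeight (by positivity)
  have h1 : ∫ p, expWeight (4 * κ) p ∂delayMeasure = 1 := by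
    have e : expWeight (4 * κ) = fun p : ℝ × ℝ =>
        (4 * κ * Real.exp (-(4 * κ) * p.1)) * (1 : ℝ) := by
      ext p; simp [expWeight]
    rw [e, integral_prod_mul (fun τ => 4 * κ * Real.exp (-(4 * κ) * τ)) (fun _ => (1 : ℝ)),
      integral_const_mul, integral_exp_mul_Ioi (by linarith : -(4 * κ) < 0)]
    simp
    field_simp
  have h2 : |duhamel ν c (expWeight κ) F x t| ≤
      ∫ p, D / 4 * Real.exp (3 * κ * t) * expWeight (4 * κ) p ∂delayMeasure := by
    refine norm_integral_le_of_norm_le (f := duhamelIntegrand ν c (expWeight κ) F x t)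
      (hi.const_mul _) (Eventually.of_forall fun p => ?_)
    rw [Real.norm_eq_abs, duhamelIntegrand]
    split_ifs with hp
    · rw [abs_mul, expWeight, abs_of_nonneg (by positivity)]
      refine (mul_le_mul_of_nonneg_left (hD _ _) (by positivity)).trans (le_of_eq ?_)
      rw [max_eq_left (by linarith), expWeight]
      have : Real.exp (3 * κ * (t - p.1)) * Real.exp (-κ * p.1) =
          Real.exp (3 * κ * t) * Real.exp (-(4 * κ) * p.1) := by
        rw [← Real.exp_add, ← Real.exp_add]; ring_nf
      linear_combination (κ * D) * this
    · rw [abs_zero, expWeight]; positivity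
  rwa [integral_const_mul, h1, mul_one] at h2

end duhamel

end ViscousPSystem

/-! ### Time derivative of the Duhamel integral -/

namespace ViscousPSystem
open Filter Topology ProbabilityTheory

section timeDerivative

variable {ν c B B' κ : ℝ} {F F' : ℝ → ℝ → ℝ}

/-- The exponentially damped propagator applied to the time slice `F (·, s)`. -/
noncomputable def dampedHeat (κ ν c : ℝ) (F : ℝ → ℝ → ℝ) (x s τ : ℝ) : ℝ :=
  κ * Real.exp (-κ * τ) * driftHeat ν c (fun x => F x s) x τ

/-- The `τ`-derivative of `dampedHeat` (for `F' = ∂ₓ F`). -/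
noncomputable def dampedHeatDt (κ ν c : ℝ) (F F' : ℝ → ℝ → ℝ) (x s τ : ℝ) : ℝ :=
  κ * Real.exp (-κ * τ) * (-κ * driftHeat ν c (fun x => F x s) x τ +
    c * driftHeat ν c (fun x => F' x s) x τ + ν * driftHeatDx ν c (fun x => F' x s) x τ)

lemma measurable_driftHeat_slice (hF : Measurable (Function.uncurry F)) (x : ℝ) :
    Measurable fun p : ℝ × ℝ => driftHeat ν c (fun x => F x p.1) x p.2 := by
  have : Measurable fun q : (ℝ × ℝ) × ℝ =>
      F (x + c * q.1.2 + √(2 * ν * q.1.2) * q.2) q.1.1 :=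
    hF.comp (by fun_prop : Measurable fun q : (ℝ × ℝ) × ℝ =>
      (x + c * q.1.2 + √(2 * ν * q.1.2) * q.2, q.1.1))
  exact this.stronglyMeasurable.integral_prod_right'.measurable

lemma measurable_driftHeatDx_slice (hF : Measurable (Function.uncurry F)) (x : ℝ) :
    Measurable fun p : ℝ × ℝ => driftHeatDx ν c (fun x => F x p.1) x p.2 := by
  have : Measurable fun q : (ℝ × ℝ) × ℝ => q.2 / √(2 * ν * q.1.2) *
      F (x + c * q.1.2 + √(2 * ν * q.1.2) * q.2) q.1.1 :=
    (by fun_prop : Measurable fun q : (ℝ × ℝ) × ℝ => q.2 / √(2 * ν * q.1.2)).mul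
    (hF.comp (by fun_prop : Measurable fun q : (ℝ × ℝ) × ℝ =>
      (x + c * q.1.2 + √(2 * ν * q.1.2) * q.2, q.1.1)))
  exact this.stronglyMeasurable.integral_prod_right'.measurable

lemma measurable_dampedHeatDt (hF : Measurable (Function.uncurry F))
    (hF' : Measurable (Function.uncurry F')) (x : ℝ) :
    Measurable fun p : ℝ × ℝ => dampedHeatDt κ ν c F F' x p.1 p.2 := by
  unfold dampedHeatDt
  have h1 := measurable_driftHeat_slice (ν := ν) (c := c) hF x
  have h2 := measurable_driftHeat_slice (ν := ν) (c := c) hF' x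
  have h3 := measurable_driftHeatDx_slice (ν := ν) (c := c) hF' x
  exact (by fun_prop : Measurable fun p : ℝ × ℝ => κ * Real.exp (-κ * p.2)).mul
    (((h1.const_mul _).add (h2.const_mul _)).add (h3.const_mul _))

lemma abs_driftHeatDx_le {w : ℝ → ℝ} (hB : ∀ x, |w x| ≤ B) (x t : ℝ) :
    |driftHeatDx ν c w x t| ≤ (∫ z, |z| ∂stdGaussian) * B / √(2 * ν * t) := by
  have h := norm_integral_le_of_norm_le (μ := stdGaussian)
    (f := fun z => z / √(2 * ν * t) * w (x + c * t + √(2 * ν * t) * z))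
    (g := fun z => |z| * (B / √(2 * ν * t))) (integrable_abs_stdGaussian.mul_const _)
    (Eventually.of_forall fun z => by
      rw [Real.norm_eq_abs, abs_mul, abs_div, abs_of_nonneg (Real.sqrt_nonneg _),
        div_mul_eq_mul_div, ← mul_div_assoc]
      gcongr
      exact hB _)
  rw [integral_mul_const, ← mul_div_assoc] at h
  exact h

/-- An integrable majorant of `dampedHeatDt`. -/
noncomputable def dampedHeatBound (κ ν c B B' τ : ℝ) : ℝ :=
  (κ * B + |c| * B') * (κ * Real.exp (-κ * τ)) +
    ν * ((∫ z, |z| ∂stdGaussian) * B') * (κ * Real.exp (-κ * τ) / √(2 * ν * τ))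

lemma integrableOn_dampedHeatBound (hκ : 0 < κ) (hν : 0 < ν) :
    IntegrableOn (dampedHeatBound κ ν c B B') (Ioi 0) :=
  ((integrableOn_exp_decay hκ).const_mul _).add
    ((integrableOn_exp_decay_div_sqrt hκ hν).const_mul _)

lemma abs_dampedHeatDt_le (hκ : 0 < κ) (hν : 0 < ν) (hB : ∀ x t, |F x t| ≤ B)
    (hB' : ∀ x t, |F' x t| ≤ B') (x s τ : ℝ) :
    |dampedHeatDt κ ν c F F' x s τ| ≤ dampedHeatBound κ ν c B B' τ := by
  have h1 := abs_driftHeat_le (ν := ν) (c := c) (fun x => hB x s) x τ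
  have h2 := abs_driftHeat_le (ν := ν) (c := c) (fun x => hB' x s) x τ
  have h3 := abs_driftHeatDx_le (ν := ν) (c := c) (fun x => hB' x s) x τ
  have hE : 0 ≤ κ * Real.exp (-κ * τ) := by positivity
  rw [dampedHeatDt, abs_mul, abs_of_nonneg hE]
  have : |-κ * driftHeat ν c (fun x => F x s) x τ + c * driftHeat ν c (fun x => F' x s) x τ +
      ν * driftHeatDx ν c (fun x => F' x s) x τ| ≤
      κ * B + |c| * B' + ν * ((∫ z, |z| ∂stdGaussian) * B' / √(2 * ν * τ)) := by
    refine (abs_add_three _ _ _).trans ?_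
    rw [abs_mul, abs_mul, abs_mul, abs_neg, abs_of_pos hκ, abs_of_pos hν]
    gcongr
  refine (mul_le_mul_of_nonneg_left this hE).trans (le_of_eq ?_)
  rw [dampedHeatBound]
  ring

/-- The derivative is singular like `τ^(-1/2)` at zero. The fundamental theorem needs only
continuity up to the endpoint and an integrable derivative in the interior, which the majorant
provides. -/
lemma integral_dampedHeatDt (hκ : 0 < κ) (hν : 0 < ν) (hF : Continuous (Function.uncurry F))
    (hB : ∀ x t, |F x t| ≤ B) (hF' : Continuous (Function.uncurry F'))
    (hB' : ∀ x t, |F' x t| ≤ B') (hd : ∀ x t, HasDerivAt (fun x => F x t) (F' x t) x)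
    (x s : ℝ) {t : ℝ} (ht : 0 ≤ t) :
    ∫ τ in (0 : ℝ)..t, dampedHeatDt κ ν c F F' x s τ =
      dampedHeat κ ν c F x s t - κ * F x s := by
  have h := intervalIntegral.integral_eq_sub_of_hasDerivAt_of_le (a := 0) (b := t)
    (f := dampedHeat κ ν c F x s) (f' := dampedHeatDt κ ν c F F' x s) ht ?_ ?_ ?_
  · rw [h]; simp [dampedHeat, driftHeat_zero]
  · refine Continuous.continuousOn ?_
    have := continuous_driftHeat_comp (ν := ν) (c := c) (continuous_slice hF s)
      (fun x => hB x s) (continuous_const (y := x)) (continuous_id (X := ℝ))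
    exact (by fun_prop : Continuous fun τ => κ * Real.exp (-κ * τ)).mul this
  · intro τ hτ
    have h1 := hasDerivAt_driftHeat_time (c := c) hν (fun x => hd x s) (fun x => hB x s)
      (continuous_slice hF' s) (fun x => hB' x s) x hτ.1
    have h2 : HasDerivAt (fun τ => κ * Real.exp (-κ * τ)) (-κ * (κ * Real.exp (-κ * τ))) τ := by
      have := (((hasDerivAt_id τ).const_mul (-κ)).exp).const_mul κ
      refine this.congr_deriv ?_
      simp only [id]; ring
    refine (h2.mul h1).congr_deriv ?_
    rw [dampedHeatDt]; ring
  · rw [intervalIntegrable_iff_integrableOn_Ioc_of_le ht]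
    refine Integrable.mono' ((integrableOn_dampedHeatBound (c := c) (B := B) (B' := B') hκ hν).mono_set
      Ioc_subset_Ioi_self) ?_ (Eventually.of_forall fun τ => abs_dampedHeatDt_le hκ hν hB hB' x s τ)
    exact ((measurable_dampedHeatDt hF.measurable hF'.measurable x).comp
      (by fun_prop : Measurable fun τ : ℝ => (s, τ))).aestronglyMeasurable

lemma duhamel_eq_integral_dampedHeat (hκ : 0 < κ) (hF : Continuous (Function.uncurry F))
    (hB : ∀ x t, |F x t| ≤ B) (x : ℝ) {t : ℝ} (ht : 0 ≤ t) :
    duhamel ν c (expWeight κ) F x t = ∫ s in (0 : ℝ)..t, dampedHeat κ ν c F x s (t - s) := by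
  rw [duhamel_expWeight_eq hκ hF hB, setIntegral_ite_lt ht]
  have := intervalIntegral.integral_comp_sub_left (a := 0) (b := t)
    (fun s => dampedHeat κ ν c F x s (t - s)) t
  simp only [sub_zero, sub_self, sub_sub_cancel] at this
  rw [← this]
  rfl

/-- The substitution `s = t - τ` turns the generator applied to the Duhamel integral into an
integral of `τ`-derivatives of the propagator, in a form ready for Fubini. -/
lemma duhamel_eq_integral_dampedHeatDt (hκ : 0 < κ) (hν : 0 < ν)
    (hF : Continuous (Function.uncurry F))
    (hB : ∀ x t, |F x t| ≤ B) (hF' : Continuous (Function.uncurry F'))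
    (hB' : ∀ x t, |F' x t| ≤ B') (x : ℝ) {t : ℝ} (ht : 0 ≤ t) :
    -κ * duhamel ν c (expWeight κ) F x t + c * duhamel ν c (expWeight κ) F' x t +
      ν * duhamel ν c (expWeightDx κ ν) F' x t =
      ∫ s in (0 : ℝ)..t, dampedHeatDt κ ν c F F' x s (t - s) := by
  have i1 := integrable_duhamelIntegrand (ν := ν) (c := c) (measurable_expWeight κ)
    (integrable_expWeight hκ) hF.measurable hB x t
  have i2 := integrable_duhamelIntegrand (ν := ν) (c := c) (measurable_expWeight κ)
    (integrable_expWeight hκ) hF'.measurable hB' x t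
  have i3 := integrable_duhamelIntegrand (ν := ν) (c := c) (measurable_expWeightDx κ ν)
    (integrable_expWeightDx hκ hν) hF'.measurable hB' x t
  have j1 := i1.integral_prod_left
  have j2 := i2.integral_prod_left
  have j3 := i3.integral_prod_left
  have j12 : Integrable (fun τ =>
      -κ * (∫ z, duhamelIntegrand ν c (expWeight κ) F x t (τ, z) ∂stdGaussian) +
        c * ∫ z, duhamelIntegrand ν c (expWeight κ) F' x t (τ, z) ∂stdGaussian)
      (volume.restrict (Ioi 0)) := (j1.const_mul _).add (j2.const_mul _)
  unfold duhamel
  rw [integral_prod _ i1, integral_prod _ i2, integral_prod _ i3, ← integral_const_mul,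
    ← integral_const_mul, ← integral_const_mul, ← integral_add (j1.const_mul _) (j2.const_mul _),
    ← integral_add j12 (j3.const_mul _)]
  have := intervalIntegral.integral_comp_sub_left (a := 0) (b := t)
    (fun s => dampedHeatDt κ ν c F F' x s (t - s)) t
  simp only [sub_zero, sub_self, sub_sub_cancel] at this
  rw [← this, ← setIntegral_ite_lt ht]
  refine integral_congr_ae (Eventually.of_forall fun τ => ?_)
  simp only [duhamelIntegrand]
  split_ifs
  · simp only [expWeight, expWeightDx, mul_assoc, integral_const_mul, dampedHeatDt, driftHeat,
      driftHeatDx]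
    ring
  · simp

/-- Integrated form of the equation satisfied by `duhamel`. -/
lemma duhamel_eq_time_integral (hκ : 0 < κ) (hν : 0 < ν) (hF : Continuous (Function.uncurry F))
    (hB : ∀ x t, |F x t| ≤ B) (hF' : Continuous (Function.uncurry F'))
    (hB' : ∀ x t, |F' x t| ≤ B') (hd : ∀ x t, HasDerivAt (fun x => F x t) (F' x t) x)
    (x : ℝ) {t : ℝ} (ht : 0 ≤ t) :
    duhamel ν c (expWeight κ) F x t = ∫ r in (0 : ℝ)..t, (κ * F x r +
      (-κ * duhamel ν c (expWeight κ) F x r + c * duhamel ν c (expWeight κ) F' x r +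
        ν * duhamel ν c (expWeightDx κ ν) F' x r)) := by
  have c0 : Continuous fun r => F x r := hF.comp (by fun_prop : Continuous fun r : ℝ => (x, r))
  have c1 : Continuous fun r => duhamel ν c (expWeight κ) F x r :=
    (continuous_duhamel (measurable_expWeight κ) (integrable_expWeight hκ) hF hB).comp
      (by fun_prop : Continuous fun r : ℝ => (x, r))
  have c2 : Continuous fun r => duhamel ν c (expWeight κ) F' x r :=
    (continuous_duhamel (measurable_expWeight κ) (integrable_expWeight hκ) hF' hB').comp
      (by fun_prop : Continuous fun r : ℝ => (x, r))
  have c3 : Continuous fun r => duhamel ν c (expWeightDx κ ν) F' x r :=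
    (continuous_duhamel (measurable_expWeightDx κ ν) (integrable_expWeightDx hκ hν) hF' hB').comp
      (by fun_prop : Continuous fun r : ℝ => (x, r))
  rw [intervalIntegral.integral_add (Continuous.intervalIntegrable (by fun_prop) _ _)
    (Continuous.intervalIntegrable (by fun_prop) _ _)]
  -- The source has no derivative in time, so the integral cannot be differentiated directly.
  -- Instead the kernel is integrated over the triangle `0 < s < r ≤ t`: integrating first in `s`
  -- gives the generator term, first in `r` the propagator at lag `t - s` minus its initial value.
  set K' : ℝ → ℝ → ℝ := fun r s => if s < r then dampedHeatDt κ ν c F F' x s (r - s) else 0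
    with hK'
  have hmeas : Measurable (Function.uncurry K') := by
    refine Measurable.ite (measurableSet_lt measurable_snd measurable_fst) ?_ measurable_const
    exact (measurable_dampedHeatDt hF.measurable hF'.measurable x).comp
      (by fun_prop : Measurable fun q : ℝ × ℝ => (q.2, q.1 - q.2))
  have hint : Integrable (Function.uncurry K')
      ((volume.restrict (Ioc 0 t)).prod (volume.restrict (Ioc 0 t))) := by
    -- On the triangle the kernel is dominated by a function of `r - s` alone. The product `f(s) g(r
    -- - s)` is a convolution integrand of two integrable functions, hence integrable on the plane.
    set f : ℝ → ℝ := (Ioc 0 t).indicator fun _ => 1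
    set g : ℝ → ℝ := (Ioi 0).indicator (dampedHeatBound κ ν c B B')
    have hf : Integrable f volume :=
      (integrable_indicator_iff measurableSet_Ioc).2 (integrable_const 1)
    have hg : Integrable g volume := (integrable_indicator_iff measurableSet_Ioi).2
      (integrableOn_dampedHeatBound hκ hν)
    have hconv := hf.convolution_integrand (ContinuousLinearMap.mul ℝ ℝ) hg
    rw [Measure.prod_restrict]
    refine Integrable.mono' (hconv.integrableOn (s := Ioc 0 t ×ˢ Ioc 0 t))
      hmeas.aestronglyMeasurable ?_
    filter_upwards [ae_restrict_mem (measurableSet_Ioc.prod measurableSet_Ioc)] with q hq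
    simp only [Function.uncurry, hK', ContinuousLinearMap.mul_apply', f, g,
      indicator_of_mem hq.2, one_mul]
    split_ifs with h
    · rw [indicator_of_mem (by simpa using h)]
      exact abs_dampedHeatDt_le hκ hν hB hB' x _ _
    · rw [indicator_of_notMem (by simpa using h)]; simp
  have e1 : ∫ r in (0 : ℝ)..t, (-κ * duhamel ν c (expWeight κ) F x r +
      c * duhamel ν c (expWeight κ) F' x r + ν * duhamel ν c (expWeightDx κ ν) F' x r) =
      ∫ r in Ioc 0 t, ∫ s in Ioc 0 t, K' r s := by
    rw [intervalIntegral.integral_of_le ht]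
    refine setIntegral_congr_fun measurableSet_Ioc fun r hr => ?_
    rw [duhamel_eq_integral_dampedHeatDt hκ hν hF hB hF' hB' x hr.1.le]
    have e : K' r = (Iio r).indicator fun s => dampedHeatDt κ ν c F F' x s (r - s) := by
      ext s; simp [hK', indicator]
    rw [e, setIntegral_indicator measurableSet_Iio, intervalIntegral.integral_of_le hr.1.le,
      integral_Ioc_eq_integral_Ioo]
    congr 2
    ext s
    simp only [mem_Ioo, mem_inter_iff, mem_Ioc, mem_Iio]
    exact ⟨fun h => ⟨⟨h.1, h.2.le.trans hr.2⟩, h.2⟩, fun h => ⟨h.1.1, h.2⟩⟩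
  have e2 : ∫ s in Ioc 0 t, ∫ r in Ioc 0 t, K' r s =
      ∫ s in (0 : ℝ)..t, (dampedHeat κ ν c F x s (t - s) - κ * F x s) := by
    rw [intervalIntegral.integral_of_le ht]
    refine setIntegral_congr_fun measurableSet_Ioc fun s hs => ?_
    rw [← integral_dampedHeatDt hκ hν hF hB hF' hB' hd x s (sub_nonneg.2 hs.2)]
    have e : (fun r => K' r s) = (Ioi s).indicator fun r => dampedHeatDt κ ν c F F' x s (r - s) := by
      ext r; simp [hK', indicator]
    have e3 := intervalIntegral.integral_comp_sub_right (a := s) (b := t)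
      (fun τ => dampedHeatDt κ ν c F F' x s τ) s
    rw [sub_self] at e3
    rw [e, setIntegral_indicator measurableSet_Ioi, ← e3, intervalIntegral.integral_of_le hs.2]
    congr 2
    ext r
    simp only [mem_inter_iff, mem_Ioc, mem_Ioi]
    exact ⟨fun h => ⟨h.2, h.1.2⟩, fun h => ⟨⟨hs.1.trans h.1, h.2⟩, h.1⟩⟩
  have cK : Continuous fun s => dampedHeat κ ν c F x s (t - s) := by
    unfold dampedHeat driftHeat
    refine Continuous.mul (by fun_prop) (continuous_of_dominated (bound := fun _ => B) ?_ ?_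
      (integrable_const _) ?_)
    · exact fun s => ((continuous_slice hF s).comp
        (by fun_prop : Continuous fun z => x + c * (t - s) + √(2 * ν * (t - s)) * z)).aestronglyMeasurable
    · exact fun p => Eventually.of_forall fun z => hB _ _
    · exact Eventually.of_forall fun z => hF.comp (by fun_prop :
        Continuous fun s => (x + c * (t - s) + √(2 * ν * (t - s)) * z, s))
  rw [e1, integral_integral_swap hint, e2, intervalIntegral.integral_sub
    (cK.intervalIntegrable _ _) (Continuous.intervalIntegrable (by fun_prop) _ _),
    duhamel_eq_integral_dampedHeat hκ hF hB x ht]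
  ring

/-- `duhamel` solves the damped inhomogeneous equation. -/
lemma hasDerivAt_duhamel_time (hκ : 0 < κ) (hν : 0 < ν) (hF : Continuous (Function.uncurry F))
    (hB : ∀ x t, |F x t| ≤ B) (hF' : Continuous (Function.uncurry F'))
    (hB' : ∀ x t, |F' x t| ≤ B') (hd : ∀ x t, HasDerivAt (fun x => F x t) (F' x t) x)
    (x : ℝ) {t : ℝ} (ht : 0 < t) :
    HasDerivAt (fun t => duhamel ν c (expWeight κ) F x t) (κ * F x t +
      (-κ * duhamel ν c (expWeight κ) F x t + c * duhamel ν c (expWeight κ) F' x t +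
        ν * duhamel ν c (expWeightDx κ ν) F' x t)) t := by
  have c0 : Continuous fun r => F x r := hF.comp (by fun_prop : Continuous fun r : ℝ => (x, r))
  have c1 : Continuous fun r => duhamel ν c (expWeight κ) F x r :=
    (continuous_duhamel (measurable_expWeight κ) (integrable_expWeight hκ) hF hB).comp
      (by fun_prop : Continuous fun r : ℝ => (x, r))
  have c2 : Continuous fun r => duhamel ν c (expWeight κ) F' x r :=
    (continuous_duhamel (measurable_expWeight κ) (integrable_expWeight hκ) hF' hB').comp
      (by fun_prop : Continuous fun r : ℝ => (x, r))
  have c3 : Continuous fun r => duhamel ν c (expWeightDx κ ν) F' x r :=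
    (continuous_duhamel (measurable_expWeightDx κ ν) (integrable_expWeightDx hκ hν) hF' hB').comp
      (by fun_prop : Continuous fun r : ℝ => (x, r))
  have hc : Continuous fun t => κ * F x t +
      (-κ * duhamel ν c (expWeight κ) F x t + c * duhamel ν c (expWeight κ) F' x t +
        ν * duhamel ν c (expWeightDx κ ν) F' x t) := by fun_prop
  have h := intervalIntegral.integral_hasDerivAt_right (hc.intervalIntegrable 0 t)
    hc.aestronglyMeasurable.stronglyMeasurableAtFilter hc.continuousAt
  refine h.congr_of_eventuallyEq ?_
  filter_upwards [Ioi_mem_nhds ht] with r hr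
  exact duhamel_eq_time_integral hκ hν hF hB hF' hB' hd x (le_of_lt hr)

end timeDerivative

end ViscousPSystem

/-! ### Monotone equilibria and the kinetic components -/

namespace ViscousPSystem
open Filter Topology ProbabilityTheory

/-- The local equilibria of a two-speed kinetic model with density `u`. -/
structure IsMaxwellianPair (M₁ M₂ : ℝ → ℝ) : Prop where
  contDiff₁ : ContDiff ℝ 1 M₁
  contDiff₂ : ContDiff ℝ 1 M₂
  deriv_pos₁ : ∀ u, 0 < deriv M₁ u
  deriv_pos₂ : ∀ u, 0 < deriv M₂ u
  add : ∀ u, M₁ u + M₂ u = u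
  zero₁ : M₁ 0 = 0

section Maxwellian

variable {M₁ M₂ : ℝ → ℝ}

lemma IsMaxwellianPair.symm (hM : IsMaxwellianPair M₁ M₂) : IsMaxwellianPair M₂ M₁ where
  contDiff₁ := hM.contDiff₂
  contDiff₂ := hM.contDiff₁
  deriv_pos₁ := hM.deriv_pos₂
  deriv_pos₂ := hM.deriv_pos₁
  add u := by rw [add_comm, hM.add]
  zero₁ := by have := hM.add 0; rw [hM.zero₁, zero_add] at this; exact this

lemma IsMaxwellianPair.strictMono (hM : IsMaxwellianPair M₁ M₂) : StrictMono M₁ :=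
  strictMono_of_deriv_pos hM.deriv_pos₁

lemma IsMaxwellianPair.continuous (hM : IsMaxwellianPair M₁ M₂) : Continuous M₁ :=
  hM.contDiff₁.continuous

lemma IsMaxwellianPair.continuous_deriv (hM : IsMaxwellianPair M₁ M₂) : Continuous (deriv M₁) :=
  hM.contDiff₁.continuous_deriv le_rfl

lemma IsMaxwellianPair.hasDerivAt (hM : IsMaxwellianPair M₁ M₂) (u : ℝ) :
    HasDerivAt M₁ (deriv M₁ u) u :=
  (hM.contDiff₁.differentiable one_ne_zero u).hasDerivAt

/-- The two derivatives are positive and sum to one. -/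
lemma IsMaxwellianPair.deriv_lt_one (hM : IsMaxwellianPair M₁ M₂) (u : ℝ) : deriv M₁ u < 1 := by
  have h := (hM.hasDerivAt u).add (hM.symm.hasDerivAt u)
  have e : M₁ + M₂ = id := by ext u; exact hM.add u
  rw [e] at h
  have := h.unique (hasDerivAt_id u)
  linarith [hM.deriv_pos₂ u]

lemma IsMaxwellianPair.abs_deriv_le_one (hM : IsMaxwellianPair M₁ M₂) (u : ℝ) :
    |deriv M₁ u| ≤ 1 := by
  rw [abs_of_pos (hM.deriv_pos₁ u)]; exact (hM.deriv_lt_one u).le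

lemma IsMaxwellianPair.abs_sub_le (hM : IsMaxwellianPair M₁ M₂) (u v : ℝ) :
    |M₁ u - M₁ v| ≤ |u - v| := by
  simpa using abs_le_linear_growth hM.hasDerivAt hM.abs_deriv_le_one v u

lemma IsMaxwellianPair.abs_le (hM : IsMaxwellianPair M₁ M₂) (u : ℝ) : |M₁ u| ≤ |u| := by
  simpa [hM.zero₁] using hM.abs_sub_le u 0

end Maxwellian

/-- One kinetic component: the damped free evolution of `w` plus relaxation towards `M u`. -/
noncomputable def kineticComponent (κ ν c : ℝ) (M w : ℝ → ℝ) (u : ℝ → ℝ → ℝ) (x t : ℝ) : ℝ :=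
  Real.exp (-κ * max t 0) * driftHeat ν c w x (max t 0) +
    duhamel ν c (expWeight κ) (fun x t => M (u x t)) x t

/-- The `x`-derivative of `kineticComponent`. -/
noncomputable def kineticComponentDx (κ ν c : ℝ) (M w' : ℝ → ℝ) (u : ℝ → ℝ → ℝ) (x t : ℝ) : ℝ :=
  Real.exp (-κ * max t 0) * driftHeat ν c w' x (max t 0) +
    duhamel ν c (expWeightDx κ ν) (fun x t => M (u x t)) x t

/-- The second `x`-derivative of `kineticComponent`. -/
noncomputable def kineticComponentDxx (κ ν c : ℝ) (M w' : ℝ → ℝ) (u u' : ℝ → ℝ → ℝ) (x t : ℝ) : ℝ :=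
  Real.exp (-κ * max t 0) * driftHeatDx ν c w' x (max t 0) +
    duhamel ν c (expWeightDx κ ν) (fun x t => deriv M (u x t) * u' x t) x t

/-- The fixed point map of the kinetic model for the density. -/
noncomputable def densityMap (κ ν a : ℝ) (M₁ M₂ w₁ w₂ : ℝ → ℝ) (u : ℝ → ℝ → ℝ) (x t : ℝ) : ℝ :=
  kineticComponent κ ν a M₁ w₁ u x t + kineticComponent κ ν (-a) M₂ w₂ u x t

/-- Picard iterates for the density. -/
noncomputable def picard (κ ν a : ℝ) (M₁ M₂ w₁ w₂ : ℝ → ℝ) : ℕ → ℝ → ℝ → ℝ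
  | 0 => fun _ _ => 0
  | n + 1 => densityMap κ ν a M₁ M₂ w₁ w₂ (picard κ ν a M₁ M₂ w₁ w₂ n)

/-- The density of the kinetic model. -/
noncomputable def density (κ ν a : ℝ) (M₁ M₂ w₁ w₂ : ℝ → ℝ) (x t : ℝ) : ℝ :=
  limUnder atTop fun n => picard κ ν a M₁ M₂ w₁ w₂ n x t

/-- Initial profiles of class `C^{1,1}`. -/
structure IsInitialProfile (b B₁ B₂ : ℝ) (w w' : ℝ → ℝ) : Prop where
  hasDerivAt : ∀ x, HasDerivAt w (w' x) x
  bound : ∀ x, |w x| ≤ b / 2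
  bound_deriv : ∀ x, |w' x| ≤ B₁
  lipschitz : ∀ x y, |w' x - w' y| ≤ B₂ * |x - y|

lemma IsInitialProfile.continuous {b B₁ B₂ : ℝ} {w w' : ℝ → ℝ}
    (h : IsInitialProfile b B₁ B₂ w w') : Continuous w :=
  continuous_iff_continuousAt.2 fun z => (h.hasDerivAt z).continuousAt

lemma IsInitialProfile.continuous_deriv {b B₁ B₂ : ℝ} {w w' : ℝ → ℝ}
    (h : IsInitialProfile b B₁ B₂ w w') : Continuous w' := by
  refine (LipschitzWith.of_dist_le_mul (K := B₂.toNNReal) fun x y => ?_).continuous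
  rw [Real.dist_eq, Real.dist_eq]
  exact (h.lipschitz x y).trans
    (mul_le_mul_of_nonneg_right (Real.le_coe_toNNReal _) (abs_nonneg _))

section component

variable {κ ν c b B₁ B₂ : ℝ} {M M₂ w w' : ℝ → ℝ} {u u' v : ℝ → ℝ → ℝ}

lemma continuous_comp_uncurry (hM : Continuous M) (hu : Continuous (Function.uncurry u)) :
    Continuous (Function.uncurry fun x t => M (u x t)) := hM.comp hu

lemma IsMaxwellianPair.bound (hM : IsMaxwellianPair M M₂) (hub : ∀ x t, |u x t| ≤ b) (x t : ℝ) :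
    |M (u x t)| ≤ b := (hM.abs_le _).trans (hub x t)

lemma IsMaxwellianPair.bound_deriv (hM : IsMaxwellianPair M M₂) {B : ℝ}
    (hub : ∀ x t, |u' x t| ≤ B) (x t : ℝ) :
    |deriv M (u x t) * u' x t| ≤ B := by
  rw [abs_mul]
  refine (mul_le_mul (hM.abs_deriv_le_one _) (hub x t) (abs_nonneg _) zero_le_one).trans ?_
  rw [one_mul]

lemma exp_damping_le_one (hκ : 0 < κ) (t : ℝ) : Real.exp (-κ * max t 0) ≤ 1 := by
  rw [Real.exp_le_one_iff]
  have : 0 ≤ κ * max t 0 := by positivity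
  linarith

lemma continuous_kineticComponent (hκ : 0 < κ) (hM : IsMaxwellianPair M M₂)
    (hw : IsInitialProfile b B₁ B₂ w w') (hu : Continuous (Function.uncurry u))
    (hub : ∀ x t, |u x t| ≤ b) :
    Continuous (Function.uncurry (kineticComponent κ ν c M w u)) := by
  have h1 := continuous_driftHeat_comp (ν := ν) (c := c) hw.continuous hw.bound
    (continuous_fst (X := ℝ) (Y := ℝ)) (continuous_snd.max (continuous_const (y := (0 : ℝ))))
  have h2 := continuous_duhamel (ν := ν) (c := c) (measurable_expWeight κ)
    (integrable_expWeight hκ) (continuous_comp_uncurry hM.continuous hu) (hM.bound hub)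
  exact ((by fun_prop : Continuous fun p : ℝ × ℝ => Real.exp (-κ * max p.2 0)).mul h1).add h2

/-- Monotonicity of `M` allows the source to be replaced by the constant `M b`; by `duhamel_const`
the result is a convex combination of the data bound and `M b`. -/
lemma kineticComponent_le (hκ : 0 < κ) (hM : IsMaxwellianPair M M₂)
    (hw : IsInitialProfile b B₁ B₂ w w') (hu : Continuous (Function.uncurry u))
    (hub : ∀ x t, |u x t| ≤ b) (x t : ℝ) :
    kineticComponent κ ν c M w u x t ≤
      Real.exp (-κ * max t 0) * (b / 2) + (1 - Real.exp (-κ * max t 0)) * M b := by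
  refine add_le_add (mul_le_mul_of_nonneg_left ?_ (Real.exp_nonneg _)) ?_
  · exact (abs_le.1 (abs_driftHeat_le hw.bound _ _)).2
  · rw [← duhamel_const (ν := ν) (c := c) hκ (M b) x t]
    exact duhamel_mono hκ (continuous_comp_uncurry hM.continuous hu).measurable
      (hM.bound hub) measurable_const (fun _ _ => le_rfl)
      (fun x t => hM.strictMono.monotone (abs_le.1 (hub x t)).2) x t

lemma le_kineticComponent (hκ : 0 < κ) (hM : IsMaxwellianPair M M₂)
    (hw : IsInitialProfile b B₁ B₂ w w') (hu : Continuous (Function.uncurry u))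
    (hub : ∀ x t, |u x t| ≤ b) (x t : ℝ) :
    Real.exp (-κ * max t 0) * (-(b / 2)) + (1 - Real.exp (-κ * max t 0)) * M (-b) ≤
      kineticComponent κ ν c M w u x t := by
  refine add_le_add (mul_le_mul_of_nonneg_left ?_ (Real.exp_nonneg _)) ?_
  · exact (abs_le.1 (abs_driftHeat_le hw.bound _ _)).1
  · rw [← duhamel_const (ν := ν) (c := c) hκ (M (-b)) x t]
    exact duhamel_mono hκ measurable_const (fun _ _ => le_rfl)
      (continuous_comp_uncurry hM.continuous hu).measurable (hM.bound hub)
      (fun x t => hM.strictMono.monotone (abs_le.1 (hub x t)).1) x t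

/-- The sup bound for a kinetic component. -/
lemma abs_kineticComponent_le (hκ : 0 < κ) (hM : IsMaxwellianPair M M₂)
    (hw : IsInitialProfile b B₁ B₂ w w') (hu : Continuous (Function.uncurry u))
    (hub : ∀ x t, |u x t| ≤ b) {R : ℝ} (hR : b / 2 ≤ R) (h1 : M b ≤ R) (h2 : -R ≤ M (-b))
    (x t : ℝ) : |kineticComponent κ ν c M w u x t| ≤ R := by
  have e1 := kineticComponent_le (ν := ν) (c := c) hκ hM hw hu hub x t
  have e2 := le_kineticComponent (ν := ν) (c := c) hκ hM hw hu hub x t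
  have h3 := exp_damping_le_one hκ t
  have h4 := Real.exp_nonneg (-κ * max t 0)
  rw [abs_le]
  constructor <;> nlinarith

lemma abs_kineticComponent_sub_le (hκ : 0 < κ) (hM : IsMaxwellianPair M M₂)
    (hu : Continuous (Function.uncurry u)) (hub : ∀ x t, |u x t| ≤ b)
    (hv : Continuous (Function.uncurry v)) (hvb : ∀ x t, |v x t| ≤ b) {D : ℝ}
    (hD : ∀ x t, |u x t - v x t| ≤ D * Real.exp (3 * κ * max t 0)) (x t : ℝ) :
    |kineticComponent κ ν c M w u x t - kineticComponent κ ν c M w v x t| ≤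
      D / 4 * Real.exp (3 * κ * max t 0) := by
  rw [kineticComponent, kineticComponent, add_sub_add_left_eq_sub,
    duhamel_sub (measurable_expWeight κ) (integrable_expWeight hκ)
      (continuous_comp_uncurry hM.continuous hu).measurable (hM.bound hub)
      (continuous_comp_uncurry hM.continuous hv).measurable (hM.bound hvb)]
  exact abs_duhamel_le_exp hκ (fun x t => (hM.abs_sub_le _ _).trans (hD x t)) x t

/-- The derivative falls on the data in the free term and on the kernel in the Duhamel term, so no
differentiability of `u` is needed. This starts the regularity bootstrap. -/
lemma hasDerivAt_kineticComponent (hκ : 0 < κ) (hν : 0 < ν) (hM : IsMaxwellianPair M M₂)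
    (hw : IsInitialProfile b B₁ B₂ w w') (hu : Continuous (Function.uncurry u))
    (hub : ∀ x t, |u x t| ≤ b) (x t : ℝ) :
    HasDerivAt (fun x => kineticComponent κ ν c M w u x t)
      (kineticComponentDx κ ν c M w' u x t) x :=
  ((hasDerivAt_driftHeat hw.hasDerivAt hw.bound hw.continuous_deriv hw.bound_deriv x _).const_mul
    _).add (hasDerivAt_duhamel_smoothing hκ hν (continuous_comp_uncurry hM.continuous hu)
      (hM.bound hub) x t)

lemma continuous_kineticComponentDx (hκ : 0 < κ) (hν : 0 < ν) (hM : IsMaxwellianPair M M₂)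
    (hw : IsInitialProfile b B₁ B₂ w w') (hu : Continuous (Function.uncurry u))
    (hub : ∀ x t, |u x t| ≤ b) :
    Continuous (Function.uncurry (kineticComponentDx κ ν c M w' u)) := by
  have h1 := continuous_driftHeat_comp (ν := ν) (c := c) hw.continuous_deriv hw.bound_deriv
    (continuous_fst (X := ℝ) (Y := ℝ)) (continuous_snd.max (continuous_const (y := (0 : ℝ))))
  have h2 := continuous_duhamel (ν := ν) (c := c) (measurable_expWeightDx κ ν)
    (integrable_expWeightDx hκ hν) (continuous_comp_uncurry hM.continuous hu) (hM.bound hub)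
  exact ((by fun_prop : Continuous fun p : ℝ × ℝ => Real.exp (-κ * max p.2 0)).mul h1).add h2

lemma abs_damped_add_le (hκ : 0 < κ) {p q P Q t : ℝ} (hp : |p| ≤ P) (hq : |q| ≤ Q) :
    |Real.exp (-κ * max t 0) * p + q| ≤ P + Q := by
  refine (abs_add_le _ _).trans (add_le_add ?_ hq)
  rw [abs_mul, abs_of_nonneg (Real.exp_nonneg _)]
  refine (mul_le_mul (exp_damping_le_one hκ t) hp (abs_nonneg _) zero_le_one).trans ?_
  rw [one_mul]

/-- The total mass of the singular Duhamel weight. -/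
noncomputable def weightMass (κ ν : ℝ) : ℝ := ∫ p, |expWeightDx κ ν p| ∂delayMeasure

lemma abs_kineticComponentDx_le (hκ : 0 < κ) (hν : 0 < ν) (hM : IsMaxwellianPair M M₂)
    (hw : IsInitialProfile b B₁ B₂ w w') (hub : ∀ x t, |u x t| ≤ b) (x t : ℝ) :
    |kineticComponentDx κ ν c M w' u x t| ≤ B₁ + weightMass κ ν * b :=
  abs_damped_add_le hκ (abs_driftHeat_le hw.bound_deriv _ _)
    (abs_duhamel_le (integrable_expWeightDx hκ hν) (hM.bound hub) x t)

lemma continuous_source_deriv (hM : IsMaxwellianPair M M₂) (hu : Continuous (Function.uncurry u))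
    (hu' : Continuous (Function.uncurry u')) :
    Continuous (Function.uncurry fun x t => deriv M (u x t) * u' x t) :=
  (hM.continuous_deriv.comp hu).mul hu'

lemma hasDerivAt_source (hM : IsMaxwellianPair M M₂)
    (hd : ∀ x t, HasDerivAt (fun x => u x t) (u' x t) x) (x t : ℝ) :
    HasDerivAt (fun x => M (u x t)) (deriv M (u x t) * u' x t) x :=
  (hM.hasDerivAt _).comp x (hd x t)

/-- One derivative sits on the kernel and the second on the source. Two on the kernel would give a
nonintegrable `τ^(-1)`. In the free term `w'` is only Lipschitz, so the Gaussian takes the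
derivative and `t > 0` is needed. -/
lemma hasDerivAt_kineticComponentDx (hκ : 0 < κ) (hν : 0 < ν) (hM : IsMaxwellianPair M M₂)
    (hw : IsInitialProfile b B₁ B₂ w w') (hu : Continuous (Function.uncurry u))
    (hub : ∀ x t, |u x t| ≤ b) (hd : ∀ x t, HasDerivAt (fun x => u x t) (u' x t) x)
    (hu' : Continuous (Function.uncurry u')) {B : ℝ} (hub' : ∀ x t, |u' x t| ≤ B)
    (x : ℝ) {t : ℝ} (ht : 0 < t) :
    HasDerivAt (fun x => kineticComponentDx κ ν c M w' u x t)
      (kineticComponentDxx κ ν c M w' u u' x t) x :=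
  ((hasDerivAt_driftHeat_smoothing hw.continuous_deriv hw.bound_deriv hν x
    (lt_max_of_lt_left ht)).const_mul _).add
    (hasDerivAt_duhamel (measurable_expWeightDx κ ν) (integrable_expWeightDx hκ hν)
      (continuous_comp_uncurry hM.continuous hu).measurable (hM.bound hub)
      (continuous_source_deriv hM hu hu').measurable (hM.bound_deriv hub')
      (hasDerivAt_source hM hd) x t)

lemma continuousOn_kineticComponentDxx (hκ : 0 < κ) (hν : 0 < ν) (hM : IsMaxwellianPair M M₂)
    (hw : IsInitialProfile b B₁ B₂ w w') (hu : Continuous (Function.uncurry u))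
    (hu' : Continuous (Function.uncurry u')) {B : ℝ} (hub' : ∀ x t, |u' x t| ≤ B) :
    ContinuousOn (fun p : ℝ × ℝ => kineticComponentDxx κ ν c M w' u u' p.1 p.2) {p | 0 < p.2} := by
  have h1 : ContinuousOn (fun p : ℝ × ℝ => driftHeatDx ν c w' p.1 (max p.2 0)) {p | 0 < p.2} :=
    (continuousOn_driftHeatDx (c := c) hν hw.continuous_deriv hw.bound_deriv).comp
      (by fun_prop : Continuous fun p : ℝ × ℝ => (p.1, max p.2 0)).continuousOn
      (fun p hp => lt_max_of_lt_left (show 0 < p.2 from hp))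
  have h2 := continuous_duhamel (ν := ν) (c := c) (measurable_expWeightDx κ ν)
    (integrable_expWeightDx hκ hν) (continuous_source_deriv hM hu hu') (hM.bound_deriv hub')
  exact ((by fun_prop : Continuous fun p : ℝ × ℝ =>
    Real.exp (-κ * max p.2 0)).continuousOn.mul h1).add h2.continuousOn

lemma integral_id_stdGaussian : ∫ z, z ∂stdGaussian = 0 := integral_id_gaussianReal

/-- The Gaussian has mean zero, so the value at the centre may be subtracted. The increment of `w`
over `√(2νt) z` then compensates the factor `1/√(2νt)`. -/
lemma driftHeatDx_eq_integral_sub (hw : Continuous w) {B : ℝ} (hB : ∀ x, |w x| ≤ B) (x t : ℝ) :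
    driftHeatDx ν c w x t = ∫ z, z / √(2 * ν * t) *
      (w (x + c * t + √(2 * ν * t) * z) - w (x + c * t)) ∂stdGaussian := by
  have i1 : Integrable (fun z => z / √(2 * ν * t) * w (x + c * t)) stdGaussian :=
    (integrable_id_stdGaussian.div_const _).mul_const _
  have i2 : Integrable (fun z => z / √(2 * ν * t) * w (x + c * t + √(2 * ν * t) * z))
      stdGaussian := by
    refine (integrable_abs_stdGaussian.mul_const (B / √(2 * ν * t))).mono'
      (Continuous.aestronglyMeasurable (by fun_prop)) (Eventually.of_forall fun z => ?_)
    rw [Real.norm_eq_abs, abs_mul, abs_div, abs_of_nonneg (Real.sqrt_nonneg _), div_mul_eq_mul_div,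
      ← mul_div_assoc]
    gcongr
    exact hB _
  simp only [mul_sub]
  rw [integral_sub i2 i1, integral_mul_const, integral_div, integral_id_stdGaussian, driftHeatDx]
  simp

/-- The Lipschitz increment cancels the singular factor and leaves `z²`; the bound does not
deteriorate as `t → 0`. -/
lemma abs_driftHeatDx_le_of_lipschitz (hν : 0 < ν) (hw : IsInitialProfile b B₁ B₂ w w') (x : ℝ)
    {t : ℝ} (ht : 0 < t) :
    |driftHeatDx ν c w' x t| ≤ B₂ * ∫ z, z ^ 2 ∂stdGaussian := by
  have hσ : 0 < √(2 * ν * t) := Real.sqrt_pos.2 (by positivity)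
  rw [driftHeatDx_eq_integral_sub hw.continuous_deriv hw.bound_deriv, ← integral_const_mul]
  refine norm_integral_le_of_norm_le (f := fun z => z / √(2 * ν * t) *
    (w' (x + c * t + √(2 * ν * t) * z) - w' (x + c * t))) (integrable_sq_stdGaussian.const_mul _)
    (Eventually.of_forall fun z => ?_)
  have := hw.lipschitz (x + c * t + √(2 * ν * t) * z) (x + c * t)
  rw [add_sub_cancel_left, abs_mul, abs_of_pos hσ] at this
  rw [Real.norm_eq_abs, abs_mul, abs_div, abs_of_pos hσ]
  refine (mul_le_mul_of_nonneg_left this (by positivity)).trans (le_of_eq ?_)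
  rw [← sq_abs z]
  field_simp

lemma abs_kineticComponentDxx_le (hκ : 0 < κ) (hν : 0 < ν) (hM : IsMaxwellianPair M M₂)
    (hw : IsInitialProfile b B₁ B₂ w w') {B : ℝ} (hub' : ∀ x t, |u' x t| ≤ B) (x : ℝ)
    {t : ℝ} (ht : 0 < t) :
    |kineticComponentDxx κ ν c M w' u u' x t| ≤
      B₂ * (∫ z, z ^ 2 ∂stdGaussian) + weightMass κ ν * B :=
  abs_damped_add_le hκ (abs_driftHeatDx_le_of_lipschitz hν hw _ (lt_max_of_lt_left ht))
    (abs_duhamel_le (integrable_expWeightDx hκ hν) (hM.bound_deriv hub') x t)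

/-- A kinetic component satisfies the damped advection-diffusion equation. -/
lemma hasDerivAt_kineticComponent_time (hκ : 0 < κ) (hν : 0 < ν) (hM : IsMaxwellianPair M M₂)
    (hw : IsInitialProfile b B₁ B₂ w w') (hu : Continuous (Function.uncurry u))
    (hub : ∀ x t, |u x t| ≤ b) (hd : ∀ x t, HasDerivAt (fun x => u x t) (u' x t) x)
    (hu' : Continuous (Function.uncurry u')) {B : ℝ} (hub' : ∀ x t, |u' x t| ≤ B)
    (x : ℝ) {t : ℝ} (ht : 0 < t) :
    HasDerivAt (fun t => kineticComponent κ ν c M w u x t)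
      (κ * (M (u x t) - kineticComponent κ ν c M w u x t) +
        c * kineticComponentDx κ ν c M w' u x t +
        ν * kineticComponentDxx κ ν c M w' u u' x t) t := by
  have h1 := hasDerivAt_driftHeat_time (c := c) hν hw.hasDerivAt hw.bound hw.continuous_deriv
    hw.bound_deriv x ht
  have h2 : HasDerivAt (fun t => Real.exp (-κ * t)) (-κ * Real.exp (-κ * t)) t := by
    have := ((hasDerivAt_id t).const_mul (-κ)).exp
    refine this.congr_deriv ?_
    simp only [id]; ring
  have h3 := hasDerivAt_duhamel_time (c := c) hκ hν (continuous_comp_uncurry hM.continuous hu)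
    (hM.bound hub) (continuous_source_deriv hM hu hu') (hM.bound_deriv hub')
    (hasDerivAt_source hM hd) x ht
  -- The `x`-derivative of the same Duhamel integral computed in two ways, on the source and on the
  -- kernel; derivatives are unique.
  have e : duhamel ν c (expWeight κ) (fun x t => deriv M (u x t) * u' x t) x t =
      duhamel ν c (expWeightDx κ ν) (fun x t => M (u x t)) x t :=
    (hasDerivAt_duhamel (measurable_expWeight κ) (integrable_expWeight hκ)
      (continuous_comp_uncurry hM.continuous hu).measurable (hM.bound hub)
      (continuous_source_deriv hM hu hu').measurable (hM.bound_deriv hub')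
      (hasDerivAt_source hM hd) x t).unique
    (hasDerivAt_duhamel_smoothing hκ hν (continuous_comp_uncurry hM.continuous hu)
      (hM.bound hub) x t)
  rw [e] at h3
  refine (((h2.mul h1).add h3).congr_of_eventuallyEq ?_).congr_deriv ?_
  · filter_upwards [Ioi_mem_nhds ht] with r hr
    simp only [kineticComponent, max_eq_left (le_of_lt (show 0 < r from hr)), Pi.add_apply, Pi.mul_apply]
  · simp only [kineticComponent, kineticComponentDx, kineticComponentDxx, max_eq_left ht.le]
    ring

end component

end ViscousPSystem

/-! ### Picard iteration for the density -/

namespace ViscousPSystem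
open Filter Topology ProbabilityTheory

section picard

variable {κ ν a b B₁ B₂ : ℝ} {M₁ M₂ w₁ w₂ w₁' w₂' : ℝ → ℝ} {u v : ℝ → ℝ → ℝ}

lemma continuous_densityMap (hκ : 0 < κ) (hM : IsMaxwellianPair M₁ M₂)
    (h₁ : IsInitialProfile b B₁ B₂ w₁ w₁') (h₂ : IsInitialProfile b B₁ B₂ w₂ w₂')
    (hu : Continuous (Function.uncurry u)) (hub : ∀ x t, |u x t| ≤ b) :
    Continuous (Function.uncurry (densityMap κ ν a M₁ M₂ w₁ w₂ u)) :=
  (continuous_kineticComponent hκ hM h₁ hu hub).add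
    (continuous_kineticComponent hκ hM.symm h₂ hu hub)

/-- Constants of size `b` are sub- and supersolutions of the kinetic model. -/
lemma abs_densityMap_le (hκ : 0 < κ) (hM : IsMaxwellianPair M₁ M₂)
    (h₁ : IsInitialProfile b B₁ B₂ w₁ w₁') (h₂ : IsInitialProfile b B₁ B₂ w₂ w₂')
    (hu : Continuous (Function.uncurry u)) (hub : ∀ x t, |u x t| ≤ b) (x t : ℝ) :
    |densityMap κ ν a M₁ M₂ w₁ w₂ u x t| ≤ b := by
  have e1 := kineticComponent_le (ν := ν) (c := a) hκ hM h₁ hu hub x t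
  have e2 := le_kineticComponent (ν := ν) (c := a) hκ hM h₁ hu hub x t
  have e3 := kineticComponent_le (ν := ν) (c := -a) hκ hM.symm h₂ hu hub x t
  have e4 := le_kineticComponent (ν := ν) (c := -a) hκ hM.symm h₂ hu hub x t
  -- The data bounds add up to `b/2 + b/2 = b` and the equilibria to `M₁ b + M₂ b = b`, so the
  -- convex combination of the two is again `b`; likewise at `-b`.
  have h5 := hM.add b
  have h6 := hM.add (-b)
  unfold densityMap
  rw [abs_le]
  constructor
  · linear_combination e2 + e4 - (1 - Real.exp (-κ * max t 0)) * h6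
  · linear_combination e1 + e3 + (1 - Real.exp (-κ * max t 0)) * h5

/-- Each `Mᵢ` is 1-Lipschitz and each component contributes `1/4`. The exponential weight makes the
contraction global in time, so no continuation over short intervals is required. -/
lemma abs_densityMap_sub_le (hκ : 0 < κ) (hM : IsMaxwellianPair M₁ M₂)
    (hu : Continuous (Function.uncurry u)) (hub : ∀ x t, |u x t| ≤ b)
    (hv : Continuous (Function.uncurry v)) (hvb : ∀ x t, |v x t| ≤ b) {D : ℝ}
    (hD : ∀ x t, |u x t - v x t| ≤ D * Real.exp (3 * κ * max t 0)) (x t : ℝ) :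
    |densityMap κ ν a M₁ M₂ w₁ w₂ u x t - densityMap κ ν a M₁ M₂ w₁ w₂ v x t| ≤
      D / 2 * Real.exp (3 * κ * max t 0) := by
  have e1 := abs_kineticComponent_sub_le (ν := ν) (c := a) (w := w₁) hκ hM hu hub hv hvb hD x t
  have e2 := abs_kineticComponent_sub_le (ν := ν) (c := -a) (w := w₂) hκ hM.symm hu hub hv hvb hD x t
  unfold densityMap
  rw [add_sub_add_comm]
  refine (abs_add_le _ _).trans ?_
  linarith

lemma picard_regular (hκ : 0 < κ) (hM : IsMaxwellianPair M₁ M₂)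
    (h₁ : IsInitialProfile b B₁ B₂ w₁ w₁') (h₂ : IsInitialProfile b B₁ B₂ w₂ w₂') (n : ℕ) :
    Continuous (Function.uncurry (picard κ ν a M₁ M₂ w₁ w₂ n)) ∧
      ∀ x t, |picard κ ν a M₁ M₂ w₁ w₂ n x t| ≤ b := by
  induction n with
  | zero =>
    have : 0 ≤ b / 2 := (abs_nonneg _).trans (h₁.bound 0)
    refine ⟨continuous_const, fun x t => ?_⟩
    simp only [picard, abs_zero]
    linarith
  | succ n ih =>
    exact ⟨continuous_densityMap hκ hM h₁ h₂ ih.1 ih.2, abs_densityMap_le hκ hM h₁ h₂ ih.1 ih.2⟩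

lemma abs_picard_succ_sub_le (hκ : 0 < κ) (hM : IsMaxwellianPair M₁ M₂)
    (h₁ : IsInitialProfile b B₁ B₂ w₁ w₁') (h₂ : IsInitialProfile b B₁ B₂ w₂ w₂') (n : ℕ) :
    ∀ x t, |picard κ ν a M₁ M₂ w₁ w₂ (n + 1) x t - picard κ ν a M₁ M₂ w₁ w₂ n x t| ≤
      b * (1 / 2) ^ n * Real.exp (3 * κ * max t 0) := by
  induction n with
  | zero =>
    intro x t
    have hb := (picard_regular (ν := ν) (a := a) hκ hM h₁ h₂ 1).2 x t
    have h0 : 0 ≤ b := (abs_nonneg _).trans hb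
    have h1 : 1 ≤ Real.exp (3 * κ * max t 0) := Real.one_le_exp (by positivity)
    simp only [picard, sub_zero, pow_zero, mul_one] at hb ⊢
    nlinarith
  | succ n ih =>
    intro x t
    have hn := picard_regular (ν := ν) (a := a) hκ hM h₁ h₂ n
    have hn' := picard_regular (ν := ν) (a := a) hκ hM h₁ h₂ (n + 1)
    have := abs_densityMap_sub_le (ν := ν) (a := a) (w₁ := w₁) (w₂ := w₂) hκ hM hn'.1 hn'.2
      hn.1 hn.2 ih x t
    refine this.trans (le_of_eq ?_)
    ring

lemma dist_picard_le (hκ : 0 < κ) (hM : IsMaxwellianPair M₁ M₂)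
    (h₁ : IsInitialProfile b B₁ B₂ w₁ w₁') (h₂ : IsInitialProfile b B₁ B₂ w₂ w₂') (x t : ℝ)
    (n : ℕ) :
    dist (picard κ ν a M₁ M₂ w₁ w₂ n x t) (picard κ ν a M₁ M₂ w₁ w₂ (n + 1) x t) ≤
      b * Real.exp (3 * κ * max t 0) * (1 / 2) ^ n := by
  rw [dist_comm, Real.dist_eq]
  refine (abs_picard_succ_sub_le hκ hM h₁ h₂ n x t).trans (le_of_eq ?_)
  ring

lemma tendsto_picard (hκ : 0 < κ) (hM : IsMaxwellianPair M₁ M₂)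
    (h₁ : IsInitialProfile b B₁ B₂ w₁ w₁') (h₂ : IsInitialProfile b B₁ B₂ w₂ w₂') (x t : ℝ) :
    Tendsto (fun n => picard κ ν a M₁ M₂ w₁ w₂ n x t) atTop
      (𝓝 (density κ ν a M₁ M₂ w₁ w₂ x t)) :=
  (cauchySeq_of_le_geometric (1 / 2) (b * Real.exp (3 * κ * max t 0)) (by norm_num)
    (dist_picard_le hκ hM h₁ h₂ x t)).tendsto_limUnder

lemma abs_picard_sub_density_le (hκ : 0 < κ) (hM : IsMaxwellianPair M₁ M₂)
    (h₁ : IsInitialProfile b B₁ B₂ w₁ w₁') (h₂ : IsInitialProfile b B₁ B₂ w₂ w₂') (n : ℕ)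
    (x t : ℝ) :
    |picard κ ν a M₁ M₂ w₁ w₂ n x t - density κ ν a M₁ M₂ w₁ w₂ x t| ≤
      2 * b * (1 / 2) ^ n * Real.exp (3 * κ * max t 0) := by
  have := dist_le_of_le_geometric_of_tendsto (1 / 2) (b * Real.exp (3 * κ * max t 0))
    (by norm_num) (dist_picard_le hκ hM h₁ h₂ x t) (tendsto_picard (ν := ν) (a := a) hκ hM h₁ h₂ x t) n
  rw [Real.dist_eq] at this
  refine this.trans (le_of_eq ?_)
  ring

lemma abs_density_le (hκ : 0 < κ) (hM : IsMaxwellianPair M₁ M₂)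
    (h₁ : IsInitialProfile b B₁ B₂ w₁ w₁') (h₂ : IsInitialProfile b B₁ B₂ w₂ w₂') (x t : ℝ) :
    |density κ ν a M₁ M₂ w₁ w₂ x t| ≤ b :=
  le_of_tendsto (tendsto_picard hκ hM h₁ h₂ x t).abs
    (Eventually.of_forall fun n => (picard_regular hκ hM h₁ h₂ n).2 x t)

lemma tendsto_geometric_mul (C : ℝ) : Tendsto (fun n : ℕ => C * (1 / 2 : ℝ) ^ n) atTop (𝓝 0) := by
  simpa using (tendsto_pow_atTop_nhds_zero_of_lt_one (by norm_num : (0 : ℝ) ≤ 1 / 2)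
    (by norm_num)).const_mul C

/-- Convergence is uniform in `x` but the weight grows with `t`, so it is only locally uniform: a
half plane `{p | p.2 < q.2 + 1}` serves as neighbourhood. -/
lemma continuous_density (hκ : 0 < κ) (hM : IsMaxwellianPair M₁ M₂)
    (h₁ : IsInitialProfile b B₁ B₂ w₁ w₁') (h₂ : IsInitialProfile b B₁ B₂ w₂ w₂') :
    Continuous (Function.uncurry (density κ ν a M₁ M₂ w₁ w₂)) := by
  have hb : 0 ≤ b := (abs_nonneg _).trans (abs_density_le (ν := ν) (a := a) hκ hM h₁ h₂ 0 0)
  have hl : TendstoLocallyUniformly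
      (fun n => Function.uncurry (picard κ ν a M₁ M₂ w₁ w₂ n))
      (Function.uncurry (density κ ν a M₁ M₂ w₁ w₂)) atTop := by
    rw [Metric.tendstoLocallyUniformly_iff]
    intro δ hδ q
    refine ⟨{p | p.2 < q.2 + 1}, (isOpen_lt continuous_snd continuous_const).mem_nhds (by simp), ?_⟩
    have := (tendsto_geometric_mul (2 * b * Real.exp (3 * κ * max (q.2 + 1) 0))).eventually
      (gt_mem_nhds hδ)
    filter_upwards [this] with n hn p hp
    have hp' : p.2 < q.2 + 1 := hp
    rw [dist_comm, Real.dist_eq]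
    refine (abs_picard_sub_density_le hκ hM h₁ h₂ n p.1 p.2).trans_lt (lt_of_le_of_lt ?_ hn)
    rw [mul_assoc, mul_comm _ (Real.exp _), ← mul_assoc]
    gcongr
  exact hl.continuous (Frequently.of_forall fun n => (picard_regular hκ hM h₁ h₂ n).1)

/-- The contraction estimate carries geometric convergence of the iterates over to their images, and
both sequences have the same limit. -/
lemma density_eq (hκ : 0 < κ) (hM : IsMaxwellianPair M₁ M₂)
    (h₁ : IsInitialProfile b B₁ B₂ w₁ w₁') (h₂ : IsInitialProfile b B₁ B₂ w₂ w₂') (x t : ℝ) :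
    density κ ν a M₁ M₂ w₁ w₂ x t =
      densityMap κ ν a M₁ M₂ w₁ w₂ (density κ ν a M₁ M₂ w₁ w₂) x t := by
  have t1 := (tendsto_add_atTop_iff_nat 1).2 (tendsto_picard (ν := ν) (a := a) hκ hM h₁ h₂ x t)
  refine tendsto_nhds_unique t1 ?_
  rw [tendsto_iff_dist_tendsto_zero]
  refine squeeze_zero (fun _ => dist_nonneg) (fun n => ?_)
    (tendsto_geometric_mul (b * Real.exp (3 * κ * max t 0)))
  have hn := picard_regular (ν := ν) (a := a) hκ hM h₁ h₂ n
  refine (abs_densityMap_sub_le (ν := ν) (a := a) (w₁ := w₁) (w₂ := w₂) hκ hM hn.1 hn.2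
    (continuous_density hκ hM h₁ h₂) (abs_density_le hκ hM h₁ h₂)
    (abs_picard_sub_density_le hκ hM h₁ h₂ n) x t).trans (le_of_eq ?_)
  ring

end picard

/-! ### Joint measurability in the parameter -/

section measurability

variable {Y : Type*} [MeasurableSpace Y] {κ ν c a : ℝ} {M M₁ M₂ : ℝ → ℝ} {w w₁ w₂ : Y → ℝ → ℝ}
  {u : Y → ℝ → ℝ → ℝ}

lemma measurable_kineticComponent (hM : Measurable M)
    (hw : Measurable fun p : ℝ × Y => w p.2 p.1)
    (hu : Measurable fun p : ℝ × ℝ × Y => u p.2.2 p.1 p.2.1) :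
    Measurable fun p : ℝ × ℝ × Y => kineticComponent κ ν c M (w p.2.2) (u p.2.2) p.1 p.2.1 := by
  unfold kineticComponent
  refine Measurable.add (Measurable.mul (by fun_prop) ?_) ?_
  · have : Measurable fun q : (ℝ × ℝ × Y) × ℝ =>
        w q.1.2.2 (q.1.1 + c * max q.1.2.1 0 + √(2 * ν * max q.1.2.1 0) * q.2) :=
      hw.comp (by fun_prop : Measurable fun q : (ℝ × ℝ × Y) × ℝ =>
        (q.1.1 + c * max q.1.2.1 0 + √(2 * ν * max q.1.2.1 0) * q.2, q.1.2.2))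
    exact this.stronglyMeasurable.integral_prod_right'.measurable
  · have h1 : Measurable fun q : (ℝ × ℝ × Y) × ℝ × ℝ =>
        u q.1.2.2 (q.1.1 + c * q.2.1 + √(2 * ν * q.2.1) * q.2.2) (q.1.2.1 - q.2.1) :=
      hu.comp (by fun_prop : Measurable fun q : (ℝ × ℝ × Y) × ℝ × ℝ =>
        (q.1.1 + c * q.2.1 + √(2 * ν * q.2.1) * q.2.2, q.1.2.1 - q.2.1, q.1.2.2))
    have h2 : Measurable fun q : (ℝ × ℝ × Y) × ℝ × ℝ =>
        duhamelIntegrand ν c (expWeight κ) (fun x t => M (u q.1.2.2 x t)) q.1.1 q.1.2.1 q.2 :=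
      Measurable.ite (measurableSet_lt (by fun_prop) (by fun_prop))
        (((measurable_expWeight κ).comp measurable_snd).mul (hM.comp h1)) measurable_const
    exact h2.stronglyMeasurable.integral_prod_right'.measurable

lemma measurable_picard (hM₁ : Measurable M₁) (hM₂ : Measurable M₂)
    (h₁ : Measurable fun p : ℝ × Y => w₁ p.2 p.1) (h₂ : Measurable fun p : ℝ × Y => w₂ p.2 p.1)
    (n : ℕ) :
    Measurable fun p : ℝ × ℝ × Y => picard κ ν a M₁ M₂ (w₁ p.2.2) (w₂ p.2.2) n p.1 p.2.1 := by
  induction n with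
  | zero => exact measurable_const
  | succ n ih =>
    exact (measurable_kineticComponent (u := fun y => picard κ ν a M₁ M₂ (w₁ y) (w₂ y) n)
      hM₁ h₁ ih).add (measurable_kineticComponent
        (u := fun y => picard κ ν a M₁ M₂ (w₁ y) (w₂ y) n) hM₂ h₂ ih)

/-- Each iterate is a parameter integral of a jointly measurable function, and the iterates converge
pointwise. Convergence at every `y` is why every `y` must carry a genuine profile. -/
lemma measurable_density {b B₁ B₂ : ℝ} {w₁' w₂' : Y → ℝ → ℝ} (hκ : 0 < κ)
    (hM : IsMaxwellianPair M₁ M₂)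
    (h₁ : Measurable fun p : ℝ × Y => w₁ p.2 p.1) (h₂ : Measurable fun p : ℝ × Y => w₂ p.2 p.1)
    (hp₁ : ∀ y, IsInitialProfile b B₁ B₂ (w₁ y) (w₁' y))
    (hp₂ : ∀ y, IsInitialProfile b B₁ B₂ (w₂ y) (w₂' y)) :
    Measurable fun p : ℝ × ℝ × Y => density κ ν a M₁ M₂ (w₁ p.2.2) (w₂ p.2.2) p.1 p.2.1 :=
  measurable_of_tendsto_metrizable
    (fun n => measurable_picard hM.continuous.measurable hM.symm.continuous.measurable h₁ h₂ n)
    (tendsto_pi_nhds.2 fun p => tendsto_picard hκ hM (hp₁ p.2.2) (hp₂ p.2.2) p.1 p.2.1)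

end measurability

end ViscousPSystem

/-! ### Mean-square estimates for the propagators -/

namespace ViscousPSystem
open Filter Topology ProbabilityTheory

/-- The squared `L²` norm of a function on the line. -/
noncomputable def sqNorm (g : ℝ → ℝ) : ℝ≥0∞ := ∫⁻ x, ‖g x‖ₑ ^ 2

section sqNorm

variable {f g : ℝ → ℝ}

lemma sqNorm_mono (h : ∀ x, |f x| ≤ |g x|) : sqNorm f ≤ sqNorm g := by
  refine lintegral_mono fun x => pow_le_pow_left' ?_ 2
  rw [Real.enorm_eq_ofReal_abs, Real.enorm_eq_ofReal_abs]
  exact ENNReal.ofReal_le_ofReal (h x)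

lemma sqNorm_add_le (hf : Measurable f) :
    sqNorm (fun x => f x + g x) ≤ 2 * (sqNorm f + sqNorm g) := by
  unfold sqNorm
  rw [← lintegral_add_left (by fun_prop), ← lintegral_const_mul' _ _ (by simp)]
  refine lintegral_mono fun x => ?_
  simp only [Real.enorm_eq_ofReal_abs, ← ENNReal.ofReal_pow (abs_nonneg _), sq_abs]
  rw [← ENNReal.ofReal_add (sq_nonneg _) (sq_nonneg _), ← ENNReal.ofReal_ofNat 2,
    ← ENNReal.ofReal_mul zero_le_two]
  exact ENNReal.ofReal_le_ofReal add_sq_le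

lemma sqNorm_const_mul (c : ℝ) : sqNorm (fun x => c * g x) = ‖c‖ₑ ^ 2 * sqNorm g := by
  unfold sqNorm
  rw [← lintegral_const_mul' _ _ (by simp)]
  simp only [enorm_mul, mul_pow]

lemma sqNorm_comp_add (c : ℝ) : sqNorm (fun x => g (x + c)) = sqNorm g :=
  lintegral_add_right_eq_self (fun x => ‖g x‖ₑ ^ 2) c

end sqNorm

/-- Cauchy-Schwarz against the constant one. -/
lemma sq_lintegral_le {Θ : Type*} [MeasurableSpace Θ] (μ : Measure Θ) {g : Θ → ℝ≥0∞}
    (hg : AEMeasurable g μ) : (∫⁻ θ, g θ ∂μ) ^ 2 ≤ μ univ * ∫⁻ θ, g θ ^ 2 ∂μ := by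
  have h := ENNReal.lintegral_mul_le_Lp_mul_Lq μ Real.HolderConjugate.two_two
    (aemeasurable_const (b := (1 : ℝ≥0∞))) hg
  simp only [Pi.mul_apply, one_mul, lintegral_const, ENNReal.rpow_two, one_pow] at h
  refine (pow_le_pow_left' h 2).trans (le_of_eq ?_)
  have hs (A : ℝ≥0∞) : (A ^ (1 / 2 : ℝ)) ^ 2 = A := by
    rw [← ENNReal.rpow_natCast, ← ENNReal.rpow_mul]; norm_num
  rw [mul_pow, hs, hs]

/-- Minkowski's inequality for weighted averages of functions in `L²`. -/
lemma sqNorm_integral_le {Θ : Type*} [MeasurableSpace Θ] (μ : Measure Θ) [SFinite μ]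
    {ϖ : Θ → ℝ} (hϖ : Measurable ϖ) {F : ℝ → Θ → ℝ} (hF : Measurable (Function.uncurry F))
    {N : ℝ≥0∞} (hN : ∀ᵐ θ ∂μ, sqNorm (fun x => F x θ) ≤ N) :
    sqNorm (fun x => ∫ θ, ϖ θ * F x θ ∂μ) ≤ (∫⁻ θ, ‖ϖ θ‖ₑ ∂μ) ^ 2 * N := by
  have hϖe : Measurable fun θ => ‖ϖ θ‖ₑ := hϖ.enorm
  have hslice (x : ℝ) : Measurable fun θ => F x θ := hF.comp measurable_prodMk_left
  have h1 (x : ℝ) : ‖∫ θ, ϖ θ * F x θ ∂μ‖ₑ ^ 2 ≤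
      (∫⁻ θ, ‖ϖ θ‖ₑ ∂μ) * ∫⁻ θ, ‖ϖ θ‖ₑ * ‖F x θ‖ₑ ^ 2 ∂μ := by
    refine (pow_le_pow_left' (enorm_integral_le_lintegral_enorm _) 2).trans ?_
    -- Cauchy-Schwarz for the measure `|ϖ| μ` produces one factor of its total mass; integrating in
    -- `x` and swapping the integrals produces the other.
    have := sq_lintegral_le (μ.withDensity fun θ => ‖ϖ θ‖ₑ) (g := fun θ => ‖F x θ‖ₑ)
      (hslice x).enorm.aemeasurable
    rw [lintegral_withDensity_eq_lintegral_mul _ hϖe (hslice x).enorm,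
      lintegral_withDensity_eq_lintegral_mul _ hϖe ((hslice x).enorm.pow_const 2),
      withDensity_apply _ MeasurableSet.univ, Measure.restrict_univ] at this
    simpa only [enorm_mul, Pi.mul_apply] using this
  have hm : Measurable fun p : ℝ × Θ => ‖ϖ p.2‖ₑ * ‖F p.1 p.2‖ₑ ^ 2 :=
    (hϖe.comp measurable_snd).mul (hF.enorm.pow_const 2)
  calc sqNorm (fun x => ∫ θ, ϖ θ * F x θ ∂μ)
      ≤ ∫⁻ x, (∫⁻ θ, ‖ϖ θ‖ₑ ∂μ) * ∫⁻ θ, ‖ϖ θ‖ₑ * ‖F x θ‖ₑ ^ 2 ∂μ := lintegral_mono h1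
    _ = (∫⁻ θ, ‖ϖ θ‖ₑ ∂μ) * ∫⁻ x, ∫⁻ θ, ‖ϖ θ‖ₑ * ‖F x θ‖ₑ ^ 2 ∂μ :=
        lintegral_const_mul _ hm.lintegral_prod_right'
    _ = (∫⁻ θ, ‖ϖ θ‖ₑ ∂μ) * ∫⁻ θ, ‖ϖ θ‖ₑ * sqNorm (fun x => F x θ) ∂μ := by
        rw [lintegral_lintegral_swap hm.aemeasurable]
        congr 1
        refine lintegral_congr fun θ => ?_
        rw [lintegral_const_mul' _ _ (by simp)]
        rfl
    _ ≤ (∫⁻ θ, ‖ϖ θ‖ₑ ∂μ) * ∫⁻ θ, ‖ϖ θ‖ₑ * N ∂μ := by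
        gcongr 1
        refine lintegral_mono_ae ?_
        filter_upwards [hN] with θ hθ
        gcongr
    _ = _ := by rw [lintegral_mul_const _ hϖe]; ring

section propagators

variable {κ ν c b B₁ B₂ : ℝ} {w w' M M₂ : ℝ → ℝ} {ϖ : ℝ × ℝ → ℝ} {F u u' : ℝ → ℝ → ℝ} {N N₁ N₂ : ℝ≥0∞}

lemma sqNorm_driftHeat_le (hw : Measurable w) (t : ℝ) :
    sqNorm (fun x => driftHeat ν c w x t) ≤ sqNorm w := by
  have := sqNorm_integral_le stdGaussian (ϖ := fun _ => 1) measurable_const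
    (F := fun x z => w (x + c * t + √(2 * ν * t) * z)) (N := sqNorm w)
    (hw.comp (by fun_prop : Measurable fun p : ℝ × ℝ => p.1 + c * t + √(2 * ν * t) * p.2))
    (Eventually.of_forall fun z => by
      simp only [add_assoc]
      exact (sqNorm_comp_add _).le)
  simpa [driftHeat] using this

lemma sqNorm_duhamel_le (hϖ : Measurable ϖ) (hF : Measurable (Function.uncurry F))
    (hN : ∀ t, sqNorm (fun x => F x t) ≤ N) (t : ℝ) :
    sqNorm (fun x => duhamel ν c ϖ F x t) ≤ (∫⁻ p, ‖ϖ p‖ₑ ∂delayMeasure) ^ 2 * N := by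
  have h : Measurable fun q : ℝ × ℝ × ℝ =>
      F (q.1 + c * q.2.1 + √(2 * ν * q.2.1) * q.2.2) (t - q.2.1) :=
    hF.comp (by fun_prop : Measurable fun q : ℝ × ℝ × ℝ =>
      (q.1 + c * q.2.1 + √(2 * ν * q.2.1) * q.2.2, t - q.2.1))
  have := sqNorm_integral_le delayMeasure hϖ
    (F := fun x p => if p.1 < t then F (x + c * p.1 + √(2 * ν * p.1) * p.2) (t - p.1) else 0)
    (N := N) (Measurable.ite (measurableSet_lt (by fun_prop) measurable_const) h measurable_const)
    (Eventually.of_forall fun p => by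
      split_ifs
      · simp only [add_assoc]
        exact (sqNorm_comp_add (g := fun x => F x (t - p.1)) _).le.trans (hN _)
      · simp [sqNorm])
  simpa [duhamel, duhamelIntegrand] using this

/-- The second moment of the standard Gaussian. -/
noncomputable def secondMoment : ℝ≥0∞ := ∫⁻ z, ‖z ^ 2‖ₑ ∂stdGaussian

/-- With `σ = √(2νt)`, the centred integrand is `z²` times the difference quotient of `w` of step
`σz`. The quotients are bounded in `L²` by hypothesis and `z²` has finite mass, so no negative power
of `t` survives. At `z = 0` both forms vanish. -/
lemma sqNorm_driftHeatDx_le (hν : 0 < ν) (hw : Continuous w) {B : ℝ} (hB : ∀ x, |w x| ≤ B)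
    (hN : ∀ h, sqNorm (fun x => w (x + h) - w x) ≤ ‖h‖ₑ ^ 2 * N) {t : ℝ} (ht : 0 < t) :
    sqNorm (fun x => driftHeatDx ν c w x t) ≤ secondMoment ^ 2 * N := by
  have hσ : 0 < √(2 * ν * t) := Real.sqrt_pos.2 (by positivity)
  have hm : Measurable fun p : ℝ × ℝ => (√(2 * ν * t) * p.2)⁻¹ *
      (w (p.1 + c * t + √(2 * ν * t) * p.2) - w (p.1 + c * t)) := by
    have := hw.measurable
    fun_prop
  have := sqNorm_integral_le stdGaussian (ϖ := fun z => z ^ 2) (by fun_prop)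
    (F := fun x z => (√(2 * ν * t) * z)⁻¹ *
      (w (x + c * t + √(2 * ν * t) * z) - w (x + c * t))) hm (N := N)
    (Eventually.of_forall fun z => by
      rcases eq_or_ne z 0 with rfl | hz
      · simp [sqNorm]
      rw [sqNorm_const_mul, sqNorm_comp_add (g := fun x => w (x + √(2 * ν * t) * z) - w x)]
      refine (mul_le_mul_right (hN _) _).trans (le_of_eq ?_)
      have h0 : √(2 * ν * t) * z ≠ 0 := mul_ne_zero hσ.ne' hz
      rw [← mul_assoc, ← mul_pow, ← enorm_mul, inv_mul_cancel₀ h0]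
      simp)
  refine le_of_eq_of_le ?_ this
  congr 1
  ext x
  rw [driftHeatDx_eq_integral_sub hw hB]
  congr 1
  ext z
  rcases eq_or_ne z 0 with rfl | hz
  · simp
  field_simp

lemma sqNorm_damped_add_le (hκ : 0 < κ) {p q : ℝ → ℝ} (hp : Measurable p) (t : ℝ)
    (h1 : sqNorm p ≤ N₁) (h2 : sqNorm q ≤ N₂) :
    sqNorm (fun x => Real.exp (-κ * max t 0) * p x + q x) ≤ 2 * (N₁ + N₂) := by
  refine (sqNorm_add_le (by fun_prop)).trans ?_
  gcongr
  refine le_trans (sqNorm_mono fun x => ?_) h1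
  rw [abs_mul, abs_of_nonneg (Real.exp_nonneg _)]
  exact mul_le_of_le_one_left (abs_nonneg _) (exp_damping_le_one hκ t)

/-- The total mass of the singular Duhamel weight, as an extended nonnegative number. -/
noncomputable def weightMassE (κ ν : ℝ) : ℝ≥0∞ := ∫⁻ p, ‖expWeightDx κ ν p‖ₑ ∂delayMeasure

lemma sqNorm_kineticComponentDx_le (hκ : 0 < κ) (hM : IsMaxwellianPair M M₂)
    (hw : IsInitialProfile b B₁ B₂ w w') (hu : Continuous (Function.uncurry u))
    (hN₁ : sqNorm w' ≤ N₁) (hN : ∀ t, sqNorm (fun x => u x t) ≤ N) (t : ℝ) :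
    sqNorm (fun x => kineticComponentDx κ ν c M w' u x t) ≤
      2 * (N₁ + weightMassE κ ν ^ 2 * N) := by
  refine sqNorm_damped_add_le hκ (continuous_driftHeat_comp hw.continuous_deriv hw.bound_deriv
    continuous_id continuous_const).measurable t
    ((sqNorm_driftHeat_le hw.continuous_deriv.measurable _).trans hN₁)
    (sqNorm_duhamel_le (measurable_expWeightDx κ ν)
      (continuous_comp_uncurry hM.continuous hu).measurable
      (fun t => (sqNorm_mono fun x => hM.abs_le _).trans (hN t)) t)

lemma sqNorm_kineticComponentDxx_le (hκ : 0 < κ) (hν : 0 < ν) (hM : IsMaxwellianPair M M₂)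
    (hw : IsInitialProfile b B₁ B₂ w w') (hu : Continuous (Function.uncurry u))
    (hu' : Continuous (Function.uncurry u'))
    (hN₂ : ∀ h, sqNorm (fun x => w' (x + h) - w' x) ≤ ‖h‖ₑ ^ 2 * N₂)
    (hN : ∀ t, sqNorm (fun x => u' x t) ≤ N) {t : ℝ} (ht : 0 < t) :
    sqNorm (fun x => kineticComponentDxx κ ν c M w' u u' x t) ≤
      2 * (secondMoment ^ 2 * N₂ + weightMassE κ ν ^ 2 * N) := by
  have ht' : 0 < max t 0 := lt_max_of_lt_left ht
  refine sqNorm_damped_add_le hκ (ContinuousOn.comp_continuous (continuousOn_driftHeatDx (c := c) hν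
      hw.continuous_deriv hw.bound_deriv) (by fun_prop : Continuous fun x : ℝ => (x, max t 0))
      fun x => ht').measurable t
    (sqNorm_driftHeatDx_le hν hw.continuous_deriv hw.bound_deriv hN₂ ht')
    (sqNorm_duhamel_le (measurable_expWeightDx κ ν) (continuous_source_deriv hM hu hu').measurable
      (fun t => (sqNorm_mono fun x => ?_).trans (hN t)) t)
  rw [abs_mul]
  exact mul_le_of_le_one_left (abs_nonneg _) (hM.abs_deriv_le_one _)

end propagators

end ViscousPSystem

/-! ### Kružkov-type entropies of the kinetic model -/

namespace ViscousPSystem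
open Filter Topology ProbabilityTheory

/-- The integrated one-sided excess of `g` over the level `m` (for the sign `s`). -/
noncomputable def excess (s m : ℝ) (g : ℝ → ℝ) : ℝ≥0∞ := ∫⁻ x, ENNReal.ofReal (s * (g x - m))

lemma ofReal_integral_le {α : Type*} [MeasurableSpace α] {μ : Measure α} {f : α → ℝ}
    (hf : Integrable f μ) : ENNReal.ofReal (∫ x, f x ∂μ) ≤ ∫⁻ x, ENNReal.ofReal (f x) ∂μ := by
  have h := ofReal_integral_eq_lintegral_ofReal hf.pos_part
    (Eventually.of_forall fun x => le_max_right _ _)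
  calc ENNReal.ofReal (∫ x, f x ∂μ) ≤ ENNReal.ofReal (∫ x, max (f x) 0 ∂μ) :=
        ENNReal.ofReal_le_ofReal (integral_mono hf hf.pos_part fun x => le_max_left _ _)
    _ = ∫⁻ x, ENNReal.ofReal (f x) ∂μ := by
        rw [h]; refine lintegral_congr fun x => ?_
        rw [ENNReal.ofReal_max]; simp

lemma excess_comp_add (s m c : ℝ) (g : ℝ → ℝ) :
    excess s m (fun x => g (x + c)) = excess s m g :=
  lintegral_add_right_eq_self (fun x => ENNReal.ofReal (s * (g x - m))) c

lemma excess_add_le (s m₁ m₂ : ℝ) {f g : ℝ → ℝ} (hf : Measurable f) :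
    excess s (m₁ + m₂) (fun x => f x + g x) ≤ excess s m₁ f + excess s m₂ g := by
  unfold excess
  rw [← lintegral_add_left (by fun_prop)]
  refine lintegral_mono fun x => ?_
  rw [show s * (f x + g x - (m₁ + m₂)) = s * (f x - m₁) + s * (g x - m₂) by ring]
  exact ENNReal.ofReal_add_le

/-- At local equilibrium the excesses of the two components add up to that of the density. -/
lemma excess_maxwellian_add_le {M₁ M₂ : ℝ → ℝ} (hM : IsMaxwellianPair M₁ M₂) (s k : ℝ)
    {u : ℝ → ℝ} (hu : Measurable u) :
    excess s (M₁ k) (fun x => M₁ (u x)) + excess s (M₂ k) (fun x => M₂ (u x)) ≤ excess s k u := by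
  have hm := hM.continuous.measurable
  unfold excess
  rw [← lintegral_add_left (by fun_prop)]
  refine lintegral_mono fun x => ?_
  have e : s * (u x - k) = s * (M₁ (u x) - M₁ k) + s * (M₂ (u x) - M₂ k) := by
    rw [← mul_add, sub_add_sub_comm, hM.add, hM.add]
  -- Both equilibria are increasing, so their deviations from level `k` have the same sign, and
  -- positive parts of numbers of equal sign add exactly.
  have hsign : (0 ≤ s * (M₁ (u x) - M₁ k) ∧ 0 ≤ s * (M₂ (u x) - M₂ k)) ∨
      (s * (M₁ (u x) - M₁ k) ≤ 0 ∧ s * (M₂ (u x) - M₂ k) ≤ 0) := by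
    have m1 := hM.strictMono.monotone
    have m2 := hM.symm.strictMono.monotone
    rcases le_total 0 s with hs | hs <;> rcases le_total k (u x) with hk | hk
    · exact Or.inl ⟨mul_nonneg hs (sub_nonneg.2 (m1 hk)), mul_nonneg hs (sub_nonneg.2 (m2 hk))⟩
    · exact Or.inr ⟨mul_nonpos_of_nonneg_of_nonpos hs (sub_nonpos.2 (m1 hk)),
        mul_nonpos_of_nonneg_of_nonpos hs (sub_nonpos.2 (m2 hk))⟩
    · exact Or.inr ⟨mul_nonpos_of_nonpos_of_nonneg hs (sub_nonneg.2 (m1 hk)),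
        mul_nonpos_of_nonpos_of_nonneg hs (sub_nonneg.2 (m2 hk))⟩
    · exact Or.inl ⟨mul_nonneg_of_nonpos_of_nonpos hs (sub_nonpos.2 (m1 hk)),
        mul_nonneg_of_nonpos_of_nonpos hs (sub_nonpos.2 (m2 hk))⟩
  rw [e]
  rcases hsign with h | h
  · rw [ENNReal.ofReal_add h.1 h.2]
  · rw [ENNReal.ofReal_of_nonpos h.1, ENNReal.ofReal_of_nonpos h.2]; simp

section kruzkov

variable {κ ν c a b B₁ B₂ : ℝ} {M M₁ M₂ w w' w₁ w₁' w₂ w₂' : ℝ → ℝ} {u : ℝ → ℝ → ℝ}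

/-- Jensen's inequality for the convex function `r ↦ (s (r - m))⁺`, followed by translation
invariance of Lebesgue measure at each fixed noise value. -/
lemma excess_driftHeat_le (hw : Continuous w) {B : ℝ} (hB : ∀ x, |w x| ≤ B) (s m t : ℝ) :
    excess s m (fun x => driftHeat ν c w x t) ≤ excess s m w := by
  have hm : Measurable fun p : ℝ × ℝ =>
      ENNReal.ofReal (s * (w (p.1 + c * t + √(2 * ν * t) * p.2) - m)) := by
    have := hw.measurable
    fun_prop
  calc excess s m (fun x => driftHeat ν c w x t)
      ≤ ∫⁻ x, ∫⁻ z, ENNReal.ofReal (s * (w (x + c * t + √(2 * ν * t) * z) - m)) ∂stdGaussian := by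
        refine lintegral_mono fun x => ?_
        have hi := integrable_gaussian_shift hw hB (x + c * t) (√(2 * ν * t))
        have e : s * (driftHeat ν c w x t - m) =
            ∫ z, s * (w (x + c * t + √(2 * ν * t) * z) - m) ∂stdGaussian := by
          rw [integral_const_mul, integral_sub hi (integrable_const _), driftHeat]
          simp
        rw [e]
        exact ofReal_integral_le ((hi.sub (integrable_const _)).const_mul s)
    _ = ∫⁻ z, excess s m w ∂stdGaussian := by
        rw [lintegral_lintegral_swap hm.aemeasurable]
        refine lintegral_congr fun z => ?_
        simp only [add_assoc]
        exact excess_comp_add s m (c * t + √(2 * ν * t) * z) w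
    _ = excess s m w := by simp

/-- The Duhamel average of the excess `e` of the source. -/
noncomputable def delayAverage (κ : ℝ) (e : ℝ → ℝ≥0∞) (t : ℝ) : ℝ≥0∞ :=
  ∫⁻ p, (if p.1 < t then ENNReal.ofReal (expWeight κ p) * e (t - p.1) else 0) ∂delayMeasure

lemma delayAverage_const (hκ : 0 < κ) (E : ℝ≥0∞) (t : ℝ) :
    delayAverage κ (fun _ => E) t = ENNReal.ofReal (1 - Real.exp (-κ * max t 0)) * E := by
  have h := duhamel_const (ν := 0) (c := 0) hκ 1 0 t
  have hi := integrable_duhamelIntegrand (ν := 0) (c := 0) (F := fun _ _ => 1) (B := 1)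
    (measurable_expWeight κ) (integrable_expWeight hκ) measurable_const (by simp) 0 t
  rw [mul_one] at h
  rw [← h, duhamel, ofReal_integral_eq_lintegral_ofReal hi]
  · rw [← lintegral_mul_const _ (measurable_duhamelIntegrand (measurable_expWeight κ)
      measurable_const 0 t).ennreal_ofReal]
    refine lintegral_congr fun p => ?_
    simp only [duhamelIntegrand]
    split_ifs <;> simp
  · refine Eventually.of_forall fun p => ?_
    simp only [duhamelIntegrand]
    split_ifs
    · simp only [mul_one, Pi.zero_apply, expWeight]; positivity
    · exact le_rfl

/-- Jensen again, at the reduced level `(1 - exp (-κt)) m`, because the truncated weight has only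
that mass. -/
lemma excess_duhamel_le {F : ℝ → ℝ → ℝ} {B : ℝ} (hκ : 0 < κ) (hF : Continuous (Function.uncurry F))
    (hB : ∀ x t, |F x t| ≤ B) (s m t : ℝ) :
    ∫⁻ x, ENNReal.ofReal (s * (duhamel ν c (expWeight κ) F x t -
      (1 - Real.exp (-κ * max t 0)) * m)) ≤
      delayAverage κ (fun r => excess s m fun x => F x r) t := by
  have hFm := hF.measurable
  have hm : Measurable fun q : ℝ × ℝ × ℝ => duhamelIntegrand ν c (expWeight κ)
      (fun x t => s * (F x t - m)) q.1 t q.2 := by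
    have h : Measurable fun q : ℝ × ℝ × ℝ =>
        F (q.1 + c * q.2.1 + √(2 * ν * q.2.1) * q.2.2) (t - q.2.1) :=
      hFm.comp (by fun_prop : Measurable fun q : ℝ × ℝ × ℝ =>
        (q.1 + c * q.2.1 + √(2 * ν * q.2.1) * q.2.2, t - q.2.1))
    exact Measurable.ite (measurableSet_lt (by fun_prop) measurable_const)
      (((measurable_expWeight κ).comp measurable_snd).mul ((h.sub_const m).const_mul s))
      measurable_const
  have i1 (x : ℝ) := integrable_duhamelIntegrand (ν := ν) (c := c) (measurable_expWeight κ)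
    (integrable_expWeight hκ) hFm hB x t
  have i2 (x : ℝ) := integrable_duhamelIntegrand (ν := ν) (c := c) (measurable_expWeight κ)
    (integrable_expWeight hκ) (F := fun _ _ => m) measurable_const (fun _ _ => le_rfl) x t
  have ei (x : ℝ) (p : ℝ × ℝ) : duhamelIntegrand ν c (expWeight κ)
      (fun x t => s * (F x t - m)) x t p = s * (duhamelIntegrand ν c (expWeight κ) F x t p -
        duhamelIntegrand ν c (expWeight κ) (fun _ _ => m) x t p) := by
    simp only [duhamelIntegrand]
    split_ifs <;> ring
  have hint (x : ℝ) : Integrable (duhamelIntegrand ν c (expWeight κ)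
      (fun x t => s * (F x t - m)) x t) delayMeasure := by
    exact (((i1 x).sub (i2 x)).const_mul s).congr (Eventually.of_forall fun p => (ei x p).symm)
  calc ∫⁻ x, ENNReal.ofReal (s * (duhamel ν c (expWeight κ) F x t -
        (1 - Real.exp (-κ * max t 0)) * m))
      ≤ ∫⁻ x, ∫⁻ p, ENNReal.ofReal (duhamelIntegrand ν c (expWeight κ)
          (fun x t => s * (F x t - m)) x t p) ∂delayMeasure := by
        refine lintegral_mono fun x => ?_
        have e : s * (duhamel ν c (expWeight κ) F x t - (1 - Real.exp (-κ * max t 0)) * m) =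
            ∫ p, duhamelIntegrand ν c (expWeight κ) (fun x t => s * (F x t - m)) x t p
              ∂delayMeasure := by
          simp only [ei]
          rw [integral_const_mul, integral_sub (i1 x) (i2 x),
            ← duhamel_const (ν := ν) (c := c) hκ m x t]
          rfl
        rw [e]
        exact ofReal_integral_le (hint x)
    _ = delayAverage κ (fun r => excess s m fun x => F x r) t := by
        rw [lintegral_lintegral_swap hm.ennreal_ofReal.aemeasurable]
        refine lintegral_congr fun p => ?_
        simp only [duhamelIntegrand]
        split_ifs
        · simp only [ENNReal.ofReal_mul (show 0 ≤ expWeight κ p by unfold expWeight; positivity)]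
          rw [lintegral_const_mul' _ _ (by simp)]
          congr 1
          simp only [add_assoc]
          exact excess_comp_add s m (c * p.1 + √(2 * ν * p.1) * p.2) fun x => F x (t - p.1)
        · simp

/-- The level is split as `m = exp (-κt) m + (1 - exp (-κt)) m`, matching the masses of the free and
Duhamel parts; subadditivity of the positive part then separates them. -/
lemma excess_kineticComponent_le (hκ : 0 < κ) (hM : IsMaxwellianPair M M₂)
    (hw : IsInitialProfile b B₁ B₂ w w') (hu : Continuous (Function.uncurry u))
    (hub : ∀ x t, |u x t| ≤ b) (s m t : ℝ) :
    excess s m (fun x => kineticComponent κ ν c M w u x t) ≤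
      ENNReal.ofReal (Real.exp (-κ * max t 0)) * excess s m w +
        delayAverage κ (fun r => excess s m fun x => M (u x r)) t := by
  have hc : Continuous fun x => driftHeat ν c w x (max t 0) :=
    continuous_driftHeat_comp hw.continuous hw.bound continuous_id continuous_const
  have h1 := excess_driftHeat_le (ν := ν) (c := c) hw.continuous hw.bound s m (max t 0)
  have h2 := excess_duhamel_le (ν := ν) (c := c) hκ (continuous_comp_uncurry hM.continuous hu)
    (hM.bound hub) s m t
  refine le_trans ?_ (add_le_add (mul_le_mul_right h1 _) h2)
  unfold excess
  rw [← lintegral_const_mul' _ _ (by simp), ← lintegral_add_left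
    (by have := hc.measurable; fun_prop)]
  refine lintegral_mono fun x => ?_
  rw [← ENNReal.ofReal_mul (Real.exp_nonneg _)]
  refine le_trans (le_of_eq ?_) ENNReal.ofReal_add_le
  congr 1
  simp only [kineticComponent]
  ring

lemma measurable_excess {F : ℝ → ℝ → ℝ} (hF : Measurable (Function.uncurry F)) (s m : ℝ) :
    Measurable fun r => excess s m fun x => F x r :=
  Measurable.lintegral_prod_left' (f := fun q : ℝ × ℝ => ENNReal.ofReal (s * (F q.1 q.2 - m)))
    ((hF.sub_const m).const_mul s).ennreal_ofReal

/-- Entropy dissipation for the kinetic components. -/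
lemma excess_kineticComponents_le (hκ : 0 < κ) (hM : IsMaxwellianPair M₁ M₂)
    (h₁ : IsInitialProfile b B₁ B₂ w₁ w₁') (h₂ : IsInitialProfile b B₁ B₂ w₂ w₂')
    (hu : Continuous (Function.uncurry u)) (hub : ∀ x t, |u x t| ≤ b) (s k : ℝ)
    (hE : ∀ t, excess s k (fun x => u x t) ≤ excess s (M₁ k) w₁ + excess s (M₂ k) w₂) (t : ℝ) :
    excess s (M₁ k) (fun x => kineticComponent κ ν a M₁ w₁ u x t) +
      excess s (M₂ k) (fun x => kineticComponent κ ν (-a) M₂ w₂ u x t) ≤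
      excess s (M₁ k) w₁ + excess s (M₂ k) w₂ := by
  set E := excess s (M₁ k) w₁ + excess s (M₂ k) w₂
  have e1 := excess_kineticComponent_le (ν := ν) (c := a) hκ hM h₁ hu hub s (M₁ k) t
  have e2 := excess_kineticComponent_le (ν := ν) (c := -a) hκ hM.symm h₂ hu hub s (M₂ k) t
  -- At each past time the two equilibrium excesses together are at most the excess of `u`, hence at
  -- most `E`. Averaging gives `(1 - exp (-κt)) E`, and the free part supplies the missing `exp
  -- (-κt) E`.
  have e3 : delayAverage κ (fun r => excess s (M₁ k) fun x => M₁ (u x r)) t +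
      delayAverage κ (fun r => excess s (M₂ k) fun x => M₂ (u x r)) t ≤
      delayAverage κ (fun _ => E) t := by
    have hm := measurable_excess (continuous_comp_uncurry hM.continuous hu).measurable s (M₁ k)
    have hω := measurable_expWeight κ
    unfold delayAverage
    rw [← lintegral_add_left]
    · refine lintegral_mono fun p => ?_
      dsimp only
      split_ifs
      · rw [← mul_add]
        refine mul_le_mul_right ?_ _
        exact (excess_maxwellian_add_le hM s k (continuous_slice hu _).measurable).trans (hE _)
      · simp
    · exact Measurable.ite (measurableSet_lt (by fun_prop) measurable_const)
        (hω.ennreal_ofReal.mul (hm.comp (by fun_prop))) measurable_const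
  rw [delayAverage_const hκ] at e3
  calc _ ≤ _ := add_le_add e1 e2
    _ = ENNReal.ofReal (Real.exp (-κ * max t 0)) * E +
        (delayAverage κ (fun r => excess s (M₁ k) fun x => M₁ (u x r)) t +
          delayAverage κ (fun r => excess s (M₂ k) fun x => M₂ (u x r)) t) := by ring
    _ ≤ ENNReal.ofReal (Real.exp (-κ * max t 0)) * E +
        ENNReal.ofReal (1 - Real.exp (-κ * max t 0)) * E := by gcongr
    _ = E := by
        rw [← add_mul, ← ENNReal.ofReal_add (Real.exp_nonneg _)
          (sub_nonneg.2 (exp_damping_le_one hκ t))]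
        simp

/-- Each step bounds the new density by the sum of its components. The induction starts at the zero
iterate, whose excess vanishes exactly because `s * k ≥ 0`. -/
lemma excess_picard_le (hκ : 0 < κ) (hM : IsMaxwellianPair M₁ M₂)
    (h₁ : IsInitialProfile b B₁ B₂ w₁ w₁') (h₂ : IsInitialProfile b B₁ B₂ w₂ w₂') (s k : ℝ)
    (hs : 0 ≤ s * k) (n : ℕ) :
    ∀ t, excess s k (fun x => picard κ ν a M₁ M₂ w₁ w₂ n x t) ≤
      excess s (M₁ k) w₁ + excess s (M₂ k) w₂ := by
  induction n with
  | zero =>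
    intro t
    have : s * (0 - k) ≤ 0 := by linarith
    simp only [picard, excess, ENNReal.ofReal_of_nonpos this, lintegral_zero, zero_le]
  | succ n ih =>
    intro t
    have hn := picard_regular (ν := ν) (a := a) hκ hM h₁ h₂ n
    refine le_trans ?_ (excess_kineticComponents_le (ν := ν) (a := a) hκ hM h₁ h₂ hn.1 hn.2 s k ih t)
    conv_lhs => rw [← hM.add k]
    exact excess_add_le s (M₁ k) (M₂ k)
      (continuous_slice (continuous_kineticComponent hκ hM h₁ hn.1 hn.2) t).measurable

/-- Fatou's lemma along the Picard iterates. -/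
lemma excess_density_le (hκ : 0 < κ) (hM : IsMaxwellianPair M₁ M₂)
    (h₁ : IsInitialProfile b B₁ B₂ w₁ w₁') (h₂ : IsInitialProfile b B₁ B₂ w₂ w₂') (s k : ℝ)
    (hs : 0 ≤ s * k) (t : ℝ) :
    excess s k (fun x => density κ ν a M₁ M₂ w₁ w₂ x t) ≤
      excess s (M₁ k) w₁ + excess s (M₂ k) w₂ := by
  have hl (x : ℝ) : ENNReal.ofReal (s * (density κ ν a M₁ M₂ w₁ w₂ x t - k)) =
      liminf (fun n => ENNReal.ofReal (s * (picard κ ν a M₁ M₂ w₁ w₂ n x t - k))) atTop :=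
    (ENNReal.tendsto_ofReal
      (((tendsto_picard hκ hM h₁ h₂ x t).sub_const k).const_mul s)).liminf_eq.symm
  unfold excess
  simp only [hl]
  refine (lintegral_liminf_le fun n => ?_).trans ?_
  · have := (continuous_slice (picard_regular (ν := ν) (a := a) hκ hM h₁ h₂ n).1 t).measurable
    fun_prop
  · refine liminf_le_of_le (by isBoundedDefault) fun y hy => ?_
    obtain ⟨n, hn⟩ := hy.exists
    exact hn.trans (excess_picard_le hκ hM h₁ h₂ s k hs n t)

end kruzkov

end ViscousPSystem

/-! ### From one-sided excesses to a quadratic entropy -/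

namespace ViscousPSystem
open Filter Topology ProbabilityTheory

/-- One-sided excesses integrated over the levels `M (s k)`, `0 < k ≤ R`. -/
noncomputable def layer (s R : ℝ) (M : ℝ → ℝ) (x : ℝ) : ℝ≥0∞ :=
  ∫⁻ k in Ioc 0 R, ENNReal.ofReal (s * (x - M (s * k)))

section layer

variable {κ ν a b B₁ B₂ R θ : ℝ} {M M₂ M₁ w₁ w₁' w₂ w₂' : ℝ → ℝ}

/-- Since `|M (s k)| ≤ k`, every level `k ≤ s x / 2` contributes at least `s x / 2`, over an
interval of that same length. -/
lemma ofReal_sq_le_layer (hM : IsMaxwellianPair M M₂) {s x : ℝ} (hs : |s| = 1) (h0 : 0 ≤ s * x)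
    (hR : s * x ≤ R) : ENNReal.ofReal (s * x / 2) ^ 2 ≤ layer s R M x := by
  calc ENNReal.ofReal (s * x / 2) ^ 2
      = ∫⁻ _ in Ioc 0 (s * x / 2), ENNReal.ofReal (s * x / 2) := by
        rw [setLIntegral_const, Real.volume_Ioc, sub_zero, sq]
    _ ≤ ∫⁻ k in Ioc 0 (s * x / 2), ENNReal.ofReal (s * (x - M (s * k))) := by
        refine setLIntegral_mono' measurableSet_Ioc fun k hk => ENNReal.ofReal_le_ofReal ?_
        have h1 : s * M (s * k) ≤ k := by
          refine (le_abs_self _).trans ?_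
          rw [abs_mul, hs, one_mul]
          refine (hM.abs_le _).trans ?_
          rw [abs_mul, hs, one_mul, abs_of_pos hk.1]
        rw [mul_sub]
        linarith [hk.2]
    _ ≤ layer s R M x := lintegral_mono_set (Ioc_subset_Ioc_right (by linarith))

lemma enorm_sq_le_layer (hM : IsMaxwellianPair M M₂) {x : ℝ} (hR : |x| ≤ R) :
    ‖x‖ₑ ^ 2 ≤ 4 * (layer 1 R M x + layer (-1) R M x) := by
  have key (s : ℝ) (hs : |s| = 1) (h : s * x = |x|) : ‖x‖ₑ ^ 2 ≤ 4 * layer s R M x := by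
    have h1 := ofReal_sq_le_layer (R := R) (s := s) (x := x) hM hs (h ▸ abs_nonneg x) (h ▸ hR)
    rw [h] at h1
    calc ‖x‖ₑ ^ 2 = 4 * ENNReal.ofReal (|x| / 2) ^ 2 := by
          rw [Real.enorm_eq_ofReal_abs, ← ENNReal.ofReal_pow (abs_nonneg _),
            ← ENNReal.ofReal_pow (by positivity), ← ENNReal.ofReal_ofNat 4,
            ← ENNReal.ofReal_mul (by norm_num)]
          congr 1; ring
      _ ≤ _ := by gcongr
  rcases le_total 0 x with h | h
  · refine (key 1 (by simp) (by rw [abs_of_nonneg h, one_mul])).trans ?_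
    gcongr; exact le_self_add
  · refine (key (-1) (by simp) (by rw [abs_of_nonpos h]; ring)).trans ?_
    gcongr; exact le_add_self

/-- The levels `M (s k)` lie on the side of `s`, so a value on the other side has no excess over any
of them. -/
lemma layer_eq_zero (hθ : 0 < θ) {s x : ℝ} (hM : ∀ k ∈ Ioc 0 R, θ * k ≤ s * M (s * k))
    (hx : s * x ≤ 0) : layer s R M x = 0 := by
  unfold layer
  rw [setLIntegral_congr_fun (g := fun _ => 0) measurableSet_Ioc]
  · simp
  · intro k hk
    refine ENNReal.ofReal_of_nonpos ?_
    have := hM k hk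
    have := mul_pos hθ hk.1
    rw [mul_sub]
    linarith

/-- Slope at least `θ` means that levels `k > s x / θ` lie beyond `x` and contribute nothing; each
remaining level contributes at most `s x`. -/
lemma layer_le (hθ : 0 < θ) {s x : ℝ} (hM : ∀ k ∈ Ioc 0 R, θ * k ≤ s * M (s * k))
    (hx : 0 ≤ s * x) : layer s R M x ≤ ENNReal.ofReal (1 / θ) * ENNReal.ofReal (s * x) ^ 2 := by
  calc layer s R M x
      ≤ ∫⁻ k in Ioc 0 R, (Ioc 0 (s * x / θ)).indicator (fun _ => ENNReal.ofReal (s * x)) k := by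
        refine setLIntegral_mono' measurableSet_Ioc fun k hk => ?_
        have h1 := hM k hk
        have h2 := mul_pos hθ hk.1
        by_cases h : k ≤ s * x / θ
        · rw [indicator_of_mem (show k ∈ Ioc 0 (s * x / θ) from ⟨hk.1, h⟩)]
          refine ENNReal.ofReal_le_ofReal ?_
          rw [mul_sub]; linarith
        · rw [ENNReal.ofReal_of_nonpos]
          · exact zero_le
          · rw [not_le, div_lt_iff₀ hθ] at h
            rw [mul_sub]; linarith
    _ ≤ ∫⁻ k, (Ioc 0 (s * x / θ)).indicator (fun _ => ENNReal.ofReal (s * x)) k :=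
        setLIntegral_le_lintegral _ _
    _ = ENNReal.ofReal (1 / θ) * ENNReal.ofReal (s * x) ^ 2 := by
        rw [lintegral_indicator measurableSet_Ioc, setLIntegral_const, Real.volume_Ioc, sub_zero,
          div_eq_mul_one_div (s * x) θ, ENNReal.ofReal_mul hx]
        ring

lemma layer_add_le (hθ : 0 < θ) (hMp : ∀ k ∈ Ioc 0 R, θ * k ≤ M k)
    (hMn : ∀ k ∈ Ioc 0 R, θ * k ≤ -M (-k)) (x : ℝ) :
    layer 1 R M x + layer (-1) R M x ≤ ENNReal.ofReal (1 / θ) * ‖x‖ₑ ^ 2 := by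
  rw [Real.enorm_eq_ofReal_abs]
  rcases le_total 0 x with h | h
  · rw [layer_eq_zero (s := -1) hθ (by simpa using hMn) (by linarith), add_zero, abs_of_nonneg h]
    simpa using layer_le (s := 1) hθ (by simpa using hMp) (by linarith : 0 ≤ 1 * x)
  · rw [layer_eq_zero (s := 1) hθ (by simpa using hMp) (by linarith), zero_add, abs_of_nonpos h]
    simpa using layer_le (s := -1) hθ (by simpa using hMn) (by linarith : 0 ≤ -1 * x)

lemma measurable_layer (hM : Measurable M) (s R : ℝ) : Measurable (layer s R M) :=
  Measurable.lintegral_prod_right' (f := fun q : ℝ × ℝ => ENNReal.ofReal (s * (q.1 - M (s * q.2))))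
    (by fun_prop)

lemma lintegral_layer (hM : Measurable M) {f : ℝ → ℝ} (hf : Measurable f) (s R : ℝ) :
    ∫⁻ x, layer s R M (f x) = ∫⁻ k in Ioc 0 R, excess s (M (s * k)) f := by
  unfold layer
  rw [lintegral_lintegral_swap]
  · rfl
  · exact Measurable.aemeasurable (by fun_prop)

/-- The Maxwellians have a positive lower slope on bounded sets. -/
lemma IsMaxwellianPair.exists_slope (hM : IsMaxwellianPair M M₂) (hR : 0 ≤ R) :
    ∃ θ > 0, (∀ k ∈ Ioc 0 R, θ * k ≤ M k) ∧ ∀ k ∈ Ioc 0 R, θ * k ≤ -M (-k) := by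
  obtain ⟨z, hz, hmin⟩ := isCompact_Icc.exists_isMinOn (nonempty_Icc.2 (by linarith : -R ≤ R))
    hM.continuous_deriv.continuousOn
  have key (x y : ℝ) (hx : x ∈ Icc (-R) R) (hy : y ∈ Icc (-R) R) (hxy : x ≤ y) :
      deriv M z * (y - x) ≤ M y - M x :=
    (convex_Icc (-R) R).mul_sub_le_image_sub_of_le_deriv hM.continuous.continuousOn
      (hM.contDiff₁.differentiable one_ne_zero).differentiableOn
      (fun u hu => hmin (interior_subset hu)) x hx y hy hxy
  refine ⟨deriv M z, hM.deriv_pos₁ z, fun k hk => ?_, fun k hk => ?_⟩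
  · simpa [hM.zero₁] using key 0 k ⟨by linarith, hR⟩ ⟨by linarith [hk.1], hk.2⟩ hk.1.le
  · simpa [hM.zero₁] using key (-k) 0 ⟨by linarith [hk.2], by linarith [hk.1]⟩ ⟨by linarith, hR⟩
      (by linarith [hk.1])

/-- The `L²` norm of the kinetic components is controlled uniformly in time by the data. -/
lemma sqNorm_kineticComponents_le (hκ : 0 < κ) (hM : IsMaxwellianPair M₁ M₂)
    (h₁ : IsInitialProfile b B₁ B₂ w₁ w₁') (h₂ : IsInitialProfile b B₁ B₂ w₂ w₂')
    (hθ : 0 < θ) (hθ₁ : ∀ k ∈ Ioc 0 R, θ * k ≤ M₁ k) (hθ₁' : ∀ k ∈ Ioc 0 R, θ * k ≤ -M₁ (-k))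
    (hθ₂ : ∀ k ∈ Ioc 0 R, θ * k ≤ M₂ k) (hθ₂' : ∀ k ∈ Ioc 0 R, θ * k ≤ -M₂ (-k)) (t : ℝ)
    (hR₁ : ∀ x, |kineticComponent κ ν a M₁ w₁ (density κ ν a M₁ M₂ w₁ w₂) x t| ≤ R)
    (hR₂ : ∀ x, |kineticComponent κ ν (-a) M₂ w₂ (density κ ν a M₁ M₂ w₁ w₂) x t| ≤ R) :
    sqNorm (fun x => kineticComponent κ ν a M₁ w₁ (density κ ν a M₁ M₂ w₁ w₂) x t) +
      sqNorm (fun x => kineticComponent κ ν (-a) M₂ w₂ (density κ ν a M₁ M₂ w₁ w₂) x t) ≤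
      4 * ENNReal.ofReal (1 / θ) * (sqNorm w₁ + sqNorm w₂) := by
  have m1 := hM.continuous.measurable
  have m2 := hM.symm.continuous.measurable
  have hu := continuous_density (ν := ν) (a := a) hκ hM h₁ h₂
  have hub := abs_density_le (ν := ν) (a := a) hκ hM h₁ h₂
  set u := density κ ν a M₁ M₂ w₁ w₂
  set f₁ := fun x => kineticComponent κ ν a M₁ w₁ u x t
  set f₂ := fun x => kineticComponent κ ν (-a) M₂ w₂ u x t
  have c1 : Measurable f₁ := (continuous_slice (continuous_kineticComponent hκ hM h₁ hu hub) t).measurable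
  have c2 : Measurable f₂ :=
    (continuous_slice (continuous_kineticComponent hκ hM.symm h₂ hu hub) t).measurable
  have v1 := h₁.continuous.measurable
  have v2 := h₂.continuous.measurable
  -- The entropy inequality holds at each level `s * k`, which satisfies `s * (s * k) ≥ 0`.
  -- Integration over `k` turns it into an inequality between the layer functionals.
  have hdiss (s : ℝ) (hs : s = 1 ∨ s = -1) :
      (∫⁻ x, layer s R M₁ (f₁ x)) + ∫⁻ x, layer s R M₂ (f₂ x) ≤
        (∫⁻ x, layer s R M₁ (w₁ x)) + ∫⁻ x, layer s R M₂ (w₂ x) := by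
    have hmeas {f M : ℝ → ℝ} (hf : Measurable f) (hM : Measurable M) :
        Measurable fun k => excess s (M (s * k)) f :=
      Measurable.lintegral_prod_right' (f := fun q : ℝ × ℝ =>
        ENNReal.ofReal (s * (f q.2 - M (s * q.1)))) (by fun_prop)
    rw [lintegral_layer m1 c1, lintegral_layer m2 c2, lintegral_layer m1 v1, lintegral_layer m2 v2,
      ← lintegral_add_left (hmeas c1 m1), ← lintegral_add_left (hmeas v1 m1)]
    refine setLIntegral_mono' measurableSet_Ioc fun k hk => ?_
    refine excess_kineticComponents_le hκ hM h₁ h₂ hu hub s (s * k)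
      (excess_density_le hκ hM h₁ h₂ s (s * k) ?_) t
    rw [← mul_assoc]
    exact mul_nonneg (mul_self_nonneg s) hk.1.le
  have hlow {f M M' : ℝ → ℝ} (hM : IsMaxwellianPair M M') (hf : Measurable f)
      (hfR : ∀ x, |f x| ≤ R) :
      sqNorm f ≤ 4 * ((∫⁻ x, layer 1 R M (f x)) + ∫⁻ x, layer (-1) R M (f x)) := by
    have := (measurable_layer hM.continuous.measurable 1 R).comp hf
    rw [← lintegral_add_left (by exact this), ← lintegral_const_mul' _ _ (by simp)]
    exact lintegral_mono fun x => enorm_sq_le_layer hM (hfR x)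
  have hup {f M : ℝ → ℝ} (hM : Measurable M) (hf : Measurable f)
      (hp : ∀ k ∈ Ioc 0 R, θ * k ≤ M k) (hn : ∀ k ∈ Ioc 0 R, θ * k ≤ -M (-k)) :
      (∫⁻ x, layer 1 R M (f x)) + ∫⁻ x, layer (-1) R M (f x) ≤
        ENNReal.ofReal (1 / θ) * sqNorm f := by
    have := (measurable_layer hM 1 R).comp hf
    rw [← lintegral_add_left (by exact this), sqNorm, ← lintegral_const_mul' _ _ (by simp)]
    exact lintegral_mono fun x => layer_add_le hθ hp hn (f x)
  have p1 := hdiss 1 (Or.inl rfl)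
  have p2 := hdiss (-1) (Or.inr rfl)
  calc sqNorm f₁ + sqNorm f₂
      ≤ 4 * ((∫⁻ x, layer 1 R M₁ (f₁ x)) + ∫⁻ x, layer (-1) R M₁ (f₁ x)) +
        4 * ((∫⁻ x, layer 1 R M₂ (f₂ x)) + ∫⁻ x, layer (-1) R M₂ (f₂ x)) :=
        add_le_add (hlow hM c1 hR₁) (hlow hM.symm c2 hR₂)
    _ = 4 * (((∫⁻ x, layer 1 R M₁ (f₁ x)) + ∫⁻ x, layer 1 R M₂ (f₂ x)) +
          ((∫⁻ x, layer (-1) R M₁ (f₁ x)) + ∫⁻ x, layer (-1) R M₂ (f₂ x))) := by ring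
    _ ≤ 4 * (((∫⁻ x, layer 1 R M₁ (w₁ x)) + ∫⁻ x, layer 1 R M₂ (w₂ x)) +
          ((∫⁻ x, layer (-1) R M₁ (w₁ x)) + ∫⁻ x, layer (-1) R M₂ (w₂ x))) := by gcongr
    _ = 4 * (((∫⁻ x, layer 1 R M₁ (w₁ x)) + ∫⁻ x, layer (-1) R M₁ (w₁ x)) +
          ((∫⁻ x, layer 1 R M₂ (w₂ x)) + ∫⁻ x, layer (-1) R M₂ (w₂ x))) := by ring
    _ ≤ 4 * (ENNReal.ofReal (1 / θ) * sqNorm w₁ + ENNReal.ofReal (1 / θ) * sqNorm w₂) := by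
        gcongr
        · exact hup m1 v1 hθ₁ hθ₁'
        · exact hup m2 v2 hθ₂ hθ₂'
    _ = _ := by ring

end layer

end ViscousPSystem

/-! ### Maximum principle on the half plane -/

namespace ViscousPSystem
open Filter Topology ProbabilityTheory

/-- If `s > 0`, the second derivative test gives a local minimum as well, so `g` is locally constant
and `s = 0`, a contradiction. Differentiability of `g'` at the single point `x` is enough. -/
lemma IsLocalMax.second_deriv_nonpos {g g' : ℝ → ℝ} {x s : ℝ} (hg : ∀ y, HasDerivAt g (g' y) y)
    (hg' : HasDerivAt g' s x) (hmax : IsLocalMax g x) : s ≤ 0 := by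
  by_contra! hs
  have hd : deriv g = g' := funext fun y => (hg y).deriv
  have hmin : IsLocalMin g x := by
    refine isLocalMin_of_deriv_deriv_pos ?_ ?_ (hg x).continuousAt
    · rwa [hd, hg'.deriv]
    · exact hmax.deriv_eq_zero
  have hconst : g =ᶠ[𝓝 x] fun _ => g x := by
    filter_upwards [hmax, hmin] with y h1 h2 using le_antisymm h1 h2
  have h2 : deriv g =ᶠ[𝓝 x] fun _ => 0 := by
    have := hconst.deriv
    simpa using this
  have h3 := h2.deriv_eq
  rw [hd, hg'.deriv] at h3
  simp at h3
  exact hs.ne' h3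

/-- Only slopes from the left are compared, since the maximum is taken over times up to `t`. -/
lemma deriv_nonneg_of_max_right {g : ℝ → ℝ} {t s : ℝ} (ht : 0 < t) (hg : HasDerivAt g s t)
    (hmax : ∀ r ∈ Icc 0 t, g r ≤ g t) : 0 ≤ s := by
  have h := hasDerivWithinAt_iff_tendsto_slope.1 (hg.hasDerivWithinAt (s := Iio t))
  have hne : (𝓝[Iio t \ {t}] t).NeBot := by
    rw [sdiff_singleton_eq_self (by simp)]; infer_instance
  refine ge_of_tendsto h ?_
  rw [sdiff_singleton_eq_self (by simp)]
  filter_upwards [Ioo_mem_nhdsLT ht] with r hr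
  rw [slope_def_field]
  exact div_nonneg_of_nonpos (sub_nonpos.2 (hmax r ⟨hr.1.le, hr.2.le⟩)) (by linarith [hr.2])

/-- Weak maximum principle for bounded subsolutions of weakly coupled parabolic systems on a
half space. -/
theorem parabolic_maximum_principle {ι : Type*} [Fintype ι] {ν L B : ℝ} (hν : 0 ≤ ν) (hL : 0 ≤ L)
    {c : ι → ℝ} {Z Zt Zx Zxx : ι → ℝ → ℝ → ℝ}
    (hcont : ∀ i, ContinuousOn (fun p : ℝ × ℝ => Z i p.1 p.2) {p | 0 ≤ p.2})
    (hB : ∀ i x t, 0 ≤ t → Z i x t ≤ B)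
    (ht : ∀ i x t, 0 < t → HasDerivAt (fun s => Z i x s) (Zt i x t) t)
    (hx : ∀ i x t, 0 < t → HasDerivAt (fun y => Z i y t) (Zx i x t) x)
    (hxx : ∀ i x t, 0 < t → HasDerivAt (fun y => Zx i y t) (Zxx i x t) x)
    (hinit : ∀ i x, Z i x 0 ≤ 0)
    (heq : ∀ i x t, 0 < t → 0 < Z i x t → (∀ j, Z j x t ≤ Z i x t) →
      Zt i x t ≤ c i * Zx i x t + ν * Zxx i x t + L * Z i x t)
    (i : ι) (x t : ℝ) (h0t : 0 ≤ t) : Z i x t ≤ 0 := by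
  set C : ℝ := ∑ i, |c i|
  have hC (i : ι) : |c i| ≤ C :=
    Finset.single_le_sum (f := fun i => |c i|) (fun _ _ => abs_nonneg _) (Finset.mem_univ i)
  -- The damping rate absorbs the zero-order term (`L`), the drift of the penalty through `2|y| ≤ 1
  -- + y²` (`C`) and its diffusion (`2ν`); the remaining `1` gives the strict inequality.
  set l : ℝ := L + C + 2 * ν + 1
  suffices H : ∀ δ > 0, Real.exp (-l * t) * Z i x t ≤ δ * (1 + x ^ 2) by
    have h1 : Real.exp (-l * t) * Z i x t ≤ 0 := by
      refine le_of_forall_pos_le_add fun η hη => ?_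
      have hp : 0 < 1 + x ^ 2 := by positivity
      have := H (η / (1 + x ^ 2)) (by positivity)
      rwa [div_mul_cancel₀ _ hp.ne', ← zero_add η] at this
    exact nonpos_of_mul_nonpos_right h1 (Real.exp_pos _)
  intro δ hδ
  by_contra! hlt
  set Φ : ι → ℝ × ℝ → ℝ := fun i p => Real.exp (-l * p.2) * Z i p.1 p.2 - δ * (1 + p.1 ^ 2)
  have hΦ : 0 < Φ i (x, t) := sub_pos.2 hlt
  have hC0 : 0 ≤ C := (abs_nonneg _).trans (hC i)
  have hl0 : 0 ≤ l := by positivity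
  -- For `|z| ≥ R` the penalty `δ (1 + z²) ≥ δ |z|` exceeds the bound on `Z`, so a positive maximum
  -- over the box lies in its spatial interior.
  set R : ℝ := max |x| (max B 0 / δ)
  have hxR : |x| ≤ R := le_max_left _ _
  set S : Set (ℝ × ℝ) := Icc (-R) R ×ˢ Icc 0 t
  have hS : IsCompact S := isCompact_Icc.prod isCompact_Icc
  have hmem : (x, t) ∈ S := ⟨abs_le.1 hxR, h0t, le_rfl⟩
  have hΦc (i : ι) : ContinuousOn (Φ i) S := by
    refine ContinuousOn.sub (ContinuousOn.mul (Continuous.continuousOn (by fun_prop)) ?_)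
      (Continuous.continuousOn (by fun_prop))
    exact (hcont i).mono fun p hp => hp.2.1
  have hex (j : ι) := hS.exists_isMaxOn ⟨_, hmem⟩ (hΦc j)
  choose q hqS hqmax using hex
  -- Maximising over components as well as points makes component `j` dominate all others at the
  -- maximum, which is the situation in which the differential inequality is assumed.
  obtain ⟨j, -, hj⟩ := Finset.exists_max_image Finset.univ (fun j => Φ j (q j)) ⟨i, Finset.mem_univ i⟩
  have hmax (k : ι) (p : ℝ × ℝ) (hp : p ∈ S) : Φ k p ≤ Φ j (q j) :=
    (hqmax k hp).trans (hj k (Finset.mem_univ k))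
  rcases hq : q j with ⟨y, s⟩
  rw [hq] at hmax
  have hyS : (y, s) ∈ S := hq ▸ hqS j
  have hpos : 0 < Φ j (y, s) := hΦ.trans_le (hmax i _ hmem)
  have hexp (r : ℝ) : 0 < Real.exp (-l * r) := Real.exp_pos _
  have hs : 0 < s := by
    refine lt_of_le_of_ne hyS.2.1 fun h => ?_
    have h1 := hinit j y
    have h2 : 0 ≤ δ * (1 + y ^ 2) := by positivity
    simp only [Φ, ← h, mul_zero, Real.exp_zero, one_mul] at hpos
    linarith
  have hbig (r : ℝ) (hr : 0 ≤ r) (z : ℝ) (hz : R ≤ |z|) : Φ j (z, r) ≤ 0 := by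
    have h1 : Real.exp (-l * r) * Z j z r ≤ max B 0 := by
      have e1 : Real.exp (-l * r) ≤ 1 := by
        rw [Real.exp_le_one_iff]; nlinarith
      calc _ ≤ Real.exp (-l * r) * max B 0 :=
            mul_le_mul_of_nonneg_left ((hB j z r hr).trans (le_max_left _ _)) (hexp r).le
        _ ≤ _ := mul_le_of_le_one_left (le_max_right _ _) e1
    have h2 : max B 0 / δ ≤ |z| := (le_max_right _ _).trans hz
    rw [div_le_iff₀ hδ] at h2
    have h3 : |z| ≤ 1 + z ^ 2 := by
      rw [← sq_abs]; nlinarith [sq_nonneg (|z| - 1)]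
    have h4 := mul_le_mul_of_nonneg_left h3 hδ.le
    simp only [Φ]
    linarith
  have hy : |y| < R := by
    by_contra! h
    exact (hbig s hs.le y h).not_gt hpos
  have hloc : IsLocalMax (fun z => Φ j (z, s)) y := by
    filter_upwards [(continuous_abs.tendsto y).eventually (gt_mem_nhds hy)] with z hz
    exact hmax j (z, s) ⟨abs_le.1 (le_of_lt hz), hyS.2⟩
  have d1 (z : ℝ) : HasDerivAt (fun z => Φ j (z, s))
      (Real.exp (-l * s) * Zx j z s - δ * (2 * z)) z := by
    have h1 := (hx j z s hs).const_mul (Real.exp (-l * s))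
    have h2 := (((hasDerivAt_id z).pow 2).const_add 1).const_mul δ
    refine (h1.sub h2).congr_deriv ?_
    simp
  have d2 : HasDerivAt (fun z => Real.exp (-l * s) * Zx j z s - δ * (2 * z))
      (Real.exp (-l * s) * Zxx j y s - δ * 2) y := by
    have h1 := (hxx j y s hs).const_mul (Real.exp (-l * s))
    have h2 := ((hasDerivAt_id y).const_mul 2).const_mul δ
    refine (h1.sub h2).congr_deriv ?_
    simp
  have d3 : HasDerivAt (fun r => Φ j (y, r))
      (Real.exp (-l * s) * Zt j y s - l * (Real.exp (-l * s) * Z j y s)) s := by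
    have h1 := (((hasDerivAt_id s).const_mul (-l)).exp.mul (ht j y s hs)).sub_const (δ * (1 + y ^ 2))
    refine h1.congr_deriv ?_
    simp only [id]; ring
  have e1 := hloc.hasDerivAt_eq_zero (d1 y)
  have e2 := IsLocalMax.second_deriv_nonpos d1 d2 hloc
  have e3 := deriv_nonneg_of_max_right hs d3 fun r hr =>
    hmax j (y, r) ⟨hyS.1, hr.1, hr.2.trans hyS.2.2⟩
  have hE : δ * (1 + y ^ 2) < Real.exp (-l * s) * Z j y s := sub_pos.1 hpos
  have hZpos : 0 < Z j y s := by
    have : 0 < Real.exp (-l * s) * Z j y s := lt_trans (by positivity) hE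
    exact pos_of_mul_pos_right this (hexp s).le
  have hdom (k : ι) : Z k y s ≤ Z j y s := by
    have := hmax k (y, s) hyS
    simp only [Φ] at this
    exact le_of_mul_le_mul_left (by linarith) (hexp s)
  have e4 := mul_le_mul_of_nonneg_left (heq j y s hs hZpos hdom) (hexp s).le
  have e5 : c j * (δ * (2 * y)) ≤ C * (δ * (1 + y ^ 2)) := by
    have a1 : c j * (δ * (2 * y)) ≤ |c j| * (δ * (2 * |y|)) := by
      refine (le_abs_self _).trans (le_of_eq ?_)
      rw [abs_mul, abs_mul, abs_mul, abs_of_pos hδ, abs_two]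
    have a2 : 2 * |y| ≤ 1 + y ^ 2 := by
      rw [← sq_abs]; nlinarith [sq_nonneg (|y| - 1)]
    exact a1.trans (mul_le_mul (hC j) (mul_le_mul_of_nonneg_left a2 hδ.le) (by positivity) hC0)
  have e6 : ν * (δ * 2) ≤ 2 * ν * (δ * (1 + y ^ 2)) := by
    have : 0 ≤ ν * δ * y ^ 2 := by positivity
    nlinarith
  have e7 : ν * (Real.exp (-l * s) * Zxx j y s) ≤ ν * (δ * 2) :=
    mul_le_mul_of_nonneg_left (by linarith) hν
  have e8 : Real.exp (-l * s) * Zx j y s = δ * (2 * y) := by linarith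
  have e9 : Real.exp (-l * s) * (c j * Zx j y s) = c j * (δ * (2 * y)) := by rw [← e8]; ring
  have e10 : (C + 2 * ν) * (δ * (1 + y ^ 2)) ≤ (C + 2 * ν) * (Real.exp (-l * s) * Z j y s) :=
    mul_le_mul_of_nonneg_left hE.le (by positivity)
  have e11 : 0 < Real.exp (-l * s) * Z j y s := mul_pos (hexp s) hZpos
  simp only [l] at *
  nlinarith

/-- Bounded solutions of weakly coupled linear parabolic systems vanish if their data do. -/
theorem eq_zero_of_parabolic_system {ν L B : ℝ} (hν : 0 ≤ ν) (hL : 0 ≤ L)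
    {c : Fin 2 → ℝ} {W Wt Wx Wxx : Fin 2 → ℝ → ℝ → ℝ}
    (hcont : ∀ i, ContinuousOn (fun p : ℝ × ℝ => W i p.1 p.2) {p | 0 ≤ p.2})
    (hB : ∀ i x t, 0 ≤ t → |W i x t| ≤ B)
    (ht : ∀ i x t, 0 < t → HasDerivAt (fun s => W i x s) (Wt i x t) t)
    (hx : ∀ i x t, 0 < t → HasDerivAt (fun y => W i y t) (Wx i x t) x)
    (hxx : ∀ i x t, 0 < t → HasDerivAt (fun y => Wx i y t) (Wxx i x t) x)
    (hinit : ∀ i x, W i x 0 = 0)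
    (heq : ∀ i x t, 0 < t → ∀ m, (∀ j, |W j x t| ≤ m) →
      |Wt i x t - (c i * Wx i x t + ν * Wxx i x t)| ≤ L * m)
    (i : Fin 2) (x t : ℝ) (h0t : 0 ≤ t) : W i x t = 0 := by
  -- The principle is applied to the family `±Wᵢ`. A component that dominates this family equals
  -- `maxⱼ |Wⱼ|`, so the two-sided coupling becomes a one-sided inequality.
  set sg : Bool → ℝ := fun b => if b then 1 else -1
  have hsg (b : Bool) (r : ℝ) : sg b * r ≤ |r| := by
    cases b
    · simpa [sg] using neg_le_abs r
    · simpa [sg] using le_abs_self r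
  have key := parabolic_maximum_principle (ι := Fin 2 × Bool) (B := B) hν hL (c := fun q => c q.1)
    (Z := fun q x t => sg q.2 * W q.1 x t) (Zt := fun q x t => sg q.2 * Wt q.1 x t)
    (Zx := fun q x t => sg q.2 * Wx q.1 x t) (Zxx := fun q x t => sg q.2 * Wxx q.1 x t)
    (fun q => continuousOn_const.mul (hcont q.1))
    (fun q x t h => (hsg _ _).trans (hB q.1 x t h))
    (fun q x t h => (ht q.1 x t h).const_mul _)
    (fun q x t h => (hx q.1 x t h).const_mul _)
    (fun q x t h => (hxx q.1 x t h).const_mul _)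
    (fun q x => by simp [hinit])
    (fun q x t h hpos hdom => by
      have hm (j : Fin 2) : |W j x t| ≤ sg q.2 * W q.1 x t := by
        have h1 := hdom (j, true)
        have h2 := hdom (j, false)
        simp only [sg, if_true, Bool.false_eq_true, if_false] at h1 h2
        rw [abs_le]
        constructor <;> simp only [sg] <;> linarith
      have h3 := (hsg q.2 _).trans (heq q.1 x t h _ hm)
      linarith)
  have h1 := key (i, true) x t h0t
  have h2 := key (i, false) x t h0t
  simp only [sg, if_true, Bool.false_eq_true, if_false] at h1 h2
  linarith

end ViscousPSystem

/-! ### Regularity of the density and mean-square bounds for derivatives -/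

namespace ViscousPSystem
open Filter Topology ProbabilityTheory

lemma weightMassE_ne_top {κ ν : ℝ} (hκ : 0 < κ) (hν : 0 < ν) : weightMassE κ ν ≠ ⊤ :=
  (integrable_expWeightDx hκ hν).2.ne

lemma secondMoment_ne_top : secondMoment ≠ ⊤ := integrable_sq_stdGaussian.2.ne

/-- The `x`-derivative of `density`. -/
noncomputable def densityDx (κ ν a : ℝ) (M₁ M₂ w₁ w₂ w₁' w₂' : ℝ → ℝ) (x t : ℝ) : ℝ :=
  kineticComponentDx κ ν a M₁ w₁' (density κ ν a M₁ M₂ w₁ w₂) x t +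
    kineticComponentDx κ ν (-a) M₂ w₂' (density κ ν a M₁ M₂ w₁ w₂) x t

/-- The `t`-derivative of `kineticComponent`. -/
noncomputable def kineticComponentDt (κ ν c : ℝ) (M w w' : ℝ → ℝ) (u u' : ℝ → ℝ → ℝ) (x t : ℝ) : ℝ :=
  κ * (M (u x t) - kineticComponent κ ν c M w u x t) + c * kineticComponentDx κ ν c M w' u x t +
    ν * kineticComponentDxx κ ν c M w' u u' x t

section

variable {κ ν a b B₁ B₂ : ℝ} {M₁ M₂ w₁ w₁' w₂ w₂' : ℝ → ℝ}

/-- The density equals its own image under the fixed point map, and that map produces differentiable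
functions from continuous ones. -/
lemma hasDerivAt_density (hκ : 0 < κ) (hν : 0 < ν) (hM : IsMaxwellianPair M₁ M₂)
    (h₁ : IsInitialProfile b B₁ B₂ w₁ w₁') (h₂ : IsInitialProfile b B₁ B₂ w₂ w₂') (x t : ℝ) :
    HasDerivAt (fun x => density κ ν a M₁ M₂ w₁ w₂ x t)
      (densityDx κ ν a M₁ M₂ w₁ w₂ w₁' w₂' x t) x := by
  have e : (fun x => density κ ν a M₁ M₂ w₁ w₂ x t) = fun x =>
      densityMap κ ν a M₁ M₂ w₁ w₂ (density κ ν a M₁ M₂ w₁ w₂) x t :=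
    funext fun x => density_eq hκ hM h₁ h₂ x t
  rw [e]
  exact (hasDerivAt_kineticComponent hκ hν hM h₁ (continuous_density hκ hM h₁ h₂)
    (abs_density_le hκ hM h₁ h₂) x t).add (hasDerivAt_kineticComponent hκ hν hM.symm h₂
      (continuous_density hκ hM h₁ h₂) (abs_density_le hκ hM h₁ h₂) x t)

lemma continuous_densityDx (hκ : 0 < κ) (hν : 0 < ν) (hM : IsMaxwellianPair M₁ M₂)
    (h₁ : IsInitialProfile b B₁ B₂ w₁ w₁') (h₂ : IsInitialProfile b B₁ B₂ w₂ w₂') :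
    Continuous (Function.uncurry (densityDx κ ν a M₁ M₂ w₁ w₂ w₁' w₂')) :=
  (continuous_kineticComponentDx hκ hν hM h₁ (continuous_density hκ hM h₁ h₂)
    (abs_density_le hκ hM h₁ h₂)).add (continuous_kineticComponentDx hκ hν hM.symm h₂
      (continuous_density hκ hM h₁ h₂) (abs_density_le hκ hM h₁ h₂))

lemma abs_densityDx_le (hκ : 0 < κ) (hν : 0 < ν) (hM : IsMaxwellianPair M₁ M₂)
    (h₁ : IsInitialProfile b B₁ B₂ w₁ w₁') (h₂ : IsInitialProfile b B₁ B₂ w₂ w₂') (x t : ℝ) :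
    |densityDx κ ν a M₁ M₂ w₁ w₂ w₁' w₂' x t| ≤ 2 * (B₁ + weightMass κ ν * b) := by
  refine (abs_add_le _ _).trans ?_
  have e1 := abs_kineticComponentDx_le (c := a) hκ hν hM h₁
    (abs_density_le (ν := ν) (a := a) hκ hM h₁ h₂) x t
  have e2 := abs_kineticComponentDx_le (c := -a) hκ hν hM.symm h₂
    (abs_density_le (ν := ν) (a := a) hκ hM h₁ h₂) x t
  linarith

lemma sqNorm_kineticComponentDt_le {c : ℝ} {M M' w w' : ℝ → ℝ} {u u' : ℝ → ℝ → ℝ} {t : ℝ}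
    {N : ℝ≥0∞} (hκ : 0 < κ) (hν : 0 < ν)
    (hM : IsMaxwellianPair M M') (hw : IsInitialProfile b B₁ B₂ w w')
    (hu : Continuous (Function.uncurry u)) (hub : ∀ x t, |u x t| ≤ b)
    (hN : sqNorm (fun x => u x t) ≤ N)
    (hN₀ : sqNorm (fun x => kineticComponent κ ν c M w u x t) ≤ N)
    (hN₁ : sqNorm (fun x => kineticComponentDx κ ν c M w' u x t) ≤ N)
    (hN₂ : sqNorm (fun x => kineticComponentDxx κ ν c M w' u u' x t) ≤ N) :
    sqNorm (fun x => kineticComponentDt κ ν c M w w' u u' x t) ≤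
      8 * (‖κ‖ₑ ^ 2 * 2 + ‖c‖ₑ ^ 2 + ‖ν‖ₑ ^ 2) * N := by
  have m1 := (continuous_slice (continuous_kineticComponent (ν := ν) (c := c) hκ hM hw hu hub) t).measurable
  have m2 := (continuous_slice (continuous_kineticComponentDx (ν := ν) (c := c) hκ hν hM hw hu hub) t).measurable
  have m3 := (continuous_slice (continuous_comp_uncurry hM.continuous hu) t).measurable
  have e1 : sqNorm (fun x => M (u x t) - kineticComponent κ ν c M w u x t) ≤ 2 * (N + N) := by
    simp only [sub_eq_add_neg]
    refine (sqNorm_add_le m3).trans ?_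
    gcongr
    · exact (sqNorm_mono fun x => hM.abs_le _).trans hN
    · exact (sqNorm_mono fun x => (abs_neg _).le).trans hN₀
  unfold kineticComponentDt
  refine (sqNorm_add_le (((m3.sub m1).const_mul κ).add (m2.const_mul c))).trans ?_
  rw [sqNorm_const_mul]
  calc _ ≤ 2 * (2 * (‖κ‖ₑ ^ 2 * (2 * (N + N)) + ‖c‖ₑ ^ 2 * N) + ‖ν‖ₑ ^ 2 * N) := by
        gcongr
        refine (sqNorm_add_le ((m3.sub m1).const_mul κ)).trans ?_
        rw [sqNorm_const_mul, sqNorm_const_mul]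
        gcongr
        exact e1
    _ = (16 * (‖κ‖ₑ ^ 2) + 4 * ‖c‖ₑ ^ 2 + 2 * ‖ν‖ₑ ^ 2) * N := by ring
    _ ≤ (16 * (‖κ‖ₑ ^ 2) + 8 * ‖c‖ₑ ^ 2 + 8 * ‖ν‖ₑ ^ 2) * N := by
        gcongr <;> norm_num
    _ = _ := by ring

/-- The `L²` norms of the kinetic components and of their derivatives are controlled by the data,
uniformly in time. -/
lemma exists_sqNorm_bound (hκ : 0 < κ) (hν : 0 < ν) (hM : IsMaxwellianPair M₁ M₂) (hb : 0 ≤ b)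
    (a : ℝ) :
    ∃ C : ℝ≥0∞, C ≠ ⊤ ∧ ∀ (B₁ B₂ : ℝ) (w₁ w₁' w₂ w₂' : ℝ → ℝ) (N : ℝ≥0∞) (t : ℝ),
      IsInitialProfile b B₁ B₂ w₁ w₁' → IsInitialProfile b B₁ B₂ w₂ w₂' →
      sqNorm w₁ ≤ N → sqNorm w₂ ≤ N → sqNorm w₁' ≤ N → sqNorm w₂' ≤ N →
      (∀ h, sqNorm (fun x => w₁' (x + h) - w₁' x) ≤ ‖h‖ₑ ^ 2 * N) →
      (∀ h, sqNorm (fun x => w₂' (x + h) - w₂' x) ≤ ‖h‖ₑ ^ 2 * N) → 0 < t →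
      let u := density κ ν a M₁ M₂ w₁ w₂
      let u' := densityDx κ ν a M₁ M₂ w₁ w₂ w₁' w₂'
      (sqNorm (fun x => kineticComponent κ ν a M₁ w₁ u x t) ≤ C * N ∧
        sqNorm (fun x => kineticComponent κ ν (-a) M₂ w₂ u x t) ≤ C * N) ∧
      (sqNorm (fun x => kineticComponentDx κ ν a M₁ w₁' u x t) ≤ C * N ∧
        sqNorm (fun x => kineticComponentDx κ ν (-a) M₂ w₂' u x t) ≤ C * N) ∧
      (sqNorm (fun x => kineticComponentDxx κ ν a M₁ w₁' u u' x t) ≤ C * N ∧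
        sqNorm (fun x => kineticComponentDxx κ ν (-a) M₂ w₂' u u' x t) ≤ C * N) ∧
      (sqNorm (fun x => kineticComponentDt κ ν a M₁ w₁ w₁' u u' x t) ≤ C * N ∧
        sqNorm (fun x => kineticComponentDt κ ν (-a) M₂ w₂ w₂' u u' x t) ≤ C * N) := by
  obtain ⟨θ₁, hθ₁, p1, p1'⟩ := hM.exists_slope hb
  obtain ⟨θ₂, hθ₂, p2, p2'⟩ := hM.symm.exists_slope hb
  set θ := min θ₁ θ₂
  have hθ : 0 < θ := lt_min hθ₁ hθ₂
  set W := weightMassE κ ν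
  have hW : W ≠ ⊤ := weightMassE_ne_top hκ hν
  set G := secondMoment
  have hG : G ≠ ⊤ := secondMoment_ne_top
  -- The constants form a chain: `C₀` is the entropy bound for the components, `Cu` the resulting
  -- bound for their sum, `C₁` and `C₂` those of the first and second `x`-derivatives through the
  -- kernel mass, and `C₃` that of the time derivative through the equation.
  set C₀ : ℝ≥0∞ := 4 * ENNReal.ofReal (1 / θ) * 2
  set Cu : ℝ≥0∞ := 2 * C₀
  set C₁ : ℝ≥0∞ := 2 * (1 + W ^ 2 * Cu)
  set C₂ : ℝ≥0∞ := 2 * (G ^ 2 + W ^ 2 * (2 * (C₁ + C₁)))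
  set C₃ : ℝ≥0∞ := 8 * (‖κ‖ₑ ^ 2 * 2 + ‖a‖ₑ ^ 2 + ‖ν‖ₑ ^ 2) * (Cu + C₀ + C₁ + C₂)
  have f0 : C₀ ≠ ⊤ := by finiteness
  have fu : Cu ≠ ⊤ := by finiteness
  have f1 : C₁ ≠ ⊤ := by finiteness
  have f2 : C₂ ≠ ⊤ := by finiteness
  have f3 : C₃ ≠ ⊤ := by finiteness
  refine ⟨C₀ + C₁ + C₂ + C₃, by finiteness, ?_⟩
  intro B₁ B₂ w₁ w₁' w₂ w₂' N t h₁ h₂ n1 n2 n1' n2' d1 d2 ht u u'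
  have hu : Continuous (Function.uncurry u) := continuous_density hκ hM h₁ h₂
  have hub : ∀ x t, |u x t| ≤ b := abs_density_le hκ hM h₁ h₂
  have hu' : Continuous (Function.uncurry u') := continuous_densityDx hκ hν hM h₁ h₂
  have hslope {k θ' m : ℝ} (hk : k ∈ Ioc 0 b) (h : θ' * k ≤ m) (hle : θ ≤ θ') : θ * k ≤ m :=
    (mul_le_mul_of_nonneg_right hle hk.1.le).trans h
  have bnd {c : ℝ} {M M' w w' : ℝ → ℝ} (hM : IsMaxwellianPair M M')
      (h : IsInitialProfile b B₁ B₂ w w') (t x : ℝ) : |kineticComponent κ ν c M w u x t| ≤ b := by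
    refine abs_kineticComponent_le hκ hM h hu hub (by linarith) ?_ ?_ x t
    · have := (abs_le.1 (hM.abs_le b)).2
      rwa [abs_of_nonneg hb] at this
    · have := (abs_le.1 (hM.abs_le (-b))).1
      rwa [abs_neg, abs_of_nonneg hb] at this
  have s0 (t : ℝ) : sqNorm (fun x => kineticComponent κ ν a M₁ w₁ u x t) +
      sqNorm (fun x => kineticComponent κ ν (-a) M₂ w₂ u x t) ≤ C₀ * N := by
    refine (sqNorm_kineticComponents_le hκ hM h₁ h₂ hθ
      (fun k hk => hslope hk (p1 k hk) (min_le_left _ _))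
      (fun k hk => hslope hk (p1' k hk) (min_le_left _ _))
      (fun k hk => hslope hk (p2 k hk) (min_le_right _ _))
      (fun k hk => hslope hk (p2' k hk) (min_le_right _ _)) t
      (bnd hM h₁ t) (bnd hM.symm h₂ t)).trans ?_
    calc _ ≤ 4 * ENNReal.ofReal (1 / θ) * (N + N) := by gcongr
      _ = C₀ * N := by simp only [C₀]; ring
  have s01 (t : ℝ) := le_self_add.trans (s0 t)
  have s02 (t : ℝ) := le_add_self.trans (s0 t)
  have su (t : ℝ) : sqNorm (fun x => u x t) ≤ Cu * N := by
    have e : (fun x => u x t) = fun x => kineticComponent κ ν a M₁ w₁ u x t +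
        kineticComponent κ ν (-a) M₂ w₂ u x t := funext fun x => density_eq hκ hM h₁ h₂ x t
    rw [e]
    refine (sqNorm_add_le
      (continuous_slice (continuous_kineticComponent hκ hM h₁ hu hub) t).measurable).trans ?_
    rw [mul_assoc]
    gcongr
    exact s0 t
  have sD {c : ℝ} {M M' w w' : ℝ → ℝ} (hM : IsMaxwellianPair M M')
      (h : IsInitialProfile b B₁ B₂ w w') (hN : sqNorm w' ≤ N) (t : ℝ) :
      sqNorm (fun x => kineticComponentDx κ ν c M w' u x t) ≤ C₁ * N := by
    refine (sqNorm_kineticComponentDx_le hκ hM h hu hN su t).trans (le_of_eq ?_)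
    simp only [C₁]; ring
  have su' (t : ℝ) : sqNorm (fun x => u' x t) ≤ 2 * (C₁ + C₁) * N := by
    refine (sqNorm_add_le
      (continuous_slice (continuous_kineticComponentDx hκ hν hM h₁ hu hub) t).measurable).trans ?_
    rw [mul_assoc, add_mul]
    gcongr
    · exact sD hM h₁ n1' t
    · exact sD hM.symm h₂ n2' t
  have sDD {c : ℝ} {M M' w w' : ℝ → ℝ} (hM : IsMaxwellianPair M M')
      (h : IsInitialProfile b B₁ B₂ w w')
      (hN : ∀ h, sqNorm (fun x => w' (x + h) - w' x) ≤ ‖h‖ₑ ^ 2 * N) :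
      sqNorm (fun x => kineticComponentDxx κ ν c M w' u u' x t) ≤ C₂ * N := by
    refine (sqNorm_kineticComponentDxx_le hκ hν hM h hu hu' hN su' ht).trans (le_of_eq ?_)
    simp only [C₂]; ring
  have sT {c : ℝ} {M M' w w' : ℝ → ℝ} (hM : IsMaxwellianPair M M')
      (h : IsInitialProfile b B₁ B₂ w w') (hc : ‖c‖ₑ = ‖a‖ₑ)
      (n0 : sqNorm (fun x => kineticComponent κ ν c M w u x t) ≤ C₀ * N) (n' : sqNorm w' ≤ N)
      (hN : ∀ h, sqNorm (fun x => w' (x + h) - w' x) ≤ ‖h‖ₑ ^ 2 * N) :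
      sqNorm (fun x => kineticComponentDt κ ν c M w w' u u' x t) ≤ C₃ * N := by
    have := sqNorm_kineticComponentDt_le (c := c) (u' := u') (N := (Cu + C₀ + C₁ + C₂) * N) (t := t)
      hκ hν hM h hu hub
      ((su t).trans (by gcongr; rw [add_assoc, add_assoc]; exact le_self_add))
      (n0.trans (by gcongr; exact le_add_self.trans (le_self_add.trans le_self_add)))
      ((sD hM h n' t).trans (by gcongr; exact le_add_self.trans le_self_add))
      ((sDD hM h hN).trans (by gcongr; exact le_add_self))
    rw [hc] at this
    simpa only [C₃, mul_assoc] using this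
  have l0 : C₀ * N ≤ (C₀ + C₁ + C₂ + C₃) * N := by
    gcongr; exact le_self_add.trans (le_self_add.trans le_self_add)
  have l1 : C₁ * N ≤ (C₀ + C₁ + C₂ + C₃) * N := by
    gcongr; exact le_add_self.trans (le_self_add.trans le_self_add)
  have l2 : C₂ * N ≤ (C₀ + C₁ + C₂ + C₃) * N := by
    gcongr; exact le_add_self.trans le_self_add
  have l3 : C₃ * N ≤ (C₀ + C₁ + C₂ + C₃) * N := by
    gcongr; exact le_add_self
  exact ⟨⟨(s01 t).trans l0, (s02 t).trans l0⟩, ⟨(sD hM h₁ n1' t).trans l1,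
    (sD hM.symm h₂ n2' t).trans l1⟩, ⟨(sDD hM h₁ d1).trans l2, (sDD hM.symm h₂ d2).trans l2⟩,
    ⟨(sT hM h₁ rfl (s01 t) n1' d1).trans l3,
      (sT hM.symm h₂ (enorm_neg a) (s02 t) n2' d2).trans l3⟩⟩

end

end ViscousPSystem

/-! ### Back to the viscous system: solution, bounds and uniqueness -/

namespace ViscousPSystem
open Filter Topology ProbabilityTheory

/-- The state with kinetic components `p` and `q`. -/
def toState (a p q : ℝ) : State := ![p + q, a * (q - p)]

/-- The left-going kinetic component of a state. -/
noncomputable def leftPart (a : ℝ) (s : State) : ℝ := (s 0 - s 1 / a) / 2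

/-- The right-going kinetic component of a state. -/
noncomputable def rightPart (a : ℝ) (s : State) : ℝ := (s 0 + s 1 / a) / 2

/-- The left-going local equilibrium. -/
noncomputable def leftMaxwellian (a : ℝ) (f : ℝ → ℝ) (u : ℝ) : ℝ := (u - f u / a) / 2

/-- The right-going local equilibrium. -/
noncomputable def rightMaxwellian (a : ℝ) (f : ℝ → ℝ) (u : ℝ) : ℝ := (u + f u / a) / 2

/-- The derivatives of the equilibria are `(1 ∓ f'/a)/2`; their positivity is the subcharacteristic
condition `-a < f' < a`. -/
lemma isMaxwellianPair {a : ℝ} (ha : 0 < a) {f : ℝ → ℝ} (hf : ContDiff ℝ 2 f) (hf0 : f 0 = 0)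
    (hsub : ∀ u : ℝ, -a < deriv f u ∧ deriv f u < a) :
    IsMaxwellianPair (leftMaxwellian a f) (rightMaxwellian a f) := by
  have hf1 : ContDiff ℝ 1 f := hf.of_le (by norm_num)
  have hd (u : ℝ) : HasDerivAt f (deriv f u) u :=
    (hf1.differentiable one_ne_zero u).hasDerivAt
  have hl (u : ℝ) : HasDerivAt (leftMaxwellian a f) ((1 - deriv f u / a) / 2) u :=
    ((hasDerivAt_id u).sub ((hd u).div_const a)).div_const 2
  have hr (u : ℝ) : HasDerivAt (rightMaxwellian a f) ((1 + deriv f u / a) / 2) u :=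
    ((hasDerivAt_id u).add ((hd u).div_const a)).div_const 2
  refine ⟨?_, ?_, fun u => ?_, fun u => ?_, fun u => ?_, ?_⟩
  · exact (contDiff_id.sub (hf1.div_const a)).div_const 2
  · exact (contDiff_id.add (hf1.div_const a)).div_const 2
  · rw [(hl u).deriv]
    have : deriv f u / a < 1 := (div_lt_one ha).2 (hsub u).2
    linarith
  · rw [(hr u).deriv]
    have : -1 < deriv f u / a := by rw [lt_div_iff₀ ha]; linarith [(hsub u).1]
    linarith
  · simp only [leftMaxwellian, rightMaxwellian]; ring
  · simp [leftMaxwellian, hf0]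

section toState

variable {a : ℝ}

lemma toState_parts (ha : a ≠ 0) (s : State) : toState a (leftPart a s) (rightPart a s) = s := by
  ext i
  fin_cases i
  · simp only [toState, leftPart, rightPart]; simp; ring
  · simp only [toState, leftPart, rightPart]; simp; field_simp; ring

lemma hasDerivAt_toState {p q : ℝ → ℝ} {p' q' x : ℝ} (hp : HasDerivAt p p' x)
    (hq : HasDerivAt q q' x) :
    HasDerivAt (fun x => toState a (p x) (q x)) (toState a p' q') x := by
  rw [hasDerivAt_pi]
  intro i
  fin_cases i
  · exact hp.add hq
  · exact (hq.sub hp).const_mul a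

lemma continuousOn_toState {X : Type*} [TopologicalSpace X] {p q : X → ℝ} {S : Set X}
    (hp : ContinuousOn p S) (hq : ContinuousOn q S) :
    ContinuousOn (fun x => toState a (p x) (q x)) S := by
  rw [continuousOn_pi]
  intro i
  fin_cases i
  · exact hp.add hq
  · exact continuousOn_const.mul (hq.sub hp)

lemma measurable_toState {X : Type*} [MeasurableSpace X] {p q : X → ℝ}
    (hp : Measurable p) (hq : Measurable q) : Measurable fun x => toState a (p x) (q x) := by
  rw [measurable_pi_iff]
  intro i
  fin_cases i
  · exact hp.add hq
  · exact (hq.sub hp).const_mul a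

lemma norm_toState_le (ha : 0 < a) (p q : ℝ) : ‖toState a p q‖ ≤ (1 + a) * (|p| + |q|) := by
  have h0 : 0 ≤ |p| + |q| := by positivity
  rw [pi_norm_le_iff_of_nonneg (by positivity)]
  intro i
  fin_cases i
  · refine (abs_add_le p q).trans ?_
    nlinarith
  · have : |a * (q - p)| ≤ a * (|p| + |q|) := by
      rw [abs_mul, abs_of_pos ha, add_comm]
      exact mul_le_mul_of_nonneg_left (abs_sub _ _) ha.le
    refine this.trans ?_
    nlinarith

lemma lintegral_toState_le (ha : 0 < a) {p q : ℝ → ℝ} (hm : Measurable p) {N : ℝ≥0∞}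
    (hp : sqNorm p ≤ N) (hq : sqNorm q ≤ N) :
    ∫⁻ x, ‖toState a (p x) (q x)‖ₑ ^ 2 ≤ (ENNReal.ofReal (1 + a) ^ 2 * 4) * N := by
  calc ∫⁻ x, ‖toState a (p x) (q x)‖ₑ ^ 2
      ≤ ∫⁻ x, ENNReal.ofReal (1 + a) ^ 2 * ‖|p x| + |q x|‖ₑ ^ 2 := by
        refine lintegral_mono fun x => ?_
        rw [← mul_pow, Real.enorm_of_nonneg (by positivity), ← ENNReal.ofReal_mul (by linarith),
          ← ofReal_norm]
        exact pow_le_pow_left' (ENNReal.ofReal_le_ofReal (norm_toState_le ha _ _)) 2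
    _ = ENNReal.ofReal (1 + a) ^ 2 * sqNorm fun x => |p x| + |q x| :=
        lintegral_const_mul' _ _ (by simp)
    _ ≤ ENNReal.ofReal (1 + a) ^ 2 * (2 * (N + N)) := by
        gcongr
        refine (sqNorm_add_le hm.abs).trans ?_
        gcongr
        · exact (sqNorm_mono fun x => (abs_abs _).le).trans hp
        · exact (sqNorm_mono fun x => (abs_abs _).le).trans hq
    _ = _ := by ring

lemma abs_leftPart_le (ha : 0 < a) (s : State) : |leftPart a s| ≤ (1 + 1 / a) * ‖s‖ := by
  have h0 : |s 0| ≤ ‖s‖ := norm_le_pi_norm s 0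
  have h1 : |s 1| ≤ ‖s‖ := norm_le_pi_norm s 1
  have h2 : |s 1 / a| ≤ 1 / a * ‖s‖ := by
    rw [abs_div, abs_of_pos ha, div_eq_inv_mul, one_div]; gcongr
  have h3 := abs_sub (s 0) (s 1 / a)
  rw [leftPart, abs_div, abs_two]
  have := norm_nonneg s
  have : 0 ≤ 1 / a * ‖s‖ := by positivity
  linarith

lemma abs_rightPart_le (ha : 0 < a) (s : State) : |rightPart a s| ≤ (1 + 1 / a) * ‖s‖ := by
  have h0 : |s 0| ≤ ‖s‖ := norm_le_pi_norm s 0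
  have h1 : |s 1| ≤ ‖s‖ := norm_le_pi_norm s 1
  have h2 : |s 1 / a| ≤ 1 / a * ‖s‖ := by
    rw [abs_div, abs_of_pos ha, div_eq_inv_mul, one_div]; gcongr
  have h3 := abs_add_le (s 0) (s 1 / a)
  rw [rightPart, abs_div, abs_two]
  have := norm_nonneg s
  have : 0 ≤ 1 / a * ‖s‖ := by positivity
  linarith

lemma leftPart_sub (s r : State) : leftPart a (s - r) = leftPart a s - leftPart a r := by
  simp only [leftPart, Pi.sub_apply]; ring

lemma rightPart_sub (s r : State) : rightPart a (s - r) = rightPart a s - rightPart a r := by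
  simp only [rightPart, Pi.sub_apply]; ring

lemma hasDerivAt_leftPart {g : ℝ → State} {g' : State} {x : ℝ} (h : HasDerivAt g g' x) :
    HasDerivAt (fun x => leftPart a (g x)) (leftPart a g') x :=
  (((hasDerivAt_pi.1 h) 0).sub (((hasDerivAt_pi.1 h) 1).div_const a)).div_const 2

lemma hasDerivAt_rightPart {g : ℝ → State} {g' : State} {x : ℝ} (h : HasDerivAt g g' x) :
    HasDerivAt (fun x => rightPart a (g x)) (rightPart a g') x :=
  (((hasDerivAt_pi.1 h) 0).add (((hasDerivAt_pi.1 h) 1).div_const a)).div_const 2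

lemma continuous_leftPart : Continuous (leftPart a) := by unfold leftPart; fun_prop

lemma continuous_rightPart : Continuous (rightPart a) := by unfold rightPart; fun_prop

lemma sqNorm_le_of_abs_le {p : ℝ → ℝ} {g : ℝ → State} {D : ℝ} (hD : 0 ≤ D) {N : ℝ≥0∞}
    (h : ∀ x, |p x| ≤ D * ‖g x‖) (hN : ∫⁻ x, ‖g x‖ₑ ^ 2 ≤ N) :
    sqNorm p ≤ ENNReal.ofReal D ^ 2 * N := by
  refine le_trans ?_ (mul_le_mul_right hN _)
  rw [← lintegral_const_mul' _ _ (by simp)]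
  refine lintegral_mono fun x => ?_
  rw [← mul_pow, Real.enorm_eq_ofReal_abs, ← ofReal_norm, ← ENNReal.ofReal_mul hD]
  exact pow_le_pow_left' (ENNReal.ofReal_le_ofReal (h x)) 2

end toState

/-- State-valued initial profiles whose kinetic components are of class `C^{1,1}`. -/
structure IsStateProfile (a b B₁ B₂ : ℝ) (g g' : ℝ → State) : Prop where
  left : IsInitialProfile b B₁ B₂ (fun x => leftPart a (g x)) fun x => leftPart a (g' x)
  right : IsInitialProfile b B₁ B₂ (fun x => rightPart a (g x)) fun x => rightPart a (g' x)

/-- The density of the kinetic model attached to the viscous system. -/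
noncomputable def viscousDensity (a ε ν : ℝ) (f : ℝ → ℝ) (g : ℝ → State) : ℝ → ℝ → ℝ :=
  density (1 / ε) ν a (leftMaxwellian a f) (rightMaxwellian a f)
    (fun x => leftPart a (g x)) fun x => rightPart a (g x)

/-- The `x`-derivative of `viscousDensity`. -/
noncomputable def viscousDensityDx (a ε ν : ℝ) (f : ℝ → ℝ) (g g' : ℝ → State) : ℝ → ℝ → ℝ :=
  densityDx (1 / ε) ν a (leftMaxwellian a f) (rightMaxwellian a f)
    (fun x => leftPart a (g x)) (fun x => rightPart a (g x))
    (fun x => leftPart a (g' x)) fun x => rightPart a (g' x)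

/-- The solution of the viscous system with initial profile `g`. -/
noncomputable def viscousSolution (a ε ν : ℝ) (f : ℝ → ℝ) (g : ℝ → State) (x t : ℝ) : State :=
  toState a
    (kineticComponent (1 / ε) ν a (leftMaxwellian a f) (fun x => leftPart a (g x))
      (viscousDensity a ε ν f g) x t)
    (kineticComponent (1 / ε) ν (-a) (rightMaxwellian a f) (fun x => rightPart a (g x))
      (viscousDensity a ε ν f g) x t)

/-- The `x`-derivative of `viscousSolution`. -/
noncomputable def viscousSolutionDx (a ε ν : ℝ) (f : ℝ → ℝ) (g g' : ℝ → State) (x t : ℝ) : State :=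
  toState a
    (kineticComponentDx (1 / ε) ν a (leftMaxwellian a f) (fun x => leftPart a (g' x))
      (viscousDensity a ε ν f g) x t)
    (kineticComponentDx (1 / ε) ν (-a) (rightMaxwellian a f) (fun x => rightPart a (g' x))
      (viscousDensity a ε ν f g) x t)

/-- The second `x`-derivative of `viscousSolution`. -/
noncomputable def viscousSolutionDxx (a ε ν : ℝ) (f : ℝ → ℝ) (g g' : ℝ → State) (x t : ℝ) : State :=
  toState a
    (kineticComponentDxx (1 / ε) ν a (leftMaxwellian a f) (fun x => leftPart a (g' x))
      (viscousDensity a ε ν f g) (viscousDensityDx a ε ν f g g') x t)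
    (kineticComponentDxx (1 / ε) ν (-a) (rightMaxwellian a f) (fun x => rightPart a (g' x))
      (viscousDensity a ε ν f g) (viscousDensityDx a ε ν f g g') x t)

/-- The `t`-derivative of `viscousSolution`. -/
noncomputable def viscousSolutionDt (a ε ν : ℝ) (f : ℝ → ℝ) (g g' : ℝ → State) (x t : ℝ) : State :=
  toState a
    (kineticComponentDt (1 / ε) ν a (leftMaxwellian a f) (fun x => leftPart a (g x))
      (fun x => leftPart a (g' x)) (viscousDensity a ε ν f g) (viscousDensityDx a ε ν f g g') x t)
    (kineticComponentDt (1 / ε) ν (-a) (rightMaxwellian a f) (fun x => rightPart a (g x))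
      (fun x => rightPart a (g' x)) (viscousDensity a ε ν f g) (viscousDensityDx a ε ν f g g') x t)

section viscousSolution

variable {a b B₁ B₂ ε ν : ℝ} {f : ℝ → ℝ} {g g' : ℝ → State}

lemma viscousSolution_zero (ha : 0 < a) (x : ℝ) : viscousSolution a ε ν f g x 0 = g x := by
  simp [viscousSolution, kineticComponent, driftHeat_zero, duhamel_of_nonpos, toState_parts ha.ne']

lemma continuous_viscousDensity (hε : 0 < ε)
    (hM : IsMaxwellianPair (leftMaxwellian a f) (rightMaxwellian a f))
    (h : IsStateProfile a b B₁ B₂ g g') :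
    Continuous (Function.uncurry (viscousDensity a ε ν f g)) :=
  continuous_density (by positivity) hM h.left h.right

lemma abs_viscousDensity_le (hε : 0 < ε)
    (hM : IsMaxwellianPair (leftMaxwellian a f) (rightMaxwellian a f))
    (h : IsStateProfile a b B₁ B₂ g g') (x t : ℝ) : |viscousDensity a ε ν f g x t| ≤ b :=
  abs_density_le (by positivity) hM h.left h.right x t

lemma hasDerivAt_viscousDensity (hε : 0 < ε) (hν : 0 < ν)
    (hM : IsMaxwellianPair (leftMaxwellian a f) (rightMaxwellian a f))
    (h : IsStateProfile a b B₁ B₂ g g') (x t : ℝ) :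
    HasDerivAt (fun x => viscousDensity a ε ν f g x t) (viscousDensityDx a ε ν f g g' x t) x :=
  hasDerivAt_density (by positivity) hν hM h.left h.right x t

lemma continuous_viscousDensityDx (hε : 0 < ε) (hν : 0 < ν)
    (hM : IsMaxwellianPair (leftMaxwellian a f) (rightMaxwellian a f))
    (h : IsStateProfile a b B₁ B₂ g g') :
    Continuous (Function.uncurry (viscousDensityDx a ε ν f g g')) :=
  continuous_densityDx (by positivity) hν hM h.left h.right

lemma abs_viscousDensityDx_le (hε : 0 < ε) (hν : 0 < ν)
    (hM : IsMaxwellianPair (leftMaxwellian a f) (rightMaxwellian a f))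
    (h : IsStateProfile a b B₁ B₂ g g') (x t : ℝ) :
    |viscousDensityDx a ε ν f g g' x t| ≤ 2 * (B₁ + weightMass (1 / ε) ν * b) :=
  abs_densityDx_le (by positivity) hν hM h.left h.right x t

lemma hasDerivAt_viscousSolution (hε : 0 < ε) (hν : 0 < ν)
    (hM : IsMaxwellianPair (leftMaxwellian a f) (rightMaxwellian a f))
    (h : IsStateProfile a b B₁ B₂ g g') (x t : ℝ) :
    HasDerivAt (fun x => viscousSolution a ε ν f g x t) (viscousSolutionDx a ε ν f g g' x t) x :=
  hasDerivAt_toState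
    (hasDerivAt_kineticComponent (by positivity) hν hM h.left (continuous_viscousDensity hε hM h)
      (abs_viscousDensity_le hε hM h) x t)
    (hasDerivAt_kineticComponent (by positivity) hν hM.symm h.right
      (continuous_viscousDensity hε hM h) (abs_viscousDensity_le hε hM h) x t)

lemma hasDerivAt_viscousSolutionDx (hε : 0 < ε) (hν : 0 < ν)
    (hM : IsMaxwellianPair (leftMaxwellian a f) (rightMaxwellian a f))
    (h : IsStateProfile a b B₁ B₂ g g') (x : ℝ) {t : ℝ} (ht : 0 < t) :
    HasDerivAt (fun x => viscousSolutionDx a ε ν f g g' x t)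
      (viscousSolutionDxx a ε ν f g g' x t) x :=
  hasDerivAt_toState
    (hasDerivAt_kineticComponentDx (by positivity) hν hM h.left (continuous_viscousDensity hε hM h)
      (abs_viscousDensity_le hε hM h) (hasDerivAt_viscousDensity hε hν hM h)
      (continuous_viscousDensityDx hε hν hM h) (abs_viscousDensityDx_le hε hν hM h) x ht)
    (hasDerivAt_kineticComponentDx (by positivity) hν hM.symm h.right
      (continuous_viscousDensity hε hM h)
      (abs_viscousDensity_le hε hM h) (hasDerivAt_viscousDensity hε hν hM h)
      (continuous_viscousDensityDx hε hν hM h) (abs_viscousDensityDx_le hε hν hM h) x ht)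

lemma hasDerivAt_viscousSolution_time (hε : 0 < ε) (hν : 0 < ν)
    (hM : IsMaxwellianPair (leftMaxwellian a f) (rightMaxwellian a f))
    (h : IsStateProfile a b B₁ B₂ g g') (x : ℝ) {t : ℝ} (ht : 0 < t) :
    HasDerivAt (fun t => viscousSolution a ε ν f g x t) (viscousSolutionDt a ε ν f g g' x t) t :=
  hasDerivAt_toState
    (hasDerivAt_kineticComponent_time (by positivity) hν hM h.left
      (continuous_viscousDensity hε hM h)
      (abs_viscousDensity_le hε hM h) (hasDerivAt_viscousDensity hε hν hM h)
      (continuous_viscousDensityDx hε hν hM h) (abs_viscousDensityDx_le hε hν hM h) x ht)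
    (hasDerivAt_kineticComponent_time (by positivity) hν hM.symm h.right
      (continuous_viscousDensity hε hM h)
      (abs_viscousDensity_le hε hM h) (hasDerivAt_viscousDensity hε hν hM h)
      (continuous_viscousDensityDx hε hν hM h) (abs_viscousDensityDx_le hε hν hM h) x ht)

lemma dx_viscousSolution (hε : 0 < ε) (hν : 0 < ν)
    (hM : IsMaxwellianPair (leftMaxwellian a f) (rightMaxwellian a f))
    (h : IsStateProfile a b B₁ B₂ g g') :
    dx (viscousSolution a ε ν f g) = viscousSolutionDx a ε ν f g g' := by
  ext1 x; ext1 t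
  exact (hasDerivAt_viscousSolution hε hν hM h x t).deriv

lemma dxx_viscousSolution (hε : 0 < ε) (hν : 0 < ν)
    (hM : IsMaxwellianPair (leftMaxwellian a f) (rightMaxwellian a f))
    (h : IsStateProfile a b B₁ B₂ g g') (x : ℝ) {t : ℝ} (ht : 0 < t) :
    dxx (viscousSolution a ε ν f g) x t = viscousSolutionDxx a ε ν f g g' x t := by
  rw [dxx, dx_viscousSolution hε hν hM h]
  exact (hasDerivAt_viscousSolutionDx hε hν hM h x ht).deriv

lemma dt_viscousSolution (hε : 0 < ε) (hν : 0 < ν)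
    (hM : IsMaxwellianPair (leftMaxwellian a f) (rightMaxwellian a f))
    (h : IsStateProfile a b B₁ B₂ g g') (x : ℝ) {t : ℝ} (ht : 0 < t) :
    dt (viscousSolution a ε ν f g) x t = viscousSolutionDt a ε ν f g g' x t :=
  (hasDerivAt_viscousSolution_time hε hν hM h x ht).deriv

lemma continuous_viscousSolution (hε : 0 < ε)
    (hM : IsMaxwellianPair (leftMaxwellian a f) (rightMaxwellian a f))
    (h : IsStateProfile a b B₁ B₂ g g') :
    Continuous fun p : ℝ × ℝ => viscousSolution a ε ν f g p.1 p.2 := by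
  rw [← continuousOn_univ]
  exact continuousOn_toState (continuous_kineticComponent (by positivity) hM h.left
    (continuous_viscousDensity hε hM h) (abs_viscousDensity_le hε hM h)).continuousOn
    (continuous_kineticComponent (by positivity) hM.symm h.right
    (continuous_viscousDensity hε hM h) (abs_viscousDensity_le hε hM h)).continuousOn

/-- `viscousSolution` is a classical solution. -/
theorem isClassicalSolution_viscousSolution (ha : 0 < a) (hε : 0 < ε) (hν : 0 < ν)
    (hM : IsMaxwellianPair (leftMaxwellian a f) (rightMaxwellian a f))
    (h : IsStateProfile a b B₁ B₂ g g') {u₀ : ℝ → State} (hg : ∀ᵐ x, g x = u₀ x) :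
    IsClassicalSolution a ε ν f u₀ (viscousSolution a ε ν f g) := by
  have hκ : 0 < 1 / ε := by positivity
  have hu := continuous_viscousDensity (ν := ν) hε hM h
  have hub := abs_viscousDensity_le (ν := ν) hε hM h
  have hu' := continuous_viscousDensityDx hε hν hM h
  have hub' := abs_viscousDensityDx_le hε hν hM h
  have k1 := continuous_kineticComponent (ν := ν) (c := a) hκ hM h.left hu hub
  have k2 := continuous_kineticComponent (ν := ν) (c := -a) hκ hM.symm h.right hu hub
  have d1 := continuous_kineticComponentDx (c := a) hκ hν hM h.left hu hub
  have d2 := continuous_kineticComponentDx (c := -a) hκ hν hM.symm h.right hu hub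
  have e1 := continuousOn_kineticComponentDxx (c := a) hκ hν hM h.left hu hu' hub'
  have e2 := continuousOn_kineticComponentDxx (c := -a) hκ hν hM.symm h.right hu hu' hub'
  have hsum (x t : ℝ) : viscousDensity a ε ν f g x t =
      kineticComponent (1 / ε) ν a (leftMaxwellian a f) (fun x => leftPart a (g x))
        (viscousDensity a ε ν f g) x t +
      kineticComponent (1 / ε) ν (-a) (rightMaxwellian a f) (fun x => rightPart a (g x))
        (viscousDensity a ε ν f g) x t := density_eq hκ hM h.left h.right x t
  have hdt : ContinuousOn (fun p : ℝ × ℝ => viscousSolutionDt a ε ν f g g' p.1 p.2)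
      {p | 0 < p.2} := by
    refine continuousOn_toState ?_ ?_
    · exact ((continuousOn_const.mul ((continuous_comp_uncurry hM.continuous hu).continuousOn.sub
        k1.continuousOn)).add (continuousOn_const.mul d1.continuousOn)).add
        (continuousOn_const.mul e1)
    · exact ((continuousOn_const.mul ((continuous_comp_uncurry hM.symm.continuous hu).continuousOn.sub
        k2.continuousOn)).add (continuousOn_const.mul d2.continuousOn)).add
        (continuousOn_const.mul e2)
  refine ⟨(continuous_viscousSolution hε hM h).continuousOn, ?_, ?_, ?_, ?_, ?_, ?_, ?_, ?_, ?_⟩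
  · exact fun x t ht => (hasDerivAt_viscousSolution_time hε hν hM h x ht).differentiableAt
  · exact fun x t ht => (hasDerivAt_viscousSolution hε hν hM h x t).differentiableAt
  · rw [dx_viscousSolution hε hν hM h]
    exact fun x t ht => (hasDerivAt_viscousSolutionDx hε hν hM h x ht).differentiableAt
  · exact hdt.congr fun p hp => dt_viscousSolution hε hν hM h p.1 hp
  · rw [dx_viscousSolution hε hν hM h]
    exact continuousOn_toState d1.continuousOn d2.continuousOn
  · exact (continuousOn_toState e1 e2).congr fun p hp => dxx_viscousSolution hε hν hM h p.1 hp
  · intro x t ht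
    rw [dt_viscousSolution hε hν hM h x ht, dxx_viscousSolution hε hν hM h x ht,
      dx_viscousSolution hε hν hM h]
    simp only [viscousSolutionDt, viscousSolutionDx, viscousSolutionDxx, toState,
      kineticComponentDt, Matrix.cons_val_zero, Matrix.cons_val_one]
    have := hM.add (viscousDensity a ε ν f g x t)
    have := hsum x t
    -- In the sum of the kinetic equations the relaxation terms cancel, since the equilibria and the
    -- components both sum to the density.
    linear_combination (1 / ε) * hM.add (viscousDensity a ε ν f g x t) + (1 / ε) * hsum x t
  · intro x t ht
    rw [dt_viscousSolution hε hν hM h x ht, dxx_viscousSolution hε hν hM h x ht,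
      dx_viscousSolution hε hν hM h]
    simp only [viscousSolutionDt, viscousSolutionDx, viscousSolutionDxx, viscousSolution, toState,
      kineticComponentDt, Matrix.cons_val_zero, Matrix.cons_val_one]
    -- In `a` times the difference of the kinetic equations, the relaxation is towards `a (M₂ - M₁)
    -- = f`.
    have e : a * (rightMaxwellian a f (viscousDensity a ε ν f g x t) -
        leftMaxwellian a f (viscousDensity a ε ν f g x t)) = f (viscousDensity a ε ν f g x t) := by
      simp only [rightMaxwellian, leftMaxwellian]
      field_simp
      ring
    rw [← hsum x t]
    linear_combination (1 / ε) * e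
  · filter_upwards [hg] with x hx
    rw [viscousSolution_zero ha, hx]

/-- Sup bounds for `viscousSolution` and its derivatives, uniform in time. -/
theorem exists_norm_bound (ha : 0 < a) (hε : 0 < ε) (hν : 0 < ν)
    (hM : IsMaxwellianPair (leftMaxwellian a f) (rightMaxwellian a f)) (b B₁ B₂ : ℝ) :
    ∃ K : ℝ, ∀ g g' : ℝ → State, IsStateProfile a b B₁ B₂ g g' → ∀ x t : ℝ, 0 < t →
      ‖viscousSolution a ε ν f g x t‖ ≤ K ∧ ‖viscousSolutionDt a ε ν f g g' x t‖ ≤ K ∧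
        ‖viscousSolutionDx a ε ν f g g' x t‖ ≤ K ∧ ‖viscousSolutionDxx a ε ν f g g' x t‖ ≤ K := by
  have hκ : 0 < 1 / ε := by positivity
  -- `D₁` and `D₂` bound the first and second `x`-derivatives of a component. The density has two
  -- components, whence `2 * D₁` inside `D₂`; `D₃` reads off the time derivative from the equation.
  set D₁ := B₁ + weightMass (1 / ε) ν * b
  set D₂ := B₂ * (∫ z, z ^ 2 ∂stdGaussian) + weightMass (1 / ε) ν * (2 * D₁)
  set D₃ := (1 / ε) * (b + b) + a * D₁ + ν * D₂
  set K := max (max b D₁) (max D₂ D₃)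
  refine ⟨(1 + a) * (K + K), fun g g' h x t ht => ?_⟩
  have hb : 0 ≤ b := by linarith [(abs_nonneg _).trans (h.left.bound 0)]
  have hu := continuous_viscousDensity (ν := ν) hε hM h
  have hub := abs_viscousDensity_le (ν := ν) hε hM h
  have hub' := abs_viscousDensityDx_le hε hν hM h
  have q0 {c : ℝ} {M M' w w' : ℝ → ℝ} (hM : IsMaxwellianPair M M')
      (h : IsInitialProfile b B₁ B₂ w w') :
      |kineticComponent (1 / ε) ν c M w (viscousDensity a ε ν f g) x t| ≤ b := by
    refine abs_kineticComponent_le hκ hM h hu hub (by linarith) ?_ ?_ x t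
    · have := (abs_le.1 (hM.abs_le b)).2
      rwa [abs_of_nonneg hb] at this
    · have := (abs_le.1 (hM.abs_le (-b))).1
      rwa [abs_neg, abs_of_nonneg hb] at this
  have q1 {c : ℝ} {M M' w w' : ℝ → ℝ} (hM : IsMaxwellianPair M M')
      (h : IsInitialProfile b B₁ B₂ w w') :
      |kineticComponentDx (1 / ε) ν c M w' (viscousDensity a ε ν f g) x t| ≤ D₁ :=
    abs_kineticComponentDx_le hκ hν hM h hub x t
  have q2 {c : ℝ} {M M' w w' : ℝ → ℝ} (hM : IsMaxwellianPair M M')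
      (h : IsInitialProfile b B₁ B₂ w w') :
      |kineticComponentDxx (1 / ε) ν c M w' (viscousDensity a ε ν f g)
        (viscousDensityDx a ε ν f g g') x t| ≤ D₂ :=
    abs_kineticComponentDxx_le hκ hν hM h hub' x ht
  have q3 {c : ℝ} {M M' w w' : ℝ → ℝ} (hM : IsMaxwellianPair M M')
      (h : IsInitialProfile b B₁ B₂ w w') (hc : |c| = a) :
      |kineticComponentDt (1 / ε) ν c M w w' (viscousDensity a ε ν f g)
        (viscousDensityDx a ε ν f g g') x t| ≤ D₃ := by
    unfold kineticComponentDt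
    refine (abs_add_three _ _ _).trans ?_
    rw [abs_mul, abs_mul, abs_mul, hc, abs_of_pos hκ, abs_of_pos hν]
    have := (abs_sub (M (viscousDensity a ε ν f g x t)) (kineticComponent (1 / ε) ν c M w
      (viscousDensity a ε ν f g) x t)).trans (add_le_add (hM.bound hub x t) (q0 hM h))
    have := q1 (c := c) hM h
    have := q2 (c := c) hM h
    simp only [D₃]
    gcongr
  have l0 : b ≤ K := (le_max_left _ _).trans (le_max_left _ _)
  have l1 : D₁ ≤ K := (le_max_right _ _).trans (le_max_left _ _)
  have l2 : D₂ ≤ K := (le_max_left _ _).trans (le_max_right _ _)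
  have l3 : D₃ ≤ K := (le_max_right _ _).trans (le_max_right _ _)
  have fin {p q : ℝ} (hp : |p| ≤ K) (hq : |q| ≤ K) : ‖toState a p q‖ ≤ (1 + a) * (K + K) :=
    (norm_toState_le ha p q).trans (by gcongr)
  have hM' := hM.symm
  have ha' : |a| = a := abs_of_pos ha
  exact ⟨fin ((q0 hM h.left).trans l0) ((q0 hM' h.right).trans l0),
    fin ((q3 hM h.left ha').trans l3) ((q3 hM' h.right (by rw [abs_neg, ha'])).trans l3),
    fin ((q1 hM h.left).trans l1) ((q1 hM' h.right).trans l1),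
    fin ((q2 hM h.left).trans l2) ((q2 hM' h.right).trans l2)⟩

/-- `L²` bounds for `viscousSolution` and its derivatives, uniform in time. -/
theorem exists_lintegral_bound (ha : 0 < a) (hε : 0 < ε) (hν : 0 < ν)
    (hM : IsMaxwellianPair (leftMaxwellian a f) (rightMaxwellian a f)) {b : ℝ} (hb : 0 ≤ b) :
    ∃ C : ℝ≥0∞, C ≠ ⊤ ∧ ∀ (B₁ B₂ : ℝ) (g g' : ℝ → State) (N : ℝ≥0∞),
      IsStateProfile a b B₁ B₂ g g' → ∫⁻ x, ‖g x‖ₑ ^ 2 ≤ N → ∫⁻ x, ‖g' x‖ₑ ^ 2 ≤ N →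
      (∀ h, ∫⁻ x, ‖g' (x + h) - g' x‖ₑ ^ 2 ≤ ‖h‖ₑ ^ 2 * N) → ∀ t : ℝ, 0 < t →
      ∫⁻ x, ‖viscousSolution a ε ν f g x t‖ₑ ^ 2 ≤ C * N ∧
        ∫⁻ x, ‖viscousSolutionDt a ε ν f g g' x t‖ₑ ^ 2 ≤ C * N ∧
        ∫⁻ x, ‖viscousSolutionDx a ε ν f g g' x t‖ₑ ^ 2 ≤ C * N ∧
        ∫⁻ x, ‖viscousSolutionDxx a ε ν f g g' x t‖ₑ ^ 2 ≤ C * N := by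
  have hκ : 0 < 1 / ε := by positivity
  obtain ⟨C, hC, H⟩ := exists_sqNorm_bound hκ hν hM hb a
  set D : ℝ := 1 + 1 / a
  have hD : 0 ≤ D := by positivity
  refine ⟨ENNReal.ofReal (1 + a) ^ 2 * 4 * (C * ENNReal.ofReal D ^ 2), by finiteness, ?_⟩
  intro B₁ B₂ g g' N h n0 n1 n2 t ht
  have n3 (P : State → ℝ) (hP : ∀ s, |P s| ≤ D * ‖s‖) (hsub : ∀ s r, P (s - r) = P s - P r) (r : ℝ) :
      sqNorm (fun x => P (g' (x + r)) - P (g' x)) ≤ ‖r‖ₑ ^ 2 * (ENNReal.ofReal D ^ 2 * N) := by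
    have := sqNorm_le_of_abs_le (g := fun x => g' (x + r) - g' x) hD (fun x => hP _) (n2 r)
    simp only [hsub] at this
    rwa [mul_left_comm] at this
  obtain ⟨⟨a1, a2⟩, ⟨b1, b2⟩, ⟨c1, c2⟩, ⟨d1, d2⟩⟩ := H B₁ B₂ _ _ _ _ (ENNReal.ofReal D ^ 2 * N) t
    h.left h.right
    (sqNorm_le_of_abs_le hD (fun x => abs_leftPart_le ha _) n0)
    (sqNorm_le_of_abs_le hD (fun x => abs_rightPart_le ha _) n0)
    (sqNorm_le_of_abs_le hD (fun x => abs_leftPart_le ha _) n1)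
    (sqNorm_le_of_abs_le hD (fun x => abs_rightPart_le ha _) n1)
    (n3 _ (abs_leftPart_le ha) leftPart_sub) (n3 _ (abs_rightPart_le ha) rightPart_sub) ht
  have hu := continuous_viscousDensity (ν := ν) hε hM h
  have hub := abs_viscousDensity_le (ν := ν) hε hM h
  have hu' := continuous_viscousDensityDx hε hν hM h
  have hub' := abs_viscousDensityDx_le hε hν hM h
  have m0 := (continuous_slice (continuous_kineticComponent (ν := ν) (c := a) hκ hM h.left hu hub)
    t).measurable
  have m1 := (continuous_slice (continuous_kineticComponentDx (c := a) hκ hν hM h.left hu hub)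
    t).measurable
  have m2 : Measurable fun x => kineticComponentDxx (1 / ε) ν a (leftMaxwellian a f)
      (fun x => leftPart a (g' x)) (viscousDensity a ε ν f g) (viscousDensityDx a ε ν f g g') x t :=
    (ContinuousOn.comp_continuous
      (continuousOn_kineticComponentDxx (c := a) hκ hν hM h.left hu hu' hub')
      (by fun_prop : Continuous fun x : ℝ => (x, t)) fun x => ht).measurable
  have mM := (continuous_slice (continuous_comp_uncurry hM.continuous hu) t).measurable
  have m3 : Measurable fun x => kineticComponentDt (1 / ε) ν a (leftMaxwellian a f)
      (fun x => leftPart a (g x)) (fun x => leftPart a (g' x)) (viscousDensity a ε ν f g)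
      (viscousDensityDx a ε ν f g g') x t :=
    (((mM.sub m0).const_mul _).add (m1.const_mul _)).add (m2.const_mul _)
  have fin {p q : ℝ → ℝ} (hm : Measurable p) (hp : sqNorm p ≤ C * (ENNReal.ofReal D ^ 2 * N))
      (hq : sqNorm q ≤ C * (ENNReal.ofReal D ^ 2 * N)) :
      ∫⁻ x, ‖toState a (p x) (q x)‖ₑ ^ 2 ≤
        ENNReal.ofReal (1 + a) ^ 2 * 4 * (C * ENNReal.ofReal D ^ 2) * N := by
    refine (lintegral_toState_le ha hm hp hq).trans (le_of_eq ?_)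
    ring
  exact ⟨fin m0 a1 a2, fin m3 d1 d2, fin m1 b1 b2, fin m2 c1 c2⟩

end viscousSolution

/-- Bounded classical solutions are determined by their initial data. -/
theorem IsClassicalSolution.eq_of_bounded {a ε ν K : ℝ} {f : ℝ → ℝ} {u₀ : ℝ → State}
    {u v : ℝ → ℝ → State} (ha : 0 < a) (hε : 0 < ε) (hν : 0 < ν)
    (hf : ∀ x y, |f x - f y| ≤ a * |x - y|)
    (hu : IsClassicalSolution a ε ν f u₀ u) (hv : IsClassicalSolution a ε ν f u₀ v)
    (huK : ∀ x t, 0 ≤ t → ‖u x t‖ ≤ K) (hvK : ∀ x t, 0 ≤ t → ‖v x t‖ ≤ K)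
    (x t : ℝ) (ht : 0 ≤ t) : u x t = v x t := by
  set P : Fin 2 → State → ℝ := ![leftPart a, rightPart a]
  have hP (i : Fin 2) : Continuous (P i) := by
    fin_cases i
    · exact continuous_leftPart
    · exact continuous_rightPart
  have hPsub (i : Fin 2) (s r : State) : P i (s - r) = P i s - P i r := by
    fin_cases i
    · exact leftPart_sub s r
    · exact rightPart_sub s r
  have hPle (i : Fin 2) (s : State) : |P i s| ≤ (1 + 1 / a) * ‖s‖ := by
    fin_cases i
    · exact abs_leftPart_le ha s
    · exact abs_rightPart_le ha s
  have hPd (i : Fin 2) {g : ℝ → State} {g' : State} {x : ℝ} (h : HasDerivAt g g' x) :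
      HasDerivAt (fun x => P i (g x)) (P i g') x := by
    fin_cases i
    · exact hasDerivAt_leftPart h
    · exact hasDerivAt_rightPart h
  -- The data are prescribed only almost everywhere; continuity at `t = 0` makes the two traces
  -- agree at every point.
  have hzero (x : ℝ) : u x 0 = v x 0 := by
    have hcu : Continuous fun x => u x 0 := hu.continuousOn.comp_continuous
      (by fun_prop : Continuous fun x : ℝ => (x, (0 : ℝ))) fun x => le_refl (0 : ℝ)
    have hcv : Continuous fun x => v x 0 := hv.continuousOn.comp_continuous
      (by fun_prop : Continuous fun x : ℝ => (x, (0 : ℝ))) fun x => le_refl (0 : ℝ)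
    have : (fun x => u x 0) =ᵐ[volume] fun x => v x 0 := by
      filter_upwards [hu.initial, hv.initial] with x h1 h2
      rw [h1, h2]
    exact congrFun (Continuous.ae_eq_iff_eq volume hcu hcv |>.1 this) x
  have key := eq_zero_of_parabolic_system (ν := ν) (L := 2 * (1 / ε)) (B := (1 + 1 / a) * (K + K))
    hν.le (by positivity) (c := ![a, -a])
    (W := fun i x t => P i (u x t - v x t)) (Wt := fun i x t => P i (dt u x t - dt v x t))
    (Wx := fun i x t => P i (dx u x t - dx v x t))
    (Wxx := fun i x t => P i (dxx u x t - dxx v x t))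
    (fun i => (hP i).comp_continuousOn (hu.continuousOn.sub hv.continuousOn))
    (fun i x t h => (hPle i _).trans (by
      gcongr
      exact (norm_sub_le _ _).trans (add_le_add (huK x t h) (hvK x t h))))
    (fun i x t h => hPd i ((hu.differentiable_t x t h).hasDerivAt.sub
      (hv.differentiable_t x t h).hasDerivAt))
    (fun i x t h => hPd i ((hu.differentiable_x x t h).hasDerivAt.sub
      (hv.differentiable_x x t h).hasDerivAt))
    (fun i x t h => hPd i ((hu.differentiable_xx x t h).hasDerivAt.sub
      (hv.differentiable_xx x t h).hasDerivAt))
    (fun i x => by rw [hzero x, sub_self]; simpa using hPsub i (u x 0) (u x 0))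
    (fun i x t h m hm => by
      have m0 : |leftPart a (u x t - v x t)| ≤ m := hm 0
      have m1 : |rightPart a (u x t - v x t)| ≤ m := hm 1
      set d := u x t - v x t with hd
      have d0 : u x t 0 - v x t 0 = leftPart a d + rightPart a d := by
        simp only [hd, leftPart, rightPart, Pi.sub_apply]; ring
      have d1 : u x t 1 - v x t 1 = a * (rightPart a d - leftPart a d) := by
        simp only [hd, leftPart, rightPart, Pi.sub_apply]; field_simp; ring
      have f1 : |f (u x t 0) - f (v x t 0)| ≤ a * (2 * m) := by
        refine (hf _ _).trans ?_
        rw [d0]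
        gcongr
        exact (abs_add_le _ _).trans (by linarith)
      have f2 : |u x t 1 - v x t 1| ≤ a * (2 * m) := by
        rw [d1, abs_mul, abs_of_pos ha]
        gcongr
        exact (abs_sub _ _).trans (by linarith)
      -- The whole coupling of the difference is `r` in one kinetic equation and `-r` in the other.
      -- If both components are at most `m`, the differences of `v` and of `f(u)` are each at most
      -- `2am`, giving `|r| ≤ 2m/ε`, the value chosen for `L`.
      set r := (1 / ε) / (2 * a) * ((u x t 1 - v x t 1) - (f (u x t 0) - f (v x t 0))) with hr
      have hrle : |r| ≤ 2 * (1 / ε) * m := by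
        rw [hr, abs_mul, abs_of_pos (by positivity : 0 < (1 / ε) / (2 * a))]
        calc _ ≤ (1 / ε) / (2 * a) * (a * (2 * m) + a * (2 * m)) := by
              gcongr; exact (abs_sub _ _).trans (add_le_add f2 f1)
          _ = _ := by field_simp; ring
      have u1 := hu.eq_fst x t h
      have u2 := hu.eq_snd x t h
      have v1 := hv.eq_fst x t h
      have v2 := hv.eq_snd x t h
      have hpos : a ≠ 0 := ha.ne'
      fin_cases i
      · refine le_of_eq_of_le (congrArg _ ?_) hrle
        change leftPart a (dt u x t - dt v x t) - (a * leftPart a (dx u x t - dx v x t) +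
          ν * leftPart a (dxx u x t - dxx v x t)) = r
        simp only [hr, leftPart, Pi.sub_apply]
        rw [← eq_sub_iff_add_eq] at u1 v1
        rw [add_assoc, ← eq_sub_iff_add_eq] at u2 v2
        rw [u1, u2, v1, v2]
        field_simp
        ring
      · refine le_of_eq_of_le (congrArg _ ?_) ((abs_neg r).le.trans hrle)
        change rightPart a (dt u x t - dt v x t) - (-a * rightPart a (dx u x t - dx v x t) +
          ν * rightPart a (dxx u x t - dxx v x t)) = -r
        simp only [hr, rightPart, Pi.sub_apply]
        rw [← eq_sub_iff_add_eq] at u1 v1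
        rw [add_assoc, ← eq_sub_iff_add_eq] at u2 v2
        rw [u1, u2, v1, v2]
        field_simp
        ring)
  have k0 := key 0 x t ht
  have k1 := key 1 x t ht
  have : toState a (leftPart a (u x t - v x t)) (rightPart a (u x t - v x t)) = 0 := by
    change leftPart a (u x t - v x t) = 0 at k0
    change rightPart a (u x t - v x t) = 0 at k1
    rw [k0, k1]
    ext i; fin_cases i <;> simp [toState]
  rw [toState_parts ha.ne'] at this
  exact sub_eq_zero.1 this

end ViscousPSystem

/-! ### Weak derivatives and `C^{1,1}` representatives -/

namespace ViscousPSystem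
open Filter Topology ProbabilityTheory

/-- A smooth compactly supported function of mean zero is the derivative of another one. -/
lemma exists_primitive_of_integral_eq_zero {ψ : ℝ → ℝ} (hψ : ContDiff ℝ ∞ ψ)
    (hc : HasCompactSupport ψ) (h0 : ∫ x, ψ x = 0) :
    ∃ φ : ℝ → ℝ, ContDiff ℝ ∞ φ ∧ HasCompactSupport φ ∧ deriv φ = ψ ∧
      ∃ R : ℝ, 0 ≤ R ∧ (∀ x, x ∉ Ioc (-R) R → φ x = 0) ∧ ∀ x, x ∉ Ioc (-R) R → ψ x = 0 := by
  obtain ⟨R₀, hR₀⟩ := hc.isCompact.isBounded.subset_closedBall 0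
  set R := max R₀ 0 + 1 with hR
  have hzero (x : ℝ) (hx : x ∉ Ioo (-R) R) : ψ x = 0 := by
    by_contra hne
    have : x ∈ Metric.closedBall (0 : ℝ) R₀ := hR₀ (subset_tsupport _ hne)
    rw [mem_closedBall_zero_iff, Real.norm_eq_abs, abs_le] at this
    have := le_max_left R₀ 0
    exact hx ⟨by linarith, by linarith⟩
  have hψc := hψ.continuous
  have hd (x : ℝ) : HasDerivAt (fun x => ∫ y in (-R)..x, ψ y) (ψ x) x :=
    hψc.integral_hasStrictDerivAt _ x |>.hasDerivAt
  have hderiv : deriv (fun x => ∫ y in (-R)..x, ψ y) = ψ := funext fun x => (hd x).deriv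
  have hR0 : 0 ≤ R := by have := le_max_right R₀ 0; linarith
  have hleft (x : ℝ) (hx : x ≤ -R) : ∫ y in (-R)..x, ψ y = 0 := by
    rw [intervalIntegral.integral_symm, intervalIntegral.integral_of_le hx,
      setIntegral_eq_zero_of_forall_eq_zero, neg_zero]
    exact fun y hy => hzero y fun h => absurd h.1 (not_lt.2 hy.2)
  have hright (x : ℝ) (hx : R ≤ x) : ∫ y in (-R)..x, ψ y = 0 := by
    rw [intervalIntegral.integral_of_le (by linarith), setIntegral_eq_integral_of_forall_compl_eq_zero,
      h0]
    intro y hy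
    refine hzero y fun h => hy ⟨h.1, by linarith [h.2]⟩
  have hφ0 (x : ℝ) (hx : x ∉ Ioc (-R) R) : ∫ y in (-R)..x, ψ y = 0 := by
    rcases le_or_gt x (-R) with h | h
    · exact hleft x h
    · exact hright x (not_lt.1 fun h' => hx ⟨h, h'.le⟩)
  refine ⟨fun x => ∫ y in (-R)..x, ψ y, ?_, ?_, hderiv, R, hR0, hφ0,
    fun x hx => hzero x fun h => hx ⟨h.1, h.2.le⟩⟩
  · rw [contDiff_infty_iff_deriv, hderiv]
    exact ⟨fun x => (hd x).differentiableAt, hψ⟩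
  · refine HasCompactSupport.intro (isCompact_Icc (a := -R) (b := R)) fun x hx => hφ0 x fun h => hx ?_
    exact Ioc_subset_Icc_self h

/-- A locally integrable function with a locally integrable weak derivative is, up to a constant,
the integral of its weak derivative. -/
lemma exists_ae_eq_integral_of_weakDeriv {g g' : ℝ → ℝ} (hg : LocallyIntegrable g volume)
    (hg' : LocallyIntegrable g' volume)
    (h : ∀ φ : ℝ → ℝ, ContDiff ℝ ∞ φ → HasCompactSupport φ →
      ∫ x, deriv φ x * g x = -∫ x, φ x * g' x) :
    ∃ c, ∀ᵐ x, g x = c + ∫ y in 0..x, g' y := by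
  have hii (α β : ℝ) : IntervalIntegrable g' volume α β := (hg'.integrableOn_isCompact isCompact_uIcc).intervalIntegrable
  set H : ℝ → ℝ := fun x => ∫ y in 0..x, g' y with hH
  have hHc : Continuous H := intervalIntegral.continuous_primitive hii 0
  have hHd : ∀ᵐ x, deriv H x = g' x := by
    filter_upwards [LocallyIntegrable.ae_hasDerivAt_integral hg'] with x hx
    exact (hx 0).deriv
  -- A test function of mean zero is `φ'` for an admissible `φ`. Parts for the absolutely continuous
  -- `H` and the weak derivative of `g` then give the same pairing.
  have key (ψ : ℝ → ℝ) (hψ : ContDiff ℝ ∞ ψ) (hc : HasCompactSupport ψ) (h0 : ∫ x, ψ x = 0) :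
      ∫ x, ψ x * g x = ∫ x, ψ x * H x := by
    obtain ⟨φ, hφ, hφc, hφd, R, hR, hφ0, hψ0⟩ := exists_primitive_of_integral_eq_zero hψ hc h0
    have hle : -R ≤ R := by linarith
    have hac : AbsolutelyContinuousOnInterval H (-R) R :=
      (hii (-R) R).absolutelyContinuousOnInterval_intervalIntegral
        (by rw [uIcc_of_le hle]; exact ⟨by linarith, hR⟩)
    have hac' : AbsolutelyContinuousOnInterval φ (-R) R :=
      (hφ.contDiffOn.of_le (by norm_cast)).absolutelyContinuousOnInterval
    have ibp := hac'.integral_mul_deriv_eq_deriv_mul hac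
    have hφR : φ (-R) = 0 := hφ0 _ fun h => lt_irrefl _ h.1
    have hφR' : φ R = 0 := by
      have hcl : IsClosed {x | φ x = 0} := isClosed_eq hφ.continuous continuous_const
      have : R ∈ closure (Ioi R) := by rw [closure_Ioi]; exact self_mem_Ici
      exact (hcl.closure_subset_iff.2 fun x (hx : R < x) => hφ0 x fun h => absurd h.2 (not_le.2 hx)) this
    have e1 : ∫ x, φ x * g' x = ∫ x in (-R)..R, φ x * deriv H x := by
      rw [intervalIntegral.integral_of_le hle,
        setIntegral_eq_integral_of_forall_compl_eq_zero fun x hx => by rw [hφ0 x hx, zero_mul]]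
      refine integral_congr_ae ?_
      filter_upwards [hHd] with x hx
      rw [hx]
    have e2 : ∫ x, ψ x * H x = ∫ x in (-R)..R, deriv φ x * H x := by
      rw [intervalIntegral.integral_of_le hle, hφd,
        setIntegral_eq_integral_of_forall_compl_eq_zero fun x hx => by rw [hψ0 x hx, zero_mul]]
    have := h φ hφ hφc
    rw [hφd] at this
    rw [this, e1, e2, ibp, hφR, hφR']
    ring
  obtain ⟨χ⟩ : Nonempty (ContDiffBump (0 : ℝ)) := inferInstance
  set X : ℝ → ℝ := χ.normed volume with hX
  have hXs : ContDiff ℝ ∞ X := χ.contDiff_normed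
  have hXc : HasCompactSupport X := χ.hasCompactSupport_normed
  have hXi : Integrable X := hXs.continuous.integrable_of_hasCompactSupport hXc
  have hX1 : ∫ x, X x = 1 := χ.integral_normed
  have hw : LocallyIntegrable (fun x => g x - H x) volume := hg.sub hHc.locallyIntegrable
  have hint {ψ : ℝ → ℝ} (hψ : ContDiff ℝ ∞ ψ) (hc : HasCompactSupport ψ) {k : ℝ → ℝ}
      (hk : LocallyIntegrable k volume) : Integrable fun x => ψ x * k x :=
    hk.integrable_smul_left_of_hasCompactSupport hψ.continuous hc
  refine ⟨∫ x, X x * (g x - H x), ?_⟩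
  have := ae_eq_of_integral_contDiff_smul_eq hw
    (locallyIntegrable_const (∫ x, X x * (g x - H x))) fun φ hφ hφc => ?_
  · filter_upwards [this] with x hx
    rw [← hx]; ring
  have hφi : Integrable φ := hφ.continuous.integrable_of_hasCompactSupport hφc
  set m := ∫ x, φ x with hm
  -- The argument of du Bois-Reymond: subtracting the mean times a normalised bump makes any test
  -- function admissible, so `g - H` pairs like the constant `∫ X (g - H)`.
  have k := key (fun x => φ x - m * X x) (hφ.sub (contDiff_const.mul hXs))
    (hφc.sub (hXc.mul_left (f := fun _ => m)))
    (by rw [integral_sub hφi (hXi.const_mul m), integral_const_mul, hX1]; ring)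
  have expand (l : ℝ → ℝ) (hl : LocallyIntegrable l volume) :
      ∫ x, (φ x - m * X x) * l x = (∫ x, φ x * l x) - m * ∫ x, X x * l x := by
    rw [← integral_const_mul, ← integral_sub (hint hφ hφc hl) ((hint hXs hXc hl).const_mul m)]
    congr 1; ext x; ring
  rw [expand g hg, expand H hHc.locallyIntegrable] at k
  simp only [smul_eq_mul]
  rw [integral_mul_const]
  simp only [mul_sub]
  rw [integral_sub (hint hφ hφc hg) (hint hφ hφc hHc.locallyIntegrable),
    integral_sub (hint hXs hXc hg) (hint hXs hXc hHc.locallyIntegrable)]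
  linarith

lemma HasWeakDeriv.exists_ae_eq_integral {g g' : ℝ → State} (h : HasWeakDeriv g g') :
    ∃ c : State, ∀ᵐ x, g x = c + ∫ y in 0..x, g' y := by
  have hloc {k : ℝ → State} (hk : LocallyIntegrable k volume) (i : Fin 2) :
      LocallyIntegrable (fun x => k x i) volume := fun x => by
    obtain ⟨s, hs, hi⟩ := hk x
    exact ⟨s, hs, hi.eval i⟩
  have key (i : Fin 2) : ∃ c : ℝ, ∀ᵐ x, g x i = c + ∫ y in 0..x, g' y i := by
    refine exists_ae_eq_integral_of_weakDeriv (hloc h.1 i) (hloc h.2.1 i) fun φ hφ hc => ?_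
    have hφ' : Continuous (deriv φ) := (contDiff_infty_iff_deriv.1 hφ).2.continuous
    have e := congrFun (h.2.2 φ hφ hc) i
    rw [Pi.neg_apply, eval_integral fun j => ?_, eval_integral fun j => ?_] at e
    · simpa using e
    · exact (h.2.1.integrable_smul_left_of_hasCompactSupport hφ.continuous hc).eval j
    · exact (h.1.integrable_smul_left_of_hasCompactSupport hφ' hc.deriv).eval j
  choose c hc using key
  refine ⟨c, ?_⟩
  filter_upwards [hc 0, hc 1] with x h0 h1
  have hi (i : Fin 2) : (∫ y in 0..x, g' y) i = ∫ y in 0..x, g' y i :=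
    ((ContinuousLinearMap.proj (R := ℝ) (φ := fun _ : Fin 2 => ℝ) i).intervalIntegral_comp_comm
      (h.2.1.integrableOn_isCompact isCompact_uIcc).intervalIntegrable).symm
  ext i
  rw [Pi.add_apply, hi]
  fin_cases i
  · exact h0
  · exact h1

/-- Twice weakly differentiable functions have a continuously differentiable representative. -/
lemma HasWeakDeriv.exists_representative {g₀ g₁ g₂ : ℝ → State} (h₁ : HasWeakDeriv g₀ g₁)
    (h₂ : HasWeakDeriv g₁ g₂) :
    ∃ g g' : ℝ → State, (∀ x, HasDerivAt g (g' x) x) ∧ g =ᵐ[volume] g₀ ∧ g' =ᵐ[volume] g₁ ∧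
      Continuous g' ∧ ∀ x h, g' (x + h) - g' x = ∫ y in x..x + h, g₂ y := by
  have hii (α β : ℝ) : IntervalIntegrable g₂ volume α β :=
    (h₂.2.1.integrableOn_isCompact isCompact_uIcc).intervalIntegrable
  obtain ⟨c, hc⟩ := h₁.exists_ae_eq_integral
  obtain ⟨d, hd⟩ := h₂.exists_ae_eq_integral
  have hcont : Continuous fun x => d + ∫ y in 0..x, g₂ y :=
    continuous_const.add (intervalIntegral.continuous_primitive hii 0)
  refine ⟨fun x => c + ∫ y in 0..x, (d + ∫ z in 0..y, g₂ z), fun x => d + ∫ y in 0..x, g₂ y,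
    fun x => ?_, ?_, ?_, hcont, fun x h => ?_⟩
  · exact (hcont.integral_hasStrictDerivAt 0 x).hasDerivAt.const_add c
  · filter_upwards [hc] with x hx
    rw [hx]
    congr 1
    refine intervalIntegral.integral_congr_ae ?_
    filter_upwards [hd] with y hy _
    exact hy.symm
  · filter_upwards [hd] with x hx using hx.symm
  · rw [add_sub_add_left_eq_sub, intervalIntegral.integral_interval_sub_left (hii _ _) (hii _ _)]

/-- The increment is `h` times an average of translates over `[0, 1]`; Cauchy-Schwarz and
translation invariance finish. It converts `g₂ ∈ L²` into the increment bound used for second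
derivatives. -/
lemma lintegral_enorm_sq_intervalIntegral_le {g : ℝ → State} (hg : AEStronglyMeasurable g volume)
    (h : ℝ) :
    ∫⁻ x, ‖∫ y in x..x + h, g y‖ₑ ^ 2 ≤ ‖h‖ₑ ^ 2 * ∫⁻ x, ‖g x‖ₑ ^ 2 := by
  obtain ⟨k, hk, hgk⟩ := hg
  have hk' := hk.measurable
  have hint (x : ℝ) : ∫ y in x..x + h, g y = h • ∫ s in 0..1, k (x + h * s) := by
    rw [intervalIntegral.smul_integral_comp_add_mul, mul_zero, mul_one, add_zero]
    exact intervalIntegral.integral_congr_ae (hgk.mono fun x hx _ => hx)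
  have hm : Measurable fun p : ℝ × ℝ => ‖k (p.1 + h * p.2)‖ₑ ^ 2 :=
    ((hk'.comp (by fun_prop : Measurable fun p : ℝ × ℝ => p.1 + h * p.2)).enorm).pow_const 2
  have hb (x : ℝ) : ‖∫ y in x..x + h, g y‖ₑ ^ 2 ≤
      ‖h‖ₑ ^ 2 * ∫⁻ s in Ioc (0 : ℝ) 1, ‖k (x + h * s)‖ₑ ^ 2 := by
    rw [hint, enorm_smul, mul_pow, intervalIntegral.integral_of_le zero_le_one]
    gcongr
    refine (pow_le_pow_left' (enorm_integral_le_lintegral_enorm _) 2).trans ?_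
    have := sq_lintegral_le (volume.restrict (Ioc (0 : ℝ) 1)) (g := fun s => ‖k (x + h * s)‖ₑ)
      (hk'.comp (by fun_prop : Measurable fun s : ℝ => x + h * s)).enorm.aemeasurable
    simpa using this
  calc ∫⁻ x, ‖∫ y in x..x + h, g y‖ₑ ^ 2
      ≤ ∫⁻ x, ‖h‖ₑ ^ 2 * ∫⁻ s in Ioc (0 : ℝ) 1, ‖k (x + h * s)‖ₑ ^ 2 := lintegral_mono hb
    _ = ‖h‖ₑ ^ 2 * ∫⁻ s in Ioc (0 : ℝ) 1, ∫⁻ x, ‖k (x + h * s)‖ₑ ^ 2 := by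
        rw [lintegral_const_mul' _ _ (by simp), lintegral_lintegral_swap hm.aemeasurable]
    _ = ‖h‖ₑ ^ 2 * ∫⁻ x, ‖g x‖ₑ ^ 2 := by
        have (s : ℝ) : ∫⁻ x, ‖k (x + h * s)‖ₑ ^ 2 = ∫⁻ x, ‖g x‖ₑ ^ 2 := by
          rw [lintegral_add_right_eq_self (fun x => ‖k x‖ₑ ^ 2)]
          exact lintegral_congr_ae (hgk.mono fun x hx => by simp only [hx])
        simp [this]

/-- Pointwise bounds valid almost everywhere are valid everywhere for continuous functions. -/
lemma Continuous.le_of_ae_le {X : Type*} [TopologicalSpace X] [MeasurableSpace X] {μ : Measure X}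
    [μ.IsOpenPosMeasure] {k : X → ℝ} {c : ℝ} (hk : Continuous k) (h : ∀ᵐ x ∂μ, k x ≤ c) (x : X) :
    k x ≤ c :=
  (isClosed_le hk continuous_const).closure_subset_iff.2 (subset_refl {x | k x ≤ c})
    (Measure.dense_of_ae h x)

/-- Almost-everywhere bounds pass to every point by continuity of the representatives, and the bound
on `g₂` becomes a Lipschitz bound on `g'`. -/
lemma isStateProfile_of_weakDeriv {a b K₁ K₂ : ℝ} (ha : 0 < a) {g₀ g₁ g₂ : ℝ → State}
    (h₁ : HasWeakDeriv g₀ g₁) (h₂ : HasWeakDeriv g₁ g₂)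
    (hl : ∀ᵐ x, |leftPart a (g₀ x)| ≤ b / 2) (hr : ∀ᵐ x, |rightPart a (g₀ x)| ≤ b / 2)
    (hK₁ : ∀ᵐ x, ‖g₁ x‖ ≤ K₁) (hK₂ : ∀ᵐ x, ‖g₂ x‖ ≤ K₂) :
    ∃ g g' : ℝ → State, IsStateProfile a b ((1 + 1 / a) * K₁) ((1 + 1 / a) * K₂) g g' ∧
      g =ᵐ[volume] g₀ ∧ g' =ᵐ[volume] g₁ ∧
      ∀ h, ∫⁻ x, ‖g' (x + h) - g' x‖ₑ ^ 2 ≤ ‖h‖ₑ ^ 2 * ∫⁻ x, ‖g₂ x‖ₑ ^ 2 := by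
  obtain ⟨g, g', hd, hg, hg', hc', hinc⟩ := h₁.exists_representative h₂
  have hc : Continuous g := continuous_iff_continuousAt.2 fun x => (hd x).continuousAt
  have hA : 0 ≤ 1 + 1 / a := by positivity
  have hlip (x y : ℝ) : ‖g' x - g' y‖ ≤ K₂ * |x - y| := by
    have := hinc y (x - y)
    rw [add_sub_cancel] at this
    rw [this]
    exact intervalIntegral.norm_integral_le_of_norm_le_const_ae (hK₂.mono fun x hx _ => hx)
  have hb' (x : ℝ) : ‖g' x‖ ≤ K₁ := by
    refine Continuous.le_of_ae_le (μ := volume) hc'.norm ?_ x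
    filter_upwards [hK₁, hg'] with x hx e
    rwa [e]
  refine ⟨g, g', ⟨⟨fun x => hasDerivAt_leftPart (hd x), ?_, ?_, ?_⟩,
    ⟨fun x => hasDerivAt_rightPart (hd x), ?_, ?_, ?_⟩⟩, hg, hg', fun h => ?_⟩
  · refine Continuous.le_of_ae_le (μ := volume) (continuous_leftPart.comp hc).abs ?_
    filter_upwards [hl, hg] with x hx e
    simpa only [Function.comp_apply, e] using hx
  · exact fun x => (abs_leftPart_le ha _).trans (mul_le_mul_of_nonneg_left (hb' x) hA)
  · intro x y
    rw [← leftPart_sub, mul_assoc]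
    exact (abs_leftPart_le ha _).trans (mul_le_mul_of_nonneg_left (hlip x y) hA)
  · refine Continuous.le_of_ae_le (μ := volume) (continuous_rightPart.comp hc).abs ?_
    filter_upwards [hr, hg] with x hx e
    simpa only [Function.comp_apply, e] using hx
  · exact fun x => (abs_rightPart_le ha _).trans (mul_le_mul_of_nonneg_left (hb' x) hA)
  · intro x y
    rw [← rightPart_sub, mul_assoc]
    exact (abs_rightPart_le ha _).trans (mul_le_mul_of_nonneg_left (hlip x y) hA)
  · simp only [hinc]
    exact lintegral_enorm_sq_intervalIntegral_le h₂.2.1.aestronglyMeasurable h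

end ViscousPSystem

/-! ### Measurable selection of representatives -/

namespace ViscousPSystem
open Filter Topology ProbabilityTheory

lemma ae_ae_of_ae_prod_right {X Y : Type*} [MeasurableSpace X] [MeasurableSpace Y] {μ : Measure X}
    {ν : Measure Y} [SFinite μ] [SFinite ν] {P : X × Y → Prop} (h : ∀ᵐ p ∂(μ.prod ν), P p) :
    ∀ᵐ y ∂ν, ∀ᵐ x ∂μ, P (x, y) :=
  Measure.ae_ae_of_ae_prod (Measure.measurePreserving_swap.quasiMeasurePreserving.ae h)

section profile

variable {a b K₁ K₂ B₁ B₂ : ℝ}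

lemma isStateProfile_zero (hb : 0 ≤ b) (hB₁ : 0 ≤ B₁) (hB₂ : 0 ≤ B₂) :
    IsStateProfile a b B₁ B₂ 0 0 := by
  have h : IsInitialProfile b B₁ B₂ (fun _ : ℝ => (0 : ℝ)) fun _ => 0 :=
    ⟨fun x => hasDerivAt_const x 0, fun x => by rw [abs_zero]; linarith, fun x => by simpa using hB₁,
      fun x y => by simpa using mul_nonneg hB₂ (abs_nonneg _)⟩
  constructor <;> simpa [leftPart, rightPart] using h

lemma IsStateProfile.norm_le (ha : 0 < a) {g g' : ℝ → State} (h : IsStateProfile a b B₁ B₂ g g')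
    (x : ℝ) : ‖g x‖ ≤ (1 + a) * b := by
  rw [← toState_parts ha.ne' (g x)]
  refine (norm_toState_le ha _ _).trans ?_
  have h1 := h.left.bound x
  have h2 := h.right.bound x
  exact mul_le_mul_of_nonneg_left (by linarith) (by linarith)

lemma IsStateProfile.continuous (ha : a ≠ 0) {g g' : ℝ → State} (h : IsStateProfile a b B₁ B₂ g g') :
    Continuous g := by
  have : g = fun x => toState a (leftPart a (g x)) (rightPart a (g x)) :=
    funext fun x => (toState_parts ha _).symm
  rw [this, ← continuousOn_univ]
  exact continuousOn_toState h.left.continuous.continuousOn h.right.continuous.continuousOn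

/-- Twice weakly differentiable families of functions have a jointly measurable representative
which is continuously differentiable for every parameter. -/
lemma exists_measurable_representative {Y : Type*} [MeasurableSpace Y] {μ : Measure Y} [SFinite μ]
    (ha : 0 < a) (hb : 0 ≤ b) (hK₁ : 0 ≤ K₁) (hK₂ : 0 ≤ K₂) {g₀ g₁ g₂ : ℝ × Y → State}
    (hm : AEStronglyMeasurable g₀ ((volume : Measure ℝ).prod μ))
    (h₁ : ∀ᵐ y ∂μ, HasWeakDeriv (fun x => g₀ (x, y)) fun x => g₁ (x, y))
    (h₂ : ∀ᵐ y ∂μ, HasWeakDeriv (fun x => g₁ (x, y)) fun x => g₂ (x, y))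
    (hl : ∀ᵐ p ∂((volume : Measure ℝ).prod μ), |leftPart a (g₀ p)| ≤ b / 2)
    (hr : ∀ᵐ p ∂((volume : Measure ℝ).prod μ), |rightPart a (g₀ p)| ≤ b / 2)
    (hg₁ : ∀ᵐ p ∂((volume : Measure ℝ).prod μ), ‖g₁ p‖ ≤ K₁)
    (hg₂ : ∀ᵐ p ∂((volume : Measure ℝ).prod μ), ‖g₂ p‖ ≤ K₂) :
    ∃ g g' : Y → ℝ → State, Measurable (fun p : ℝ × Y => g p.2 p.1) ∧
      (∀ y, IsStateProfile a b ((1 + 1 / a) * K₁) ((1 + 1 / a) * K₂) (g y) (g' y)) ∧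
      ∀ᵐ y ∂μ, (∀ᵐ x, g y x = g₀ (x, y)) ∧ (∀ᵐ x, g' y x = g₁ (x, y)) ∧
        ∀ h, ∫⁻ x, ‖g' y (x + h) - g' y x‖ₑ ^ 2 ≤ ‖h‖ₑ ^ 2 * ∫⁻ x, ‖g₂ (x, y)‖ₑ ^ 2 := by
  classical
  obtain ⟨k, hk, hgk⟩ := hm
  set B₁ := (1 + 1 / a) * K₁ with hB₁
  set B₂ := (1 + 1 / a) * K₂ with hB₂
  let P (y : Y) (g g' : ℝ → State) : Prop := IsStateProfile a b B₁ B₂ g g' ∧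
    (∀ᵐ x, g x = g₀ (x, y)) ∧ (∀ᵐ x, g' x = g₁ (x, y)) ∧
    (∀ h, ∫⁻ x, ‖g' (x + h) - g' x‖ₑ ^ 2 ≤ ‖h‖ₑ ^ 2 * ∫⁻ x, ‖g₂ (x, y)‖ₑ ^ 2) ∧
    ∀ᵐ x, g x = k (x, y)
  have hgood : ∀ᵐ y ∂μ, ∃ g g', P y g g' := by
    filter_upwards [h₁, h₂, ae_ae_of_ae_prod_right hl, ae_ae_of_ae_prod_right hr,
      ae_ae_of_ae_prod_right hg₁, ae_ae_of_ae_prod_right hg₂, ae_ae_of_ae_prod_right hgk]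
      with y y1 y2 y3 y4 y5 y6 y7
    obtain ⟨g, g', hp, e0, e1, e2⟩ := isStateProfile_of_weakDeriv ha y1 y2 y3 y4 y5 y6
    refine ⟨g, g', hp, e0, e1, e2, ?_⟩
    filter_upwards [e0, y7] with x hx hx'
    rw [hx, hx']
  -- The set of good parameters need not be measurable; a measurable subset of full measure replaces
  -- it, and the zero profile is used outside.
  obtain ⟨S, hSsub, hS, hSμ⟩ : ∃ S ⊆ {y | ∃ g g', P y g g'}, MeasurableSet S ∧ μ Sᶜ = 0 := by
    obtain ⟨T, hT, hTm, hT0⟩ := exists_measurable_superset_of_null (ae_iff.1 hgood)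
    exact ⟨Tᶜ, fun y hy => not_not.1 fun h => hy (hT h), hTm.compl, by rwa [compl_compl]⟩
  have hex (y : Y) : ∃ g g' : ℝ → State, IsStateProfile a b B₁ B₂ g g' ∧
      (y ∈ S → P y g g') ∧ (y ∉ S → g = 0) := by
    by_cases hy : y ∈ S
    · obtain ⟨g, g', h⟩ := hSsub hy
      exact ⟨g, g', h.1, fun _ => h, fun h => absurd hy h⟩
    · exact ⟨0, 0, isStateProfile_zero hb (by positivity) (by positivity),
        fun h => absurd h hy, fun _ => rfl⟩
  choose g g' hprof hgS hgS' using hex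
  refine ⟨g, g', ?_, hprof, ?_⟩
  -- The representatives were chosen separately for each `y`, so joint measurability is not
  -- automatic. It is recovered from averages of the jointly measurable `k` over `(x, x + 1/(n+1)]`,
  -- which converge to `g y x` by continuity.
  · let avg (n : ℕ) (p : ℝ × Y) : State := ({q | q.2 ∈ S} : Set (ℝ × Y)).indicator
      (fun p => ∫ r in Ioc (0 : ℝ) 1, k (p.1 + r / (n + 1), p.2)) p
    have hSm : MeasurableSet ({q | q.2 ∈ S} : Set (ℝ × Y)) := measurable_snd hS
    have hmeas (n : ℕ) : Measurable (avg n) := by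
      refine Measurable.indicator (StronglyMeasurable.measurable ?_) hSm
      have : StronglyMeasurable fun q : (ℝ × Y) × ℝ => k (q.1.1 + q.2 / (n + 1), q.1.2) :=
        hk.comp_measurable (by fun_prop)
      exact this.integral_prod_right
    refine measurable_of_tendsto_metrizable hmeas (tendsto_pi_nhds.2 fun p => ?_)
    obtain ⟨x, y⟩ := p
    by_cases hy : y ∈ S
    · obtain ⟨-, -, -, -, hy5⟩ := hgS y hy
      have hc := (hprof y).continuous ha.ne'
      have e (n : ℕ) : avg n (x, y) = ∫ r in Ioc (0 : ℝ) 1, g y (x + r / (n + 1)) := by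
        have hmem : (x, y) ∈ ({q | q.2 ∈ S} : Set (ℝ × Y)) := hy
        simp only [avg, indicator_of_mem hmem]
        refine integral_congr_ae (ae_restrict_of_ae ?_)
        have hn : (0 : ℝ) < n + 1 := by positivity
        -- Scaling and translation preserve null sets, so the almost-everywhere identity of `g y`
        -- and `k` survives the substitution.
        have hq : Measure.QuasiMeasurePreserving (fun r : ℝ => x + r / (n + 1)) volume volume := by
          have h1 := (measurePreserving_add_left volume x).quasiMeasurePreserving
          have h2 : Measure.QuasiMeasurePreserving (fun r : ℝ => r * ((n : ℝ) + 1)⁻¹) volume volume := by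
            refine ⟨by fun_prop, ?_⟩
            rw [Real.map_volume_mul_right (inv_ne_zero hn.ne')]
            exact Measure.smul_absolutelyContinuous
          exact h1.comp h2
        filter_upwards [hq.ae hy5] with r hr using hr.symm
      have lim : Tendsto (fun n : ℕ => ∫ r in Ioc (0 : ℝ) 1, g y (x + r / (n + 1))) atTop
          (𝓝 (∫ _ in Ioc (0 : ℝ) 1, g y x)) := by
        refine tendsto_integral_of_dominated_convergence (fun _ => (1 + a) * b) (fun n => ?_)
          (integrable_const _) (fun n => ae_of_all _ fun r => (hprof y).norm_le ha _)
          (ae_of_all _ fun r => ?_)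
        · exact (hc.comp (by fun_prop)).aestronglyMeasurable
        · have : Tendsto (fun n : ℕ => x + r / ((n : ℝ) + 1)) atTop (𝓝 (x + 0)) := by
            refine tendsto_const_nhds.add ?_
            have := (tendsto_one_div_add_atTop_nhds_zero_nat (𝕜 := ℝ)).const_mul r
            simpa [div_eq_mul_inv] using this
          rw [add_zero] at this
          exact (hc.tendsto x).comp this
      simp only [e]
      simpa using lim
    · have hmem : (x, y) ∉ ({q | q.2 ∈ S} : Set (ℝ × Y)) := hy
      simp only [avg, indicator_of_notMem hmem, hgS' y hy]
      exact tendsto_const_nhds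
  · have : ∀ᵐ y ∂μ, y ∈ S := hSμ
    filter_upwards [this] with y hy
    obtain ⟨-, h2, h3, h4, -⟩ := hgS y hy
    exact ⟨h2, h3, h4⟩

end profile

end ViscousPSystem

/-! ### Membership in the solution class -/

namespace ViscousPSystem
open Filter Topology ProbabilityTheory

/-- A derivative along `σ` is the pointwise limit of difference quotients with steps `1/(n+1)`, each
measurable. The indicator restricts to the points where differentiability is known. -/
lemma measurable_indicator_of_hasDerivAt {Z : Type*} [MeasurableSpace Z] {F F' : Z → State}
    {S : Set Z} (hS : MeasurableSet S) {σ : ℝ → Z → Z} (hσ : ∀ h, Measurable (σ h))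
    (hF : Measurable F) (hd : ∀ z ∈ S, HasDerivAt (fun h => F (σ h z)) (F' z) 0) :
    Measurable (S.indicator F') := by
  let τ (n : ℕ) : ℝ := 1 / (n + 1)
  let q (n : ℕ) : Z → State := S.indicator fun z => (τ n)⁻¹ • (F (σ (τ n) z) - F (σ 0 z))
  have hτ : Tendsto τ atTop (𝓝[≠] 0) :=
    tendsto_nhdsWithin_iff.2 ⟨tendsto_one_div_add_atTop_nhds_zero_nat,
      Eventually.of_forall fun n => (Nat.one_div_pos_of_nat (α := ℝ)).ne'⟩
  refine measurable_of_tendsto_metrizable (f := q)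
    (fun n => (((hF.comp (hσ (τ n))).sub (hF.comp (hσ 0))).const_smul (τ n)⁻¹).indicator hS)
    (tendsto_pi_nhds.2 fun z => ?_)
  by_cases hz : z ∈ S
  · have := (hd z hz).tendsto_slope_zero.comp hτ
    simpa [q, hz, Function.comp_def] using this
  · simp only [q, indicator_of_notMem hz]
    exact tendsto_const_nhds

lemma eLpNorm_two_le {Z : Type*} [MeasurableSpace Z] {μ : Measure Z} {g : Z → State} {I : ℝ≥0∞}
    (h : ∫⁻ z, ‖g z‖ₑ ^ 2 ∂μ ≤ I) : eLpNorm g 2 μ ≤ I ^ (1 / 2 : ℝ) := by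
  rw [eLpNorm_eq_lintegral_rpow_enorm_toReal (by simp) (by simp)]
  simp only [ENNReal.toReal_ofNat, ENNReal.rpow_ofNat]
  exact ENNReal.rpow_le_rpow h (by norm_num)

lemma lintegral_enorm_sq_ne_top {Z : Type*} [MeasurableSpace Z] {μ : Measure Z} {g : Z → State}
    (h : MemLp g 2 μ) : ∫⁻ z, ‖g z‖ₑ ^ 2 ∂μ ≠ ⊤ := by
  have := (eLpNorm_lt_top_iff_lintegral_rpow_enorm_lt_top (by simp) (by simp)).1 h.2
  simp only [ENNReal.toReal_ofNat, ENNReal.rpow_ofNat] at this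
  exact this.ne

section measures

variable {N : ℕ} {Γ : Set (Fin N → ℝ)} {ρ : (Fin N → ℝ) → ℝ}

instance : SFinite (densityMeasure Γ ρ) := by unfold densityMeasure; infer_instance

lemma densityMeasure_absolutelyContinuous : densityMeasure Γ ρ ≪ volume.restrict Γ :=
  withDensity_absolutelyContinuous _ _

lemma ae_pos_spaceTimeMeasure : ∀ᵐ p ∂(spaceTimeMeasure Γ), 0 < p.2.1 := by
  have h : ∀ᵐ t ∂(volume.restrict (Ioi (0 : ℝ))), 0 < t := ae_restrict_mem measurableSet_Ioi
  exact Measure.quasiMeasurePreserving_snd.ae (Measure.quasiMeasurePreserving_fst.ae h)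

lemma measurableSet_positive_time : MeasurableSet {p : ℝ × ℝ × (Fin N → ℝ) | 0 < p.2.1} :=
  measurableSet_lt measurable_const (by fun_prop)

/-- Membership in the solution class from bounds on the positive time slices. -/
lemma memSolutionClass_of_bounds {G : ℝ → ℝ → (Fin N → ℝ) → State}
    (hm : Measurable ({p : ℝ × ℝ × (Fin N → ℝ) | 0 < p.2.1}.indicator
      fun p => G p.1 p.2.1 p.2.2))
    {K : ℝ} (hK : ∀ x t y, 0 < t → ‖G x t y‖ ≤ K) {L : (Fin N → ℝ) → ℝ≥0∞}
    (hL : ∀ᵐ y ∂(densityMeasure Γ ρ), ∀ t, 0 < t → ∫⁻ x, ‖G x t y‖ₑ ^ 2 ≤ L y)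
    (hfin : ∫⁻ y, L y ∂(densityMeasure Γ ρ) ≠ ⊤) : MemSolutionClass Γ ρ G := by
  refine ⟨memLp_top_of_bound ?_ K ?_,
    ((∫⁻ y, L y ∂(densityMeasure Γ ρ)) ^ (1 / 2 : ℝ)).toReal, ?_⟩
  · refine hm.aestronglyMeasurable.congr ?_
    filter_upwards [ae_pos_spaceTimeMeasure] with p hp
    exact indicator_of_mem (s := {p : ℝ × ℝ × (Fin N → ℝ) | 0 < p.2.1}) hp _
  · filter_upwards [ae_pos_spaceTimeMeasure] with p hp using hK _ _ _ hp
  · filter_upwards [ae_restrict_mem measurableSet_Ioi] with t ht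
    have hmt : Measurable fun p : ℝ × (Fin N → ℝ) => G p.1 t p.2 := by
      have := hm.comp (by fun_prop : Measurable fun p : ℝ × (Fin N → ℝ) => (p.1, t, p.2))
      convert this using 1
      ext1 p
      exact (indicator_of_mem (s := {p : ℝ × ℝ × (Fin N → ℝ) | 0 < p.2.1}) (a := (p.1, t, p.2))
        ht fun p => G p.1 p.2.1 p.2.2).symm
    have hI : ∫⁻ p, ‖G p.1 t p.2‖ₑ ^ 2 ∂(weightedMeasure Γ ρ) ≤
        ∫⁻ y, L y ∂(densityMeasure Γ ρ) := by
      rw [weightedMeasure, lintegral_prod_symm _ (hmt.enorm.pow_const 2).aemeasurable]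
      refine lintegral_mono_ae ?_
      filter_upwards [hL] with y hy using hy t ht
    have hle := eLpNorm_two_le hI
    have htop : (∫⁻ y, L y ∂(densityMeasure Γ ρ)) ^ (1 / 2 : ℝ) ≠ ⊤ :=
      ENNReal.rpow_ne_top_of_nonneg (by norm_num) hfin
    rw [ENNReal.ofReal_toReal htop]
    exact ⟨⟨hmt.aestronglyMeasurable, hle.trans_lt htop.lt_top⟩, hle⟩

end measures

section regularity

variable {a b B₁ B₂ ε ν : ℝ} {f : ℝ → ℝ}

lemma measurable_viscousSolution {Y : Type*} [MeasurableSpace Y] {g g' : Y → ℝ → State} (hε : 0 < ε)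
    (hM : IsMaxwellianPair (leftMaxwellian a f) (rightMaxwellian a f))
    (hg : Measurable fun p : ℝ × Y => g p.2 p.1) (h : ∀ y, IsStateProfile a b B₁ B₂ (g y) (g' y)) :
    Measurable fun p : ℝ × ℝ × Y => viscousSolution a ε ν f (g p.2.2) p.1 p.2.1 := by
  have hl := continuous_leftPart (a := a) |>.measurable.comp hg
  have hr := continuous_rightPart (a := a) |>.measurable.comp hg
  have hu : Measurable fun p : ℝ × ℝ × Y => viscousDensity a ε ν f (g p.2.2) p.1 p.2.1 :=
    measurable_density (w₁ := fun y x => leftPart a (g y x)) (w₂ := fun y x => rightPart a (g y x))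
      (by positivity) hM hl hr (fun y => (h y).left) fun y => (h y).right
  exact measurable_toState
    (measurable_kineticComponent (w := fun y x => leftPart a (g y x))
      (u := fun y => viscousDensity a ε ν f (g y)) hM.continuous.measurable hl hu)
    (measurable_kineticComponent (w := fun y x => rightPart a (g y x))
      (u := fun y => viscousDensity a ε ν f (g y)) hM.symm.continuous.measurable hr hu)

variable {N : ℕ} {Γ : Set (Fin N → ℝ)} {ρ : (Fin N → ℝ) → ℝ}

/-- All bounds hold for each `y` with constants independent of `y`, so integrating `C * L y` over
the parameters gives the `L²` part; measurability of the derivatives comes from difference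
quotients. -/
theorem hasSolutionRegularity_viscousSolution (ha : 0 < a) (hε : 0 < ε) (hν : 0 < ν) (hb : 0 ≤ b)
    (hM : IsMaxwellianPair (leftMaxwellian a f) (rightMaxwellian a f))
    {g g' : (Fin N → ℝ) → ℝ → State}
    (hg : Measurable fun p : ℝ × (Fin N → ℝ) => g p.2 p.1)
    (h : ∀ y, IsStateProfile a b B₁ B₂ (g y) (g' y)) {L : (Fin N → ℝ) → ℝ≥0∞}
    (hL : ∀ᵐ y ∂(densityMeasure Γ ρ), ∫⁻ x, ‖g y x‖ₑ ^ 2 ≤ L y ∧ ∫⁻ x, ‖g' y x‖ₑ ^ 2 ≤ L y ∧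
      ∀ h, ∫⁻ x, ‖g' y (x + h) - g' y x‖ₑ ^ 2 ≤ ‖h‖ₑ ^ 2 * L y)
    (hfin : ∫⁻ y, L y ∂(densityMeasure Γ ρ) ≠ ⊤) :
    HasSolutionRegularity Γ ρ fun x t y => viscousSolution a ε ν f (g y) x t := by
  obtain ⟨K, hK⟩ := exists_norm_bound ha hε hν hM b B₁ B₂
  obtain ⟨C, hC, hCb⟩ := exists_lintegral_bound ha hε hν hM hb
  have hfin' : ∫⁻ y, C * L y ∂(densityMeasure Γ ρ) ≠ ⊤ := by
    rw [lintegral_const_mul' _ _ hC]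
    exact ENNReal.mul_ne_top hC hfin
  have hbound : ∀ᵐ y ∂(densityMeasure Γ ρ), ∀ t, 0 < t →
      ∫⁻ x, ‖viscousSolution a ε ν f (g y) x t‖ₑ ^ 2 ≤ C * L y ∧
        ∫⁻ x, ‖viscousSolutionDt a ε ν f (g y) (g' y) x t‖ₑ ^ 2 ≤ C * L y ∧
        ∫⁻ x, ‖viscousSolutionDx a ε ν f (g y) (g' y) x t‖ₑ ^ 2 ≤ C * L y ∧
        ∫⁻ x, ‖viscousSolutionDxx a ε ν f (g y) (g' y) x t‖ₑ ^ 2 ≤ C * L y := by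
    filter_upwards [hL] with y hy t ht
    exact hCb B₁ B₂ (g y) (g' y) (L y) (h y) hy.1 hy.2.1 hy.2.2 t ht
  set S : Set (ℝ × ℝ × (Fin N → ℝ)) := {p | 0 < p.2.1} with hS
  have hSm : MeasurableSet S := measurableSet_positive_time
  have hm := measurable_viscousSolution (ν := ν) hε hM hg h
  have shift_x (r : ℝ) : Measurable fun p : ℝ × ℝ × (Fin N → ℝ) => (p.1 + r, p.2) := by fun_prop
  have shift_t (r : ℝ) : Measurable fun p : ℝ × ℝ × (Fin N → ℝ) => (p.1, p.2.1 + r, p.2.2) := by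
    fun_prop
  have hmt : Measurable (S.indicator fun p : ℝ × ℝ × (Fin N → ℝ) =>
      viscousSolutionDt a ε ν f (g p.2.2) (g' p.2.2) p.1 p.2.1) :=
    measurable_indicator_of_hasDerivAt hSm shift_t hm fun p hp => by
      have := hasDerivAt_viscousSolution_time hε hν hM (h p.2.2) p.1 (t := p.2.1) hp
      exact HasDerivAt.comp_const_add p.2.1 0 (by simpa using this)
  have hmx : Measurable (S.indicator fun p : ℝ × ℝ × (Fin N → ℝ) =>
      viscousSolutionDx a ε ν f (g p.2.2) (g' p.2.2) p.1 p.2.1) :=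
    measurable_indicator_of_hasDerivAt hSm shift_x hm fun p hp => by
      have := hasDerivAt_viscousSolution hε hν hM (h p.2.2) p.1 p.2.1
      exact HasDerivAt.comp_const_add p.1 0 (by simpa using this)
  have hmxx : Measurable (S.indicator fun p : ℝ × ℝ × (Fin N → ℝ) =>
      viscousSolutionDxx a ε ν f (g p.2.2) (g' p.2.2) p.1 p.2.1) :=
    measurable_indicator_of_hasDerivAt hSm shift_x hmx fun p hp => by
      have := hasDerivAt_viscousSolutionDx hε hν hM (h p.2.2) p.1 (t := p.2.1) hp
      have := HasDerivAt.comp_const_add p.1 0 (by simpa using this)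
      refine this.congr_of_eventuallyEq (Eventually.of_forall fun r => ?_)
      exact indicator_of_mem (s := S) (a := (p.1 + r, p.2)) hp _
  have edt (x t : ℝ) (y) (ht : 0 < t) := dt_viscousSolution hε hν hM (h y) x ht
  have edx (x t : ℝ) (y) := congrFun₂ (dx_viscousSolution hε hν hM (h y)) x t
  have edxx (x t : ℝ) (y) (ht : 0 < t) := dxx_viscousSolution hε hν hM (h y) x ht
  refine ⟨memSolutionClass_of_bounds (hm.indicator hSm) (K := K)
      (fun x t y ht => (hK _ _ (h y) x t ht).1) (hbound.mono fun y hy t ht => (hy t ht).1) hfin',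
    memSolutionClass_of_bounds (K := K) ?_ (fun x t y ht => ?_) (hbound.mono fun y hy t ht => ?_) hfin',
    memSolutionClass_of_bounds (K := K) ?_ (fun x t y ht => ?_) (hbound.mono fun y hy t ht => ?_) hfin',
    memSolutionClass_of_bounds (K := K) ?_ (fun x t y ht => ?_) (hbound.mono fun y hy t ht => ?_) hfin'⟩
  · rwa [indicator_congr fun p hp => edt p.1 p.2.1 p.2.2 hp]
  · rw [edt x t y ht]; exact (hK _ _ (h y) x t ht).2.1
  · simp only [edt _ t y ht]; exact (hy t ht).2.1
  · rwa [indicator_congr fun p hp => edx p.1 p.2.1 p.2.2]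
  · rw [edx x t y]; exact (hK _ _ (h y) x t ht).2.2.1
  · simp only [edx _ t y]; exact (hy t ht).2.2.1
  · rwa [indicator_congr fun p hp => edxx p.1 p.2.1 p.2.2 hp]
  · rw [edxx x t y ht]; exact (hK _ _ (h y) x t ht).2.2.2
  · simp only [edxx _ t y ht]; exact (hy t ht).2.2.2

end regularity

end ViscousPSystem

/-! ### Pointwise bounds from essential bounds, and the invariant region -/

namespace ViscousPSystem
open Filter Topology ProbabilityTheory

section boundedness

variable {N : ℕ} {Γ : Set (Fin N → ℝ)} {ρ : (Fin N → ℝ) → ℝ}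

lemma ae_ae_of_ae_spaceTimeMeasure {P : ℝ → ℝ → (Fin N → ℝ) → Prop}
    (h : ∀ᵐ p ∂(spaceTimeMeasure Γ), P p.1 p.2.1 p.2.2) :
    ∀ᵐ y ∂(volume.restrict Γ), ∀ᵐ q ∂((volume : Measure (ℝ × ℝ)).restrict {q | 0 ≤ q.2}),
      P q.1 q.2 y := by
  have hset : ({q | 0 ≤ q.2} : Set (ℝ × ℝ)) = univ ×ˢ Ici 0 := by ext; simp
  have hmeas : (volume : Measure (ℝ × ℝ)).restrict {q | 0 ≤ q.2} =
      (volume : Measure ℝ).prod (volume.restrict (Ioi (0 : ℝ))) := by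
    rw [hset, Measure.volume_eq_prod, ← Measure.prod_restrict, Measure.restrict_univ,
      restrict_Ioi_eq_restrict_Ici]
  rw [hmeas]
  exact ae_ae_of_ae_prod_right ((measurePreserving_prodAssoc (volume : Measure ℝ)
    (volume.restrict (Ioi (0 : ℝ))) (volume.restrict Γ)).quasiMeasurePreserving.ae h)

/-- Essentially bounded solutions are bounded for almost every parameter. -/
lemma exists_bound_of_memSolutionClass {V : ℝ → ℝ → (Fin N → ℝ) → State}
    (hV : MemSolutionClass Γ ρ V)
    (hc : ∀ᵐ y ∂(volume.restrict Γ),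
      ContinuousOn (fun q : ℝ × ℝ => V q.1 q.2 y) {q | 0 ≤ q.2}) :
    ∃ K : ℝ, ∀ᵐ y ∂(volume.restrict Γ), ∀ x t, 0 ≤ t → ‖V x t y‖ ≤ K := by
  obtain ⟨K, hK⟩ : ∃ K : ℝ, ∀ᵐ p ∂(spaceTimeMeasure Γ), ‖V p.1 p.2.1 p.2.2‖ ≤ K := by
    refine ⟨(eLpNorm (fun p : ℝ × ℝ × (Fin N → ℝ) => V p.1 p.2.1 p.2.2) ⊤
      (spaceTimeMeasure Γ)).toReal, ?_⟩
    filter_upwards [ae_le_eLpNormEssSup (f := fun p : ℝ × ℝ × (Fin N → ℝ) => V p.1 p.2.1 p.2.2)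
      (μ := spaceTimeMeasure Γ)] with p hp
    rw [← eLpNorm_exponent_top] at hp
    rw [← toReal_enorm]
    exact ENNReal.toReal_mono hV.1.2.ne hp
  refine ⟨K, ?_⟩
  filter_upwards [hc, ae_ae_of_ae_spaceTimeMeasure (P := fun x t y => ‖V x t y‖ ≤ K) hK]
    with y hy1 hy2 x t ht
  have hset : ({q | 0 ≤ q.2} : Set (ℝ × ℝ)) = univ ×ˢ Ici 0 := by ext; simp
  -- The inequality is encoded as the equality `max ‖V‖ K = K`, which extends by continuity from
  -- almost every point to all points, the closed half plane being the closure of its interior.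
  have := Measure.eqOn_of_ae_eq (μ := (volume : Measure (ℝ × ℝ)))
    (f := fun q : ℝ × ℝ => max ‖V q.1 q.2 y‖ K) (g := fun _ => K)
    (hy2.mono fun q hq => max_eq_right hq) (hy1.norm.sup continuousOn_const) continuousOn_const
    (by rw [hset, interior_prod_eq, interior_univ, interior_Ici, closure_prod_eq, closure_univ,
      closure_Ioi])
  exact max_eq_right_iff.1 (this (show ((x, t) : ℝ × ℝ) ∈ {q : ℝ × ℝ | 0 ≤ q.2} from ht))

end boundedness

section riemann

variable {a : ℝ}

lemma riemannMatrix_mulVec_zero (ha : a ≠ 0) (s : State) :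
    (riemannMatrix a).mulVec s 0 = -(2 * a) * leftPart a s := by
  simp [riemannMatrix, Matrix.mulVec, dotProduct, leftPart]
  field_simp
  ring

lemma riemannMatrix_mulVec_one (ha : a ≠ 0) (s : State) :
    (riemannMatrix a).mulVec s 1 = -(2 * a) * rightPart a s := by
  simp [riemannMatrix, Matrix.mulVec, dotProduct, rightPart]
  field_simp
  ring

/-- `A` multiplies the kinetic components by `-2a`, so balls for `‖A U‖` are boxes in those
components. -/
lemma norm_riemannMatrix_mulVec_le_iff (ha : 0 < a) (s : State) {r : ℝ} (hr : 0 ≤ r) :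
    ‖(riemannMatrix a).mulVec s‖ ≤ r ↔
      |leftPart a s| ≤ r / (2 * a) ∧ |rightPart a s| ≤ r / (2 * a) := by
  rw [pi_norm_le_iff_of_nonneg hr, Fin.forall_fin_two, riemannMatrix_mulVec_zero ha.ne',
    riemannMatrix_mulVec_one ha.ne', Real.norm_eq_abs, Real.norm_eq_abs, abs_mul, abs_mul, abs_neg,
    abs_of_pos (by positivity : 0 < 2 * a), le_div_iff₀' (by positivity),
    le_div_iff₀' (by positivity)]

lemma norm_mulVec_le_maxOpNorm (B : Matrix (Fin 2) (Fin 2) ℝ) (s : State) :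
    ‖B.mulVec s‖ ≤ maxOpNorm B * ‖s‖ :=
  (LinearMap.toContinuousLinearMap (Matrix.toLin' B)).le_opNorm s

lemma norm_le_maxOpNorm_inv (ha : 0 < a) (s : State) :
    ‖s‖ ≤ maxOpNorm (riemannMatrix a)⁻¹ * ‖(riemannMatrix a).mulVec s‖ := by
  have hdet : IsUnit (riemannMatrix a).det := by
    rw [riemannMatrix, Matrix.det_fin_two_of]
    exact (by linarith : -a * -1 - 1 * -a = 2 * a) ▸ (by positivity : 2 * a ≠ 0).isUnit
  have := norm_mulVec_le_maxOpNorm (riemannMatrix a)⁻¹ ((riemannMatrix a).mulVec s)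
  rwa [Matrix.mulVec_mulVec, Matrix.nonsing_inv_mul _ hdet, Matrix.one_mulVec] at this

lemma maxOpNorm_nonneg (B : Matrix (Fin 2) (Fin 2) ℝ) : 0 ≤ maxOpNorm B := norm_nonneg _

/-- The invariant-region bound for the solution. -/
lemma norm_viscousSolution_le {ε ν b β B₁ B₂ : ℝ} {f : ℝ → ℝ} {g g' : ℝ → State} (ha : 0 < a)
    (hε : 0 < ε) (hM : IsMaxwellianPair (leftMaxwellian a f) (rightMaxwellian a f)) (hβ : 0 ≤ β)
    (hb : b = β / a) (h : IsStateProfile a b B₁ B₂ g g') (x t : ℝ) :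
    ‖viscousSolution a ε ν f g x t‖ ≤
      maxOpNorm (riemannMatrix a)⁻¹ * (β + max |f (-b)| |f b|) := by
  set m := max |f (-b)| |f b| with hm
  have m0 : 0 ≤ m := (abs_nonneg _).trans (le_max_left _ _)
  have m1 := abs_le.1 (le_max_left _ _ : |f (-b)| ≤ m)
  have m2 := abs_le.1 (le_max_right _ _ : |f b| ≤ m)
  have hba : β = a * b := by rw [hb]; field_simp
  -- With `β = a b` the target radius equals `(b + m/a)/2`. It is at least `b/2` and bounds both
  -- equilibria at `±b`, which is all that the component bound requires.
  have hR : (β + m) / (2 * a) = (b + m / a) / 2 := by rw [hba]; field_simp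
  have d1 : f b / a ≤ m / a := by gcongr; exact m2.2
  have d2 : -(m / a) ≤ f b / a := by rw [← neg_div]; gcongr; exact m2.1
  have d3 : f (-b) / a ≤ m / a := by gcongr; exact m1.2
  have d4 : -(m / a) ≤ f (-b) / a := by rw [← neg_div]; gcongr; exact m1.1
  have d5 : 0 ≤ m / a := by positivity
  refine (norm_le_maxOpNorm_inv ha _).trans (mul_le_mul_of_nonneg_left ?_ (maxOpNorm_nonneg _))
  rw [norm_riemannMatrix_mulVec_le_iff ha _ (by positivity), hR]
  have hl (p q : ℝ) : leftPart a (toState a p q) = p := by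
    simp only [leftPart, toState]; simp; field_simp; ring
  have hr (p q : ℝ) : rightPart a (toState a p q) = q := by
    simp only [rightPart, toState]; simp; field_simp; ring
  rw [viscousSolution, hl, hr]
  have hu := continuous_viscousDensity (ν := ν) hε hM h
  have hub := abs_viscousDensity_le (ν := ν) hε hM h
  constructor
  · refine abs_kineticComponent_le (by positivity) hM h.left hu hub (by linarith) ?_ ?_ x t <;>
      simp only [leftMaxwellian] <;> linarith
  · refine abs_kineticComponent_le (by positivity) hM.symm h.right hu hub (by linarith) ?_ ?_ x t <;>
      simp only [rightMaxwellian] <;> linarith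

variable {N : ℕ} {Γ : Set (Fin N → ℝ)} {ρ : (Fin N → ℝ) → ℝ}

/-- Uniformly bounded data are bounded by `supData` in the Riemann coordinates. -/
lemma ae_norm_mulVec_le_supData {U₀ : ℝ → ℝ → ℝ × (Fin N → ℝ) → State} {C : ℝ}
    (hC : ∀ ε ν : ℝ, 0 < ε → 0 < ν → eLpNorm (U₀ ε ν) ⊤ (spaceMeasure Γ) ≤ ENNReal.ofReal C)
    {ε ν : ℝ} (hε : 0 < ε) (hν : 0 < ν) :
    ∀ᵐ p ∂(spaceMeasure Γ), ‖(riemannMatrix a).mulVec (U₀ ε ν p)‖ ≤ supData Γ a U₀ := by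
  set Q : ℝ≥0∞ := ⨆ (ε : ℝ) (ν : ℝ) (_ : 0 < ε) (_ : 0 < ν),
    eLpNorm (fun p => (riemannMatrix a).mulVec (U₀ ε ν p)) ⊤ (spaceMeasure Γ) with hQ
  -- Finiteness matters: `toReal` sends `⊤` to `0`, and the bound by `supData` would be lost.
  have hfin : Q ≠ ⊤ := by
    have : Q ≤ ENNReal.ofReal (maxOpNorm (riemannMatrix a)) * ENNReal.ofReal C := by
      refine iSup_le fun ε => iSup_le fun ν => iSup_le fun hε => iSup_le fun hν => ?_
      refine (eLpNorm_le_mul_eLpNorm_of_ae_le_mul (g := U₀ ε ν)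
        (ae_of_all _ fun p => norm_mulVec_le_maxOpNorm _ _) ⊤).trans ?_
      gcongr
      exact hC ε ν hε hν
    exact (this.trans_lt (by finiteness)).ne
  have hle : eLpNorm (fun p => (riemannMatrix a).mulVec (U₀ ε ν p)) ⊤ (spaceMeasure Γ) ≤ Q :=
    le_iSup_of_le ε (le_iSup_of_le ν (le_iSup_of_le hε (le_iSup_of_le hν le_rfl)))
  filter_upwards [ae_le_eLpNormEssSup (f := fun p => (riemannMatrix a).mulVec (U₀ ε ν p))
    (μ := spaceMeasure Γ)] with p hp
  rw [← eLpNorm_exponent_top] at hp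
  rw [← toReal_enorm]
  exact ENNReal.toReal_mono hfin (hp.trans hle)

end riemann

lemma abs_sub_le_of_abs_deriv_le {f : ℝ → ℝ} {a : ℝ} (hf : ContDiff ℝ 2 f)
    (hsub : ∀ u : ℝ, -a < deriv f u ∧ deriv f u < a) (x y : ℝ) : |f x - f y| ≤ a * |x - y| :=
  Convex.norm_image_sub_le_of_norm_deriv_le (s := univ)
    (fun u _ => hf.differentiable (by norm_num) u)
    (fun u _ => abs_le.2 ⟨(hsub u).1.le, (hsub u).2.le⟩) convex_univ (mem_univ y) (mem_univ x)

end ViscousPSystem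

/-! ### Assembly: existence and uniqueness over the parameter set -/

namespace ViscousPSystem
open Filter Topology ProbabilityTheory

lemma ae_norm_le_of_eLpNorm_top_le {Z : Type*} [MeasurableSpace Z] {μ : Measure Z} {g : Z → State}
    {c : ℝ} (h : eLpNorm g ⊤ μ ≤ ENNReal.ofReal c) : ∀ᵐ z ∂μ, ‖g z‖ ≤ max c 0 := by
  filter_upwards [ae_le_eLpNormEssSup (f := g) (μ := μ)] with z hz
  rw [← eLpNorm_exponent_top] at hz
  rw [← toReal_enorm, ← ENNReal.toReal_ofReal']
  exact ENNReal.toReal_mono ENNReal.ofReal_ne_top (hz.trans h)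

variable {N : ℕ} {Γ : Set (Fin N → ℝ)} {ρ : (Fin N → ℝ) → ℝ}

lemma lintegral_densityMeasure_slices {g : ℝ × (Fin N → ℝ) → State}
    (hg : MemLp g 2 (weightedMeasure Γ ρ)) :
    AEMeasurable (fun y => ∫⁻ x, ‖g (x, y)‖ₑ ^ 2) (densityMeasure Γ ρ) ∧
      ∫⁻ y, (∫⁻ x, ‖g (x, y)‖ₑ ^ 2) ∂(densityMeasure Γ ρ) ≠ ⊤ := by
  have hm : AEMeasurable (fun p => ‖g p‖ₑ ^ 2)
      ((volume : Measure ℝ).prod (densityMeasure Γ ρ)) := hg.1.enorm.pow_const 2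
  refine ⟨hm.prod_swap.lintegral_prod_right', ?_⟩
  have := lintegral_enorm_sq_ne_top hg
  rwa [weightedMeasure, lintegral_prod_symm _ hm] at this

/-- Existence of the solution for one pair `(ε, ν)`, given by an explicit family of profiles. -/
theorem exists_solution {a ε ν β K : ℝ} {f : ℝ → ℝ} (ha : 0 < a) (hε : 0 < ε) (hν : 0 < ν)
    (hβ : 0 ≤ β) (hK : 0 ≤ K) (hM : IsMaxwellianPair (leftMaxwellian a f) (rightMaxwellian a f))
    {g₀ g₁ g₂ : ℝ × (Fin N → ℝ) → State} (h₁ : HasWeakDerivX Γ g₀ g₁) (h₂ : HasWeakDerivX Γ g₁ g₂)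
    (m₀ : MemL2Linfty Γ ρ g₀) (m₁ : MemL2Linfty Γ ρ g₁) (m₂ : MemL2Linfty Γ ρ g₂)
    (hg₀ : ∀ᵐ p ∂(spaceMeasure Γ), ‖(riemannMatrix a).mulVec (g₀ p)‖ ≤ β)
    (hg₁ : ∀ᵐ p ∂(spaceMeasure Γ), ‖g₁ p‖ ≤ K) (hg₂ : ∀ᵐ p ∂(spaceMeasure Γ), ‖g₂ p‖ ≤ K) :
    ∃ U : ℝ → ℝ → (Fin N → ℝ) → State, IsGlobalClassicalSolution Γ a ε ν f g₀ U ∧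
      HasSolutionRegularity Γ ρ U ∧ ∀ x t y,
        ‖U x t y‖ ≤ maxOpNorm (riemannMatrix a)⁻¹ * (β + max |f (-β / a)| |f (β / a)|) := by
  -- Data in the `β`-ball of `‖A U‖` have components at most `β/(2a) = b/2` with `b = β/a`, the
  -- normalisation built into profiles.
  have hb : β / (2 * a) = β / a / 2 := by field_simp
  obtain ⟨g, g', hgm, hprof, hgood⟩ := exists_measurable_representative (μ := volume.restrict Γ)
    (b := β / a) ha (by positivity) hK hK m₀.2.1 h₁ h₂
    (hg₀.mono fun p hp => hb ▸ ((norm_riemannMatrix_mulVec_le_iff ha _ hβ).1 hp).1)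
    (hg₀.mono fun p hp => hb ▸ ((norm_riemannMatrix_mulVec_le_iff ha _ hβ).1 hp).2) hg₁ hg₂
  refine ⟨fun x t y => viscousSolution a ε ν f (g y) x t, ?_, ?_, fun x t y => ?_⟩
  · filter_upwards [hgood] with y hy
    exact isClassicalSolution_viscousSolution ha hε hν hM (hprof y) hy.1
  · let L (y : Fin N → ℝ) : ℝ≥0∞ := (∫⁻ x, ‖g₀ (x, y)‖ₑ ^ 2) + ((∫⁻ x, ‖g₁ (x, y)‖ₑ ^ 2) +
      ∫⁻ x, ‖g₂ (x, y)‖ₑ ^ 2)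
    refine hasSolutionRegularity_viscousSolution (L := L) ha hε hν (by positivity) hM hgm hprof ?_ ?_
    · filter_upwards [densityMeasure_absolutelyContinuous.ae_le hgood] with y ⟨y0, y1, y2⟩
      have e0 : ∫⁻ x, ‖g y x‖ₑ ^ 2 = ∫⁻ x, ‖g₀ (x, y)‖ₑ ^ 2 :=
        lintegral_congr_ae (y0.mono fun x hx => by simp only [hx])
      have e1 : ∫⁻ x, ‖g' y x‖ₑ ^ 2 = ∫⁻ x, ‖g₁ (x, y)‖ₑ ^ 2 :=
        lintegral_congr_ae (y1.mono fun x hx => by simp only [hx])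
      refine ⟨e0.le.trans le_self_add, e1.le.trans (le_self_add.trans le_add_self), fun h => ?_⟩
      refine (y2 h).trans ?_
      gcongr
      exact le_add_self.trans le_add_self
    · obtain ⟨a0, f0⟩ := lintegral_densityMeasure_slices m₀.1
      obtain ⟨a1, f1⟩ := lintegral_densityMeasure_slices m₁.1
      obtain ⟨a2, f2⟩ := lintegral_densityMeasure_slices m₂.1
      rw [lintegral_add_left' a0, lintegral_add_left' a1]
      finiteness
  · have := norm_viscousSolution_le (ν := ν) ha hε hM hβ rfl (hprof y) x t
    rwa [← neg_div] at this

/-- Membership in the solution class supplies one sup bound valid for almost every parameter, after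
which uniqueness applies parameter by parameter. -/
theorem solution_unique {a ε ν : ℝ} {f : ℝ → ℝ} (ha : 0 < a) (hε : 0 < ε) (hν : 0 < ν)
    (hf : ∀ x y, |f x - f y| ≤ a * |x - y|) {g₀ : ℝ × (Fin N → ℝ) → State}
    {U V : ℝ → ℝ → (Fin N → ℝ) → State} (hU : IsGlobalClassicalSolution Γ a ε ν f g₀ U)
    (hV : IsGlobalClassicalSolution Γ a ε ν f g₀ V) (rU : HasSolutionRegularity Γ ρ U)
    (rV : HasSolutionRegularity Γ ρ V) :
    ∀ᵐ y ∂(volume.restrict Γ), ∀ x t : ℝ, 0 ≤ t → V x t y = U x t y := by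
  obtain ⟨K, hK⟩ := exists_bound_of_memSolutionClass rU.mem (hU.mono fun y hy => hy.continuousOn)
  obtain ⟨K', hK'⟩ := exists_bound_of_memSolutionClass rV.mem (hV.mono fun y hy => hy.continuousOn)
  filter_upwards [hU, hV, hK, hK'] with y y1 y2 y3 y4 x t ht
  exact y2.eq_of_bounded ha hε hν hf y1 (K := max K K')
    (fun x t ht => (y4 x t ht).trans (le_max_right _ _))
    (fun x t ht => (y3 x t ht).trans (le_max_left _ _)) x t ht

end ViscousPSystem

theorem theorem4p3 {N : ℕ} (Γ : Set (Fin N → ℝ)) (hΓ : MeasurableSet Γ)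
    (hΓb : Bornology.IsBounded Γ)
    (ρ : (Fin N → ℝ) → ℝ) (hρ : ViscousPSystem.IsBoundedDensity Γ ρ)
    (a : ℝ) (ha : 0 < a)
    (f : ℝ → ℝ) (hf : ContDiff ℝ 2 f) (hf0 : f 0 = 0) (hf'0 : deriv f 0 = 0)
    (hsub : ∀ u : ℝ, -a < deriv f u ∧ deriv f u < a)
    (U₀ dU₀ ddU₀ : ℝ → ℝ → ℝ × (Fin N → ℝ) → ViscousPSystem.State)
    (hd : ∀ ε ν : ℝ, 0 < ε → 0 < ν → ViscousPSystem.HasWeakDerivX Γ (U₀ ε ν) (dU₀ ε ν))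
    (hdd : ∀ ε ν : ℝ, 0 < ε → 0 < ν → ViscousPSystem.HasWeakDerivX Γ (dU₀ ε ν) (ddU₀ ε ν))
    (hmem : ∀ ε ν : ℝ, 0 < ε → 0 < ν →
      ViscousPSystem.MemL2Linfty Γ ρ (U₀ ε ν) ∧ ViscousPSystem.MemL2Linfty Γ ρ (dU₀ ε ν) ∧
        ViscousPSystem.MemL2Linfty Γ ρ (ddU₀ ε ν))
    (C : ℝ)
    (hC : ∀ ε ν : ℝ, 0 < ε → 0 < ν →
      ViscousPSystem.dataNorm Γ ρ (U₀ ε ν) + ViscousPSystem.dataNorm Γ ρ (dU₀ ε ν) +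
        ViscousPSystem.dataNorm Γ ρ (ddU₀ ε ν) ≤ ENNReal.ofReal C) :
    ∀ ε ν : ℝ, 0 < ε → 0 < ν →
      ∃ U : ℝ → ℝ → (Fin N → ℝ) → ViscousPSystem.State,
        ViscousPSystem.IsGlobalClassicalSolution Γ a ε ν f (U₀ ε ν) U ∧
        ViscousPSystem.HasSolutionRegularity Γ ρ U ∧
        (∀ V : ℝ → ℝ → (Fin N → ℝ) → ViscousPSystem.State,
          ViscousPSystem.IsGlobalClassicalSolution Γ a ε ν f (U₀ ε ν) V →
          ViscousPSystem.HasSolutionRegularity Γ ρ V →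
          ∀ᵐ y ∂(MeasureTheory.volume.restrict Γ), ∀ x t : ℝ, 0 ≤ t → V x t y = U x t y) ∧
        MeasureTheory.eLpNorm (fun p : ℝ × ℝ × (Fin N → ℝ) => U p.1 p.2.1 p.2.2) ⊤
            (ViscousPSystem.spaceTimeMeasure Γ) ≤
          ENNReal.ofReal (ViscousPSystem.maxOpNorm (ViscousPSystem.riemannMatrix a)⁻¹ *
            (ViscousPSystem.supData Γ a U₀ +
              max |f (-(ViscousPSystem.supData Γ a U₀) / a)|
                |f (ViscousPSystem.supData Γ a U₀ / a)|)) := by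
  have hM := ViscousPSystem.isMaxwellianPair ha hf hf0 hsub
  have hbound {g : ℝ × (Fin N → ℝ) → ViscousPSystem.State} (h : ViscousPSystem.dataNorm Γ ρ g ≤ ENNReal.ofReal C) :
      MeasureTheory.eLpNorm g ⊤ (ViscousPSystem.spaceMeasure Γ) ≤ ENNReal.ofReal C := le_self_add.trans h
  have hC₀ (ε ν : ℝ) (hε : 0 < ε) (hν : 0 < ν) :=
    hbound ((le_self_add.trans le_self_add).trans (hC ε ν hε hν))
  intro ε ν hε hν
  have hC₁ := hbound ((le_add_self.trans le_self_add).trans (hC ε ν hε hν))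
  have hC₂ := hbound (le_add_self.trans (hC ε ν hε hν))
  obtain ⟨m₀, m₁, m₂⟩ := hmem ε ν hε hν
  -- The derivative bound is taken to be `max C 0`, which is the real value of `ENNReal.ofReal C`
  -- for any sign of `C`.
  obtain ⟨U, hU, rU, bU⟩ := ViscousPSystem.exists_solution ha hε hν (β := ViscousPSystem.supData Γ a U₀) ENNReal.toReal_nonneg
    (le_max_right C 0) hM (hd ε ν hε hν) (hdd ε ν hε hν) m₀ m₁ m₂
    (ViscousPSystem.ae_norm_mulVec_le_supData hC₀ hε hν) (ViscousPSystem.ae_norm_le_of_eLpNorm_top_le hC₁)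
    (ViscousPSystem.ae_norm_le_of_eLpNorm_top_le hC₂)
  refine ⟨U, hU, rU, fun V hV rV =>
    ViscousPSystem.solution_unique ha hε hν (ViscousPSystem.abs_sub_le_of_abs_deriv_le hf hsub)
      hU hV rU rV, ?_⟩
  rw [eLpNorm_exponent_top]
  refine eLpNormEssSup_le_of_ae_bound (Filter.Eventually.of_forall fun p => ?_)
  exact bU p.1 p.2.1 p.2.2
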